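/- Let $M$ be a compact smooth manifold without boundary of dimension $n$, and let $g$ be a smooth Riemannian metric on $M$ of volume $1$ with $\mathrm{Ric}_g=\lambda g$ for a constant $\lambda\in\mathbb{R}$. Let $\epsilon(g)$ be the space of infinitesimal Einstein deformations of $g$, i.e. the space of smooth symmetric $2$-tensors $h$ on $M$ with $\mathrm{tr}_g h=0$, $\delta_g h=0$ and $\Delta_E h=0$. Here $\Delta_E=\nabla^*\nabla-2\mathring{R}$, where $(\mathring{R}h)(X,Y)=\sum_i h(R_{X,e_i}Y,e_i)$ for a local orthonormal frame $(e_i)$ and the sign of the curvature tensor $R$ is such that $\mathring{R}g=\mathrm{Ric}_g$. For a metric $\tilde g$ on $M$ put $$E_{\tilde g}=\mathrm{Ric}_{\tilde g}-\frac1n\Big(\int_M \mathrm{scal}_{\tilde g}\,dV_{\tilde g}\Big)\tilde g,\qquad S_\lambda(\tilde g)=\int_M\big(\mathrm{scal}_{\tilde g}+(2-n)\lambda\big)\,dV_{\tilde g},$$ and for $h,k\in\epsilon(g)$ let $D^2E(h,k)=\frac{\partial^2}{\partial t\,\partial s}\big|_{t=s=0}E_{g+th+sk}$. Then for all $h,k,l\in\epsilon(g)$,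 the components of $E_{g+th+sk}$ at each point of $M$ are $C^2$ in $(t,s)$ near $0$, the function $\langle D^2E(h,k),l\rangle_g$ is integrable on $M$, and $S_\lambda(g+th+sk+rl)$ is $C^3$ in $(t,s,r)$ near $0$. The map $$\Phi:\epsilon(g)\times\epsilon(g)\times\epsilon(g)\to\mathbb{R},\qquad \Phi(h,k,l)=(D^2E(h,k),l)_{L^2}=\int_M\langle D^2E(h,k),l\rangle_g\,dV_g,$$ is trilinear and satisfies $$\Phi(h,k,l)=-\frac{\partial^3}{\partial t\,\partial s\,\partial r}\Big|_{t=s=r=0}S_\lambda(g+th+sk+rl),$$ and $\Phi$ is totally symmetric. In particular, if there are $h,k\in\epsilon(g)$ with $(D^2E(h,h),k)_{L^2}\neq0$, then there is $l\in\epsilon(g)$ with $(D^2E(l,l),l)_{L^2}\neq0$. -/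

import Mathlib

open scoped Manifold ContDiff Bundle

noncomputable section

/-! ### Tensor calculus in a coordinate domain of `ℝⁿ`

A field of `2`-tensors on (a part of) `ℝⁿ` is given by its components, a matrix valued function.
`G` always stands for the components of a metric. -/

/-- The Euclidean space on which `n`-dimensional manifolds are modelled. -/
abbrev Coord (n : ℕ) : Type := EuclideanSpace ℝ (Fin n)

/-- The coordinate partial derivative `∂ₖ f (y)`. -/
def pderiv {n : ℕ} (k : Fin n) (f : Coord n → ℝ) (y : Coord n) : ℝ :=
  fderiv ℝ f y (EuclideanSpace.single k 1)

/-- The Christoffel symbol `Γᵏᵢⱼ = ½ gᵏˡ (∂ᵢ gⱼₗ + ∂ⱼ gᵢₗ - ∂ₗ gᵢⱼ)`. -/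
def christoffel {n : ℕ} (G : Coord n → Matrix (Fin n) (Fin n) ℝ) (k i j : Fin n)
    (y : Coord n) : ℝ :=
  (1 / 2) * ∑ l, (G y)⁻¹ k l * (pderiv i (fun z => G z j l) y + pderiv j (fun z => G z i l) y
    - pderiv l (fun z => G z i j) y)

/-- The components `Rˡᵢⱼₖ` of the curvature tensor, with the convention
`R(∂ᵢ, ∂ⱼ) ∂ₖ = ∇ᵢ∇ⱼ ∂ₖ - ∇ⱼ∇ᵢ ∂ₖ = Rˡᵢⱼₖ ∂ₗ`. -/
def riemann {n : ℕ} (G : Coord n → Matrix (Fin n) (Fin n) ℝ) (l i j k : Fin n)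
    (y : Coord n) : ℝ :=
  pderiv i (christoffel G l j k) y - pderiv j (christoffel G l i k) y
    + ∑ m, (christoffel G l i m y * christoffel G m j k y
      - christoffel G l j m y * christoffel G m i k y)

/-- The components of the Ricci tensor `Ric(Y, Z) = tr (X ↦ R(X, Y) Z)`. -/
def ricciLocal {n : ℕ} (G : Coord n → Matrix (Fin n) (Fin n) ℝ) (y : Coord n) :
    Matrix (Fin n) (Fin n) ℝ :=
  Matrix.of fun j k => ∑ i, riemann G i i j k y

/-- The scalar curvature `gʲᵏ Ricⱼₖ`. -/
def scalLocal {n : ℕ} (G : Coord n → Matrix (Fin n) (Fin n) ℝ) (y : Coord n) : ℝ :=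
  ∑ j, ∑ k, (G y)⁻¹ j k * ricciLocal G y j k

/-- The components `(∇ₖ h)ᵢⱼ` of the covariant derivative of a `2`-tensor. -/
def covLocal {n : ℕ} (G h : Coord n → Matrix (Fin n) (Fin n) ℝ) (k i j : Fin n)
    (y : Coord n) : ℝ :=
  pderiv k (fun z => h z i j) y
    - ∑ l, (christoffel G l k i y * h y l j + christoffel G l k j y * h y i l)

/-- The components `(∇²ₘₖ h)ᵢⱼ` of the second covariant derivative of a `2`-tensor. -/
def covLocal₂ {n : ℕ} (G h : Coord n → Matrix (Fin n) (Fin n) ℝ) (m k i j : Fin n)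
    (y : Coord n) : ℝ :=
  pderiv m (covLocal G h k i j) y
    - ∑ l, (christoffel G l m k y * covLocal G h l i j y
      + christoffel G l m i y * covLocal G h k l j y
      + christoffel G l m j y * covLocal G h k i l y)

/-- The divergence `(δ h)ⱼ = - gᵏⁱ (∇ₖ h)ᵢⱼ`. -/
def divLocal {n : ℕ} (G h : Coord n → Matrix (Fin n) (Fin n) ℝ) (y : Coord n) (j : Fin n) : ℝ :=
  -∑ k, ∑ i, (G y)⁻¹ k i * covLocal G h k i j y

/-- The rough Laplacian `(∇*∇ h)ᵢⱼ = - gᵐᵏ (∇²ₘₖ h)ᵢⱼ`. -/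
def roughLaplacianLocal {n : ℕ} (G h : Coord n → Matrix (Fin n) (Fin n) ℝ) (y : Coord n) :
    Matrix (Fin n) (Fin n) ℝ :=
  Matrix.of fun i j => -∑ m, ∑ k, (G y)⁻¹ m k * covLocal₂ G h m k i j y

/-- The action of the curvature on `2`-tensors,
`(R̊ h)(X, Y) = - ∑ₐ h(R(X, eₐ) Y, eₐ)` for an orthonormal frame `(eₐ)` and the curvature `R` in
the convention of `riemann`; the sign is the one for which `R̊ g = Ric`. -/
def curvActionLocal {n : ℕ} (G h : Coord n → Matrix (Fin n) (Fin n) ℝ) (y : Coord n) :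
    Matrix (Fin n) (Fin n) ℝ :=
  Matrix.of fun i j => -∑ a, ∑ b, ∑ l, (G y)⁻¹ a b * riemann G l i a j y * h y l b

/-- The Einstein operator `Δ_E h = ∇*∇ h - 2 R̊ h`. -/
def einsteinOpLocal {n : ℕ} (G h : Coord n → Matrix (Fin n) (Fin n) ℝ) (y : Coord n) :
    Matrix (Fin n) (Fin n) ℝ :=
  roughLaplacianLocal G h y - (2 : ℝ) • curvActionLocal G h y

/-! ### Tensors on a manifold -/

section Manifold

variable {n : ℕ} {M : Type*} [TopologicalSpace M] [ChartedSpace (Coord n) M]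
  [IsManifold (𝓡 n) ∞ M]

set_option synthInstance.maxHeartbeats 200000 in
instance cotangentContinuousAdd (x : M) : ContinuousAdd (TangentSpace (𝓡 n) x →L[ℝ] ℝ) :=
  inferInstance

set_option synthInstance.maxHeartbeats 200000 in
instance cotangentIsTopologicalAddGroup (x : M) :
    IsTopologicalAddGroup (TangentSpace (𝓡 n) x →L[ℝ] ℝ) :=
  inferInstance

variable (n M) in
/-- Smooth fields of bilinear forms on the tangent spaces of `M`, i.e. smooth `2`-tensors. -/
abbrev Tensor2 : Type _ :=
  ContMDiffSection (𝓡 n) (Coord n →L[ℝ] Coord n →L[ℝ] ℝ) ∞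
    (fun x : M => TangentSpace (𝓡 n) x →L[ℝ] TangentSpace (𝓡 n) x →L[ℝ] ℝ)

instance Tensor2.addCommGroup : AddCommGroup (Tensor2 n M) :=
  ContMDiffSection.instAddCommGroup

instance Tensor2.module : Module ℝ (Tensor2 n M) := ContMDiffSection.instModule

variable (n M) in
/-- Smooth Riemannian metrics on `M`. -/
abbrev RiemMetric : Type _ :=
  Bundle.ContMDiffRiemannianMetric (𝓡 n) ∞ (Coord n) (fun x : M => TangentSpace (𝓡 n) x)

/-- A Riemannian metric, seen as a smooth `2`-tensor. -/
def metricTensor (g : RiemMetric n M) : Tensor2 n M := ⟨g.inner, g.contMDiff⟩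

/-- The components `h(∂ᵢ, ∂ⱼ)` of a tensor in the preferred chart at `p`, as functions of the
coordinates: `∂ᵢ` is the image of the standard basis vector under the differential of the inverse
chart. -/
def comps (h : Tensor2 n M) (p : M) (y : Coord n) : Matrix (Fin n) (Fin n) ℝ :=
  Matrix.of fun i j => h ((extChartAt (𝓡 n) p).symm y)
    (mfderiv 𝓘(ℝ, Coord n) (𝓡 n) (extChartAt (𝓡 n) p).symm y (EuclideanSpace.single i 1))
    (mfderiv 𝓘(ℝ, Coord n) (𝓡 n) (extChartAt (𝓡 n) p).symm y (EuclideanSpace.single j 1))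

/-! In the following, the value at a point `p` of a (not necessarily smooth) tensor is given by its
components in the basis `∂₁, …, ∂ₙ` of `T_p M` that belongs to the preferred chart at `p`. Such
tensors are functions `M → Matrix (Fin n) (Fin n) ℝ`. The definitions apply to all smooth tensors
`b` in the place of the metric, so that a metric can be varied in all directions; they have their
usual meaning where `b` is a Riemannian metric. -/

/-- The value of a smooth tensor at each point. -/
def tensorAt (h : Tensor2 n M) (p : M) : Matrix (Fin n) (Fin n) ℝ :=
  comps h p (extChartAt (𝓡 n) p p)

/-- The Ricci tensor of `b`. -/
def ricci (b : Tensor2 n M) (p : M) : Matrix (Fin n) (Fin n) ℝ :=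
  ricciLocal (comps b p) (extChartAt (𝓡 n) p p)

/-- The scalar curvature of `b`. -/
def scal (b : Tensor2 n M) (p : M) : ℝ :=
  scalLocal (comps b p) (extChartAt (𝓡 n) p p)

/-- The trace of `h` with respect to `b`. -/
def traceT (b h : Tensor2 n M) (p : M) : ℝ :=
  ∑ i, ∑ j, (tensorAt b p)⁻¹ i j * tensorAt h p i j

/-- The divergence of `h` with respect to `b`. -/
def divT (b h : Tensor2 n M) (p : M) : Fin n → ℝ :=
  divLocal (comps b p) (comps h p) (extChartAt (𝓡 n) p p)

/-- The Einstein operator `Δ_E h` with respect to `b`. -/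
def einsteinOp (b h : Tensor2 n M) (p : M) : Matrix (Fin n) (Fin n) ℝ :=
  einsteinOpLocal (comps b p) (comps h p) (extChartAt (𝓡 n) p p)

/-- The pointwise scalar product `⟨A, B⟩ = gⁱᵏ gʲˡ Aᵢⱼ Bₖₗ` of two `2`-tensors. -/
def innerT (b : Tensor2 n M) (A B : M → Matrix (Fin n) (Fin n) ℝ) (p : M) : ℝ :=
  ∑ i, ∑ j, ∑ k, ∑ l, (tensorAt b p)⁻¹ i k * (tensorAt b p)⁻¹ j l * A p i j * B p k l

section Measure

variable [MeasurableSpace M]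

/-- The Riemannian measure `√(det gᵢⱼ) dy` of the domain of the preferred chart at `p`. -/
def chartVol (b : Tensor2 n M) (p : M) : MeasureTheory.Measure M :=
  MeasureTheory.Measure.map (extChartAt (𝓡 n) p).symm
    ((MeasureTheory.volume.restrict (extChartAt (𝓡 n) p).target).withDensity
      fun y => ENNReal.ofReal (Real.sqrt (comps b p y).det))

/-- The Riemannian measure `dV`. The measures `chartVol b p`, extended by zero to `M`, agree
on the overlaps of the charts; their supremum is the measure that restricts to `chartVol b p` on the
domain of the chart at `p`, for each `p`. -/
def riemVol (b : Tensor2 n M) : MeasureTheory.Measure M := ⨆ p : M, chartVol b p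

/-- The `L²` product of two `2`-tensors. -/
def innerL2 (b : Tensor2 n M) (A B : M → Matrix (Fin n) (Fin n) ℝ) : ℝ :=
  ∫ p, innerT b A B p ∂(riemVol b)

/-- The Einstein--Hilbert functional with cosmological constant,
`S_λ(g) = ∫ (scal + (2 - n) λ) dV`. -/
def einsteinHilbert (lam : ℝ) (b : Tensor2 n M) : ℝ :=
  ∫ p, (scal b p + (2 - (n : ℝ)) * lam) ∂(riemVol b)

/-- The tensor `E_g = Ric_g - (1/n) (∫ scal_g dV_g) g`. -/
def einsteinTensor (b : Tensor2 n M) (p : M) : Matrix (Fin n) (Fin n) ℝ :=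
  ricci b p - ((1 / (n : ℝ)) * ∫ q, scal b q ∂(riemVol b)) • tensorAt b p

/-- The second derivative `D²_g E (h, k) = ∂²/∂t∂s E_{g + t h + s k}` at `t = s = 0`. -/
def D2E (b h k : Tensor2 n M) (p : M) : Matrix (Fin n) (Fin n) ℝ :=
  Matrix.of fun i j =>
    deriv (fun t : ℝ => deriv (fun s : ℝ => einsteinTensor (b + t • h + s • k) p i j) 0) 0

/-- The third variation `∂³/∂t∂s∂r S_λ(g + t h + s k + r l)` at `t = s = r = 0`. -/
def thirdVariation (lam : ℝ) (b h k l : Tensor2 n M) : ℝ :=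
  deriv (fun t : ℝ => deriv (fun s : ℝ => deriv (fun r : ℝ =>
    einsteinHilbert lam (b + t • h + s • k + r • l)) 0) 0) 0

end Measure

/-- `g` is an Einstein metric with Einstein constant `lam`: `Ric_g = lam g`. -/
def IsEinstein (g : RiemMetric n M) (lam : ℝ) : Prop :=
  ∀ p : M, ricci (metricTensor g) p = lam • tensorAt (metricTensor g) p

/-! ### The space of infinitesimal Einstein deformations

The lemmas below show that its defining equations are linear. -/

theorem comps_linear (a c : ℝ) (h k : Tensor2 n M) (p : M) :
    comps (a • h + c • k) p = a • comps h p + c • comps k p := by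
  ext y i j
  rfl

theorem comps_contDiffAt (h : Tensor2 n M) (p : M) (i j : Fin n) :
    ContDiffAt ℝ ∞ (fun y => comps h p y i j) (extChartAt (𝓡 n) p p) := by
  have hopen : IsOpen (extChartAt (𝓡 n) p).target := isOpen_extChartAt_target p
  have hmem : extChartAt (𝓡 n) p p ∈ (extChartAt (𝓡 n) p).target := mem_extChartAt_target p
  have hsm : ContMDiffOn 𝓘(ℝ, Coord n) (𝓡 n) ∞ (extChartAt (𝓡 n) p).symm
      (extChartAt (𝓡 n) p).target := contMDiffOn_extChartAt_symm p
  have hvec : ∀ i : Fin n, ContMDiffOn 𝓘(ℝ, Coord n) ((𝓡 n).prod 𝓘(ℝ, Coord n)) ∞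
      (fun y : Coord n => (⟨(extChartAt (𝓡 n) p).symm y,
        mfderiv 𝓘(ℝ, Coord n) (𝓡 n) (extChartAt (𝓡 n) p).symm y (EuclideanSpace.single i 1)⟩ :
          TangentBundle (𝓡 n) M)) (extChartAt (𝓡 n) p).target := by
    intro i
    have h1 := hsm.contMDiffOn_tangentMapWithin (m := ∞) (by simp) hopen.uniqueMDiffOn
    have h2 : ContMDiff 𝓘(ℝ, Coord n) (𝓘(ℝ, Coord n).prod 𝓘(ℝ, Coord n)) ∞
        (fun y : Coord n => (⟨y, EuclideanSpace.single i 1⟩ :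
          TangentBundle 𝓘(ℝ, Coord n) (Coord n))) := by
      exact contMDiff_vectorSpace_iff_contDiff.2 contDiff_const
    have h3 := h1.comp (h2.contMDiffOn (s := (extChartAt (𝓡 n) p).target)) (fun y hy => hy)
    refine h3.congr fun y hy => ?_
    simp only [Function.comp, tangentMapWithin]
    rw [mfderivWithin_of_isOpen hopen hy]
  have hh : ContMDiffOn 𝓘(ℝ, Coord n) ((𝓡 n).prod 𝓘(ℝ, Coord n →L[ℝ] Coord n →L[ℝ] ℝ)) ∞
      (fun y : Coord n => Bundle.TotalSpace.mk' (Coord n →L[ℝ] Coord n →L[ℝ] ℝ)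
        (E := fun x : M => TangentSpace (𝓡 n) x →L[ℝ] TangentSpace (𝓡 n) x →L[ℝ] ℝ)
        ((extChartAt (𝓡 n) p).symm y) (h ((extChartAt (𝓡 n) p).symm y)))
      (extChartAt (𝓡 n) p).target :=
    h.contMDiff.comp_contMDiffOn hsm
  have h4 : ContMDiffOn 𝓘(ℝ, Coord n) ((𝓡 n).prod 𝓘(ℝ)) ∞
      (fun y => Bundle.TotalSpace.mk' ℝ (E := Bundle.Trivial M ℝ)
        ((extChartAt (𝓡 n) p).symm y) (comps h p y i j)) (extChartAt (𝓡 n) p).target :=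
    ContMDiffOn.clm_bundle_apply₂ (F₁ := Coord n) (F₂ := Coord n) hh (hvec i) (hvec j)
  have h5 := h4.contMDiffAt (hopen.mem_nhds hmem)
  rw [Bundle.contMDiffAt_totalSpace] at h5
  exact h5.2.contDiffAt

theorem pderiv_linear (m : Fin n) (a c : ℝ) (f f' : Coord n → ℝ) (y : Coord n)
    (hf : DifferentiableAt ℝ f y) (hf' : DifferentiableAt ℝ f' y) :
    pderiv m (fun z => a * f z + c * f' z) y = a * pderiv m f y + c * pderiv m f' y := by
  have h1 := ((hf.hasFDerivAt.const_mul a).add (hf'.hasFDerivAt.const_mul c)).fderiv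
  unfold pderiv
  erw [h1]
  simp

theorem pderiv_contDiffAt (m : Fin n) (f : Coord n → ℝ) (y : Coord n)
    (hf : ContDiffAt ℝ ∞ f y) : ContDiffAt ℝ ∞ (pderiv m f) y :=
  (hf.fderiv_right (m := ∞) (by simp)).clm_apply contDiffAt_const

theorem inv_contDiffAt (G : Coord n → Matrix (Fin n) (Fin n) ℝ) (y : Coord n)
    (hG : ∀ i j, ContDiffAt ℝ ∞ (fun z => G z i j) y) (hdet : (G y).det ≠ 0) (i j : Fin n) :
    ContDiffAt ℝ ∞ (fun z => (G z)⁻¹ i j) y := by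
  have hd : ∀ F : Coord n → Matrix (Fin n) (Fin n) ℝ,
      (∀ i j, ContDiffAt ℝ ∞ (fun z => F z i j) y) → ContDiffAt ℝ ∞ (fun z => (F z).det) y := by
    intro F hF
    simp only [Matrix.det_apply]
    exact ContDiffAt.sum fun σ _ => (contDiffAt_prod fun k _ => hF _ _).const_smul _
  simp only [Matrix.inv_def, Matrix.smul_apply, Ring.inverse_eq_inv', smul_eq_mul,
    Matrix.adjugate_apply]
  refine ((hd G hG).inv hdet).mul (hd _ fun k l => ?_)
  simp only [Matrix.updateRow_apply]
  split_ifs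
  · exact contDiffAt_const
  · exact hG k l

theorem christoffel_contDiffAt (G : Coord n → Matrix (Fin n) (Fin n) ℝ) (y : Coord n)
    (hG : ∀ i j, ContDiffAt ℝ ∞ (fun z => G z i j) y) (hdet : (G y).det ≠ 0) (k i j : Fin n) :
    ContDiffAt ℝ ∞ (christoffel G k i j) y := by
  unfold christoffel
  refine contDiffAt_const.mul (ContDiffAt.sum fun l _ => (inv_contDiffAt G y hG hdet k l).mul ?_)
  exact ((pderiv_contDiffAt _ _ _ (hG _ _)).add (pderiv_contDiffAt _ _ _ (hG _ _))).sub
    (pderiv_contDiffAt _ _ _ (hG _ _))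

theorem covLocal_contDiffAt (G h : Coord n → Matrix (Fin n) (Fin n) ℝ) (y : Coord n)
    (hG : ∀ i j, ContDiffAt ℝ ∞ (fun z => G z i j) y) (hdet : (G y).det ≠ 0)
    (hh : ∀ i j, ContDiffAt ℝ ∞ (fun z => h z i j) y) (k i j : Fin n) :
    ContDiffAt ℝ ∞ (covLocal G h k i j) y := by
  unfold covLocal
  refine (pderiv_contDiffAt _ _ _ (hh _ _)).sub (ContDiffAt.sum fun l _ => ?_)
  exact ((christoffel_contDiffAt G y hG hdet _ _ _).mul (hh _ _)).add
    ((christoffel_contDiffAt G y hG hdet _ _ _).mul (hh _ _))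

theorem covLocal_linear (G h h' : Coord n → Matrix (Fin n) (Fin n) ℝ) (y : Coord n) (a c : ℝ)
    (hh : ∀ i j, DifferentiableAt ℝ (fun z => h z i j) y)
    (hh' : ∀ i j, DifferentiableAt ℝ (fun z => h' z i j) y) (k i j : Fin n) :
    covLocal G (a • h + c • h') k i j y = a * covLocal G h k i j y + c * covLocal G h' k i j y := by
  have h1 := pderiv_linear k a c _ _ y (hh i j) (hh' i j)
  simp only [covLocal, Pi.add_apply, Pi.smul_apply, Matrix.add_apply, Matrix.smul_apply,
    smul_eq_mul, h1, mul_sub, Finset.mul_sum]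
  rw [sub_add_sub_comm, ← Finset.sum_add_distrib]
  congr 1
  exact Finset.sum_congr rfl fun l _ => by ring

theorem covLocal₂_linear (G h h' : Coord n → Matrix (Fin n) (Fin n) ℝ) (y : Coord n) (a c : ℝ)
    (hG : ∀ i j, ContDiffAt ℝ ∞ (fun z => G z i j) y) (hdet : (G y).det ≠ 0)
    (hh : ∀ i j, ContDiffAt ℝ ∞ (fun z => h z i j) y)
    (hh' : ∀ i j, ContDiffAt ℝ ∞ (fun z => h' z i j) y) (m k i j : Fin n) :
    covLocal₂ G (a • h + c • h') m k i j y
      = a * covLocal₂ G h m k i j y + c * covLocal₂ G h' m k i j y := by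
  have ev : ∀ f : Coord n → ℝ, ContDiffAt ℝ ∞ f y → ∀ᶠ z in nhds y, DifferentiableAt ℝ f z :=
    fun f hf => ((hf.of_le (m := 1) (by simp)).eventually (by simp)).mono
      fun z hz => hz.differentiableAt (by simp)
  have ev1 : ∀ k i j, covLocal G (a • h + c • h') k i j
      =ᶠ[nhds y] fun z => a * covLocal G h k i j z + c * covLocal G h' k i j z := by
    intro k i j
    have e1 : ∀ᶠ z in nhds y, ∀ i j, DifferentiableAt ℝ (fun z => h z i j) z := by
      simp only [Filter.eventually_all]
      exact fun i j => ev _ (hh i j)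
    have e2 : ∀ᶠ z in nhds y, ∀ i j, DifferentiableAt ℝ (fun z => h' z i j) z := by
      simp only [Filter.eventually_all]
      exact fun i j => ev _ (hh' i j)
    filter_upwards [e1, e2] with z hz1 hz2
    exact covLocal_linear G h h' z a c hz1 hz2 k i j
  have h1 : pderiv m (covLocal G (a • h + c • h') k i j) y
      = a * pderiv m (covLocal G h k i j) y + c * pderiv m (covLocal G h' k i j) y := by
    rw [← pderiv_linear m a c _ _ y
      ((covLocal_contDiffAt G h y hG hdet hh k i j).differentiableAt (by simp))
      ((covLocal_contDiffAt G h' y hG hdet hh' k i j).differentiableAt (by simp))]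
    unfold pderiv
    rw [(ev1 k i j).fderiv_eq]
  simp only [covLocal₂, h1, fun k i j => (ev1 k i j).eq_of_nhds, mul_sub, Finset.mul_sum]
  rw [sub_add_sub_comm, ← Finset.sum_add_distrib]
  congr 1
  exact Finset.sum_congr rfl fun l _ => by ring

theorem tensorAt_apply (h : Tensor2 n M) (p : M) (i j : Fin n) :
    tensorAt h p i j = h p (EuclideanSpace.single i (1 : ℝ) : Coord n)
      (EuclideanSpace.single j (1 : ℝ) : Coord n) := by
  have h0 : mfderiv 𝓘(ℝ, Coord n) (𝓡 n) (extChartAt (𝓡 n) p).symm (extChartAt (𝓡 n) p p)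
      = ContinuousLinearMap.id ℝ (Coord n) := by
    have hopen : IsOpen (extChartAt (𝓡 n) p).target := isOpen_extChartAt_target p
    have hmem := mem_extChartAt_target (I := 𝓡 n) p
    have hd : MDifferentiableAt 𝓘(ℝ, Coord n) (𝓡 n) (extChartAt (𝓡 n) p).symm
        (extChartAt (𝓡 n) p p) :=
      ((contMDiffOn_extChartAt_symm (n := ∞) p).contMDiffAt
        (hopen.mem_nhds hmem)).mdifferentiableAt (by simp)
    rw [hd.mfderiv]
    have hev : writtenInExtChartAt 𝓘(ℝ, Coord n) (𝓡 n) (extChartAt (𝓡 n) p p)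
        (extChartAt (𝓡 n) p).symm =ᶠ[nhds (extChartAt (𝓡 n) p p)] id := by
      filter_upwards [hopen.mem_nhds hmem] with y hy
      simp only [writtenInExtChartAt, extChartAt_model_space_eq_id, Function.comp,
        PartialEquiv.refl_symm, PartialEquiv.refl_coe, id, extChartAt_to_inv]
      exact (extChartAt (𝓡 n) p).right_inv hy
    have := hev.fderiv_eq (𝕜 := ℝ)
    rw [fderiv_id] at this
    simp only [modelWithCornersSelf_coe, Set.range_id, fderivWithin_univ]
    exact this
  simp only [tensorAt, comps, Matrix.of_apply]
  rw [h0, extChartAt_to_inv]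
  rfl

theorem metric_det_ne_zero (g : RiemMetric n M) (p : M) : (tensorAt (metricTensor g) p).det ≠ 0 := by
  intro h0
  obtain ⟨v, hv, hv0⟩ := Matrix.exists_mulVec_eq_zero_iff.2 h0
  set w : Coord n := ∑ i, v i • (EuclideanSpace.single i (1 : ℝ) : Coord n) with hw
  have hwv : ∀ i, w i = v i := by
    intro i
    simp [hw, Finset.sum_apply, Pi.single_apply]
  have hw0 : w ≠ 0 := fun h => hv (funext fun i => by rw [← hwv i, h]; rfl)
  have hpos := g.pos p w hw0
  let B : Coord n →L[ℝ] Coord n →L[ℝ] ℝ := g.inner p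
  have hB : B w w = v ⬝ᵥ (tensorAt (metricTensor g) p).mulVec v := by
    simp only [dotProduct, Matrix.mulVec, tensorAt_apply]
    rw [hw]
    simp only [map_sum, map_smul, sum_apply, smul_apply,
      smul_eq_mul, Finset.mul_sum]
    rw [Finset.sum_comm]
    refine Finset.sum_congr rfl fun i _ => Finset.sum_congr rfl fun j _ => ?_
    change v j * (v i * B _ _) = v i * (B _ _ * v j)
    ring
  rw [hv0, dotProduct_zero] at hB
  exact hpos.ne' hB

theorem traceT_linear (b h k : Tensor2 n M) (a c : ℝ) (p : M) :
    traceT b (a • h + c • k) p = a * traceT b h p + c * traceT b k p := by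
  simp only [traceT, tensorAt, comps_linear, Pi.add_apply, Pi.smul_apply, Matrix.add_apply,
    Matrix.smul_apply, smul_eq_mul, Finset.mul_sum, ← Finset.sum_add_distrib]
  exact Finset.sum_congr rfl fun i _ => Finset.sum_congr rfl fun j _ => by ring

theorem divT_linear (b h k : Tensor2 n M) (a c : ℝ) (p : M) (j : Fin n) :
    divT b (a • h + c • k) p j = a * divT b h p j + c * divT b k p j := by
  have hd : ∀ (h : Tensor2 n M) i j, DifferentiableAt ℝ (fun y => comps h p y i j)
      (extChartAt (𝓡 n) p p) := fun h i j => (comps_contDiffAt h p i j).differentiableAt (by simp)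
  simp only [divT, divLocal, comps_linear, covLocal_linear _ _ _ _ a c (hd h) (hd k), mul_neg,
    Finset.mul_sum, ← neg_add, ← Finset.sum_add_distrib]
  congr 1
  exact Finset.sum_congr rfl fun i _ => Finset.sum_congr rfl fun j _ => by ring

theorem einsteinOp_linear (g : RiemMetric n M) (h k : Tensor2 n M) (a c : ℝ) (p : M) :
    einsteinOp (metricTensor g) (a • h + c • k) p
      = a • einsteinOp (metricTensor g) h p + c • einsteinOp (metricTensor g) k p := by
  have h2 := covLocal₂_linear (comps (metricTensor g) p) (comps h p) (comps k p)
    (extChartAt (𝓡 n) p p) a c (comps_contDiffAt _ p) (metric_det_ne_zero g p)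
    (comps_contDiffAt _ p) (comps_contDiffAt _ p)
  have h3 : roughLaplacianLocal (comps (metricTensor g) p) (a • comps h p + c • comps k p)
      (extChartAt (𝓡 n) p p)
      = a • roughLaplacianLocal (comps (metricTensor g) p) (comps h p) (extChartAt (𝓡 n) p p)
        + c • roughLaplacianLocal (comps (metricTensor g) p) (comps k p)
          (extChartAt (𝓡 n) p p) := by
    ext i j
    simp only [roughLaplacianLocal, h2, Matrix.of_apply, Matrix.add_apply, Matrix.smul_apply,
      smul_eq_mul, mul_neg, Finset.mul_sum, ← neg_add, ← Finset.sum_add_distrib]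
    congr 1
    exact Finset.sum_congr rfl fun i _ => Finset.sum_congr rfl fun j _ => by ring
  have h4 : curvActionLocal (comps (metricTensor g) p) (a • comps h p + c • comps k p)
      (extChartAt (𝓡 n) p p)
      = a • curvActionLocal (comps (metricTensor g) p) (comps h p) (extChartAt (𝓡 n) p p)
        + c • curvActionLocal (comps (metricTensor g) p) (comps k p)
          (extChartAt (𝓡 n) p p) := by
    ext i j
    simp only [curvActionLocal, Pi.add_apply, Pi.smul_apply, Matrix.of_apply, Matrix.add_apply,
      Matrix.smul_apply, smul_eq_mul, mul_neg, Finset.mul_sum, ← neg_add,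
      ← Finset.sum_add_distrib]
    congr 1
    exact Finset.sum_congr rfl fun i _ => Finset.sum_congr rfl fun j _ =>
      Finset.sum_congr rfl fun l _ => by ring
  simp only [einsteinOp, einsteinOpLocal, comps_linear, h3, h4]
  module

/-- `h` is an infinitesimal Einstein deformation of `g`: a symmetric, trace-free and
divergence-free tensor with `Δ_E h = 0`. -/
structure IsInfinitesimalDeformation (g : RiemMetric n M) (h : Tensor2 n M) : Prop where
  symm : ∀ (p : M) (v w : TangentSpace (𝓡 n) p), h p v w = h p w v
  trace_eq_zero : ∀ p : M, traceT (metricTensor g) h p = 0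
  div_eq_zero : ∀ p : M, divT (metricTensor g) h p = 0
  einsteinOp_eq_zero : ∀ p : M, einsteinOp (metricTensor g) h p = 0

theorem IsInfinitesimalDeformation.linear {g : RiemMetric n M} {h k : Tensor2 n M}
    (hh : IsInfinitesimalDeformation g h) (hk : IsInfinitesimalDeformation g k) (a c : ℝ) :
    IsInfinitesimalDeformation g (a • h + c • k) where
  symm p v w := by
    change a * h p v w + c * k p v w = a * h p w v + c * k p w v
    rw [hh.symm, hk.symm]
  trace_eq_zero p := by rw [traceT_linear, hh.trace_eq_zero, hk.trace_eq_zero]; simp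
  div_eq_zero p := by
    funext j
    rw [divT_linear, hh.div_eq_zero, hk.div_eq_zero]
    simp
  einsteinOp_eq_zero p := by
    rw [einsteinOp_linear, hh.einsteinOp_eq_zero, hk.einsteinOp_eq_zero]
    simp

theorem IsInfinitesimalDeformation.zero (g : RiemMetric n M) :
    IsInfinitesimalDeformation g 0 where
  symm _ _ _ := rfl
  trace_eq_zero p := by
    have := traceT_linear (metricTensor g) 0 0 0 0 p
    simpa using this
  div_eq_zero p := by
    funext j
    have := divT_linear (metricTensor g) 0 0 0 0 p j
    simpa using this
  einsteinOp_eq_zero p := by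
    have := einsteinOp_linear g 0 0 0 0 p
    simpa using this

/-- The space `ε(g)` of infinitesimal Einstein deformations: the kernel of the Einstein operator on
the symmetric trace-free and divergence-free tensors. -/
def infDef (g : RiemMetric n M) : Submodule ℝ (Tensor2 n M) where
  carrier := {h | IsInfinitesimalDeformation g h}
  add_mem' {h k} hh hk := by simpa using hh.linear hk 1 1
  zero_mem' := IsInfinitesimalDeformation.zero g
  smul_mem' a h hh := by simpa using hh.linear hh a 0

end Manifold

end

/-!
The form `Φ(h, k, l) = (D²E(h, k), l)` is symmetric because it is, up to sign, a third derivative of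
the function `S_λ` on a finite-dimensional affine family of metrics `g + L v`.

The first variation of `S_λ` (`fderiv_einsteinHilbert`) is `-∫ ⟨G, l⟩ dV` with the Euler--Lagrange
tensor `G = Ric - ½ (scal + (2 - n) λ) g`. It comes from the pointwise formula for the derivative of
the density `scal √det g` (`fderiv_scal_density_eq`), in which the trace of the derivative of the
Ricci tensor is a divergence (`IsFamilyOn.varField_divergence`) and integrates to zero
(`IsVectorField.sum_integral_divergence_eq_zero`).

At the Einstein metric, `G` vanishes. An infinitesimal Einstein deformation `h` satisfies
`D Ric (h) = λ h`: in the formula for the derivative of the Ricci tensor of a trace-free and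
divergence-free variation, commuting covariant derivatives produces the curvature terms of the
Einstein operator (`IsFamilyOn.matDeriv_famRicci_eq`). Hence the scalar curvature and the total
scalar curvature are constant to first order, and `G` vanishes to first order in the directions of
`ε(g)` (`matDeriv_eulerTensor_zero`). So the third derivative of `S_λ` is `-∫ ⟨∂²G(h, k), l⟩ dV`.
The tensors `∂²G(h, k)` and `D²E(h, k)` both differ from `∂²Ric(h, k)` by multiples of `g`
(`matDeriv_matDeriv_eulerTensor_zero`, `D2E_eq`), and these are orthogonal to the trace-free tensor
`l`. This identifies `Φ` with minus the third variation (`innerL2_D2E`). Symmetry in all arguments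
follows since derivatives commute, trilinearity since the pairing is linear in `l`, and the last
claim by polarization (`exists_diag_ne_zero`).

All the tensors are treated by their matrices of components in charts. The Christoffel symbols form
connection matrices `Aᵢ`, and the curvature is `∂ᵢ Aⱼ - ∂ⱼ Aᵢ + [Aᵢ, Aⱼ]`. The definitions of the
global objects refer to the centre of the preferred chart at each point, so the transformation laws
under changes of coordinates (`IsPullbackOn.ricci_eq`, `IsPullbackOn.div_eq`,
`IsFamPullbackOn.jac_mul_varField`) are needed to express these objects in one chart. Integrals over
`M` are written as sums of integrals over `ℝⁿ` with a partition of unity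
(`ChartPartition.integral_eq`), which are then differentiated with respect to the parameter
(`contDiffAt_integral_cutoff`, `fderiv_integral_cutoff`).
-/

open scoped Manifold ContDiff Bundle

noncomputable section

namespace EinsteinDeformation

open Matrix Filter Topology

/-! ### Differentiation of matrix-valued functions -/

section MatrixCalculus

variable {n : ℕ} {E : Type*} [NormedAddCommGroup E] [NormedSpace ℝ E]

/-- Entrywise smoothness of a matrix-valued function at a point. -/
def MatSmoothAt (F : E → Matrix (Fin n) (Fin n) ℝ) (x : E) : Prop :=
  ∀ i j, ContDiffAt ℝ ∞ (fun z => F z i j) x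

/-- The entrywise derivative of a matrix-valued function at `x` in the direction `v`. -/
def matDeriv (F : E → Matrix (Fin n) (Fin n) ℝ) (x v : E) : Matrix (Fin n) (Fin n) ℝ :=
  Matrix.of fun i j => fderiv ℝ (fun z => F z i j) x v

theorem _root_.ContDiffAt.diffAt {F : Type*} [NormedAddCommGroup F] [NormedSpace ℝ F] {f : E → F}
    {x : E} (h : ContDiffAt ℝ ∞ f x) : DifferentiableAt ℝ f x := h.differentiableAt (by simp)

namespace MatSmoothAt

variable {F H : E → Matrix (Fin n) (Fin n) ℝ} {x : E}

theorem congr (hF : MatSmoothAt F x) (h : H =ᶠ[𝓝 x] F) : MatSmoothAt H x := fun i j =>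
  (hF i j).congr_of_eventuallyEq (h.mono fun z hz => by simp only [hz])

theorem const (A : Matrix (Fin n) (Fin n) ℝ) : MatSmoothAt (fun _ : E => A) x :=
  fun _ _ => contDiffAt_const

theorem add (hF : MatSmoothAt F x) (hH : MatSmoothAt H x) :
    MatSmoothAt (fun z => F z + H z) x := fun i j => (hF i j).add (hH i j)

theorem sub (hF : MatSmoothAt F x) (hH : MatSmoothAt H x) :
    MatSmoothAt (fun z => F z - H z) x := fun i j => (hF i j).sub (hH i j)

theorem smul {f : E → ℝ} (hf : ContDiffAt ℝ ∞ f x) (hF : MatSmoothAt F x) :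
    MatSmoothAt (fun z => f z • F z) x := fun i j => hf.mul (hF i j)

theorem sum {ι : Type*} {s : Finset ι} {F : ι → E → Matrix (Fin n) (Fin n) ℝ}
    (hF : ∀ a ∈ s, MatSmoothAt (F a) x) : MatSmoothAt (fun z => ∑ a ∈ s, F a z) x := by
  intro i j
  simp only [Matrix.sum_apply]
  exact ContDiffAt.sum fun a ha => hF a ha i j

theorem mul (hF : MatSmoothAt F x) (hH : MatSmoothAt H x) :
    MatSmoothAt (fun z => F z * H z) x := by
  intro i j
  simp only [Matrix.mul_apply]
  exact ContDiffAt.sum fun a _ => (hF i a).mul (hH a j)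

theorem transpose (hF : MatSmoothAt F x) : MatSmoothAt (fun z => (F z)ᵀ) x := fun i j => hF j i

theorem trace (hF : MatSmoothAt F x) : ContDiffAt ℝ ∞ (fun z => (F z).trace) x :=
  ContDiffAt.sum fun i _ => hF i i

theorem det (hF : MatSmoothAt F x) : ContDiffAt ℝ ∞ (fun z => (F z).det) x := by
  simp only [Matrix.det_apply]
  exact ContDiffAt.sum fun σ _ => (contDiffAt_prod fun k _ => hF _ _).const_smul _

theorem inv (hF : MatSmoothAt F x) (hdet : (F x).det ≠ 0) :
    MatSmoothAt (fun z => (F z)⁻¹) x := by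
  intro i j
  simp only [Matrix.inv_def, Matrix.smul_apply, Ring.inverse_eq_inv', smul_eq_mul,
    Matrix.adjugate_apply]
  refine (hF.det.inv hdet).mul (MatSmoothAt.det fun k l => ?_)
  simp only [Matrix.updateRow_apply]
  split_ifs
  · exact contDiffAt_const
  · exact hF k l

theorem diff (hF : MatSmoothAt F x) (i j : Fin n) : DifferentiableAt ℝ (fun z => F z i j) x :=
  (hF i j).diffAt

theorem comp {E' : Type*} [NormedAddCommGroup E'] [NormedSpace ℝ E'] {f : E' → E} {y : E'}
    (hF : MatSmoothAt F (f y)) (hf : ContDiffAt ℝ ∞ f y) : MatSmoothAt (fun z => F (f z)) y :=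
  fun i j => ContDiffAt.comp y (hF i j) hf

theorem matDeriv (hF : MatSmoothAt F x) (v : E) : MatSmoothAt (fun z => matDeriv F z v) x :=
  fun i j => ((hF i j).fderiv_right (m := ∞) (by simp)).clm_apply contDiffAt_const

end MatSmoothAt

variable {F H : E → Matrix (Fin n) (Fin n) ℝ} {x : E}

theorem matDeriv_congr (h : H =ᶠ[𝓝 x] F) (v : E) : matDeriv H x v = matDeriv F x v := by
  ext i j
  have : (fun z => H z i j) =ᶠ[𝓝 x] fun z => F z i j := h.mono fun z hz => by simp only [hz]
  simp only [matDeriv, Matrix.of_apply, this.fderiv_eq]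

theorem matDeriv_add (hF : MatSmoothAt F x) (hH : MatSmoothAt H x) (v : E) :
    matDeriv (fun z => F z + H z) x v = matDeriv F x v + matDeriv H x v := by
  ext i j
  simp only [matDeriv, Matrix.of_apply, Matrix.add_apply]
  rw [fderiv_fun_add (hF.diff i j) (hH.diff i j)]
  rfl

theorem matDeriv_sub (hF : MatSmoothAt F x) (hH : MatSmoothAt H x) (v : E) :
    matDeriv (fun z => F z - H z) x v = matDeriv F x v - matDeriv H x v := by
  ext i j
  simp only [matDeriv, Matrix.of_apply, Matrix.sub_apply]
  rw [fderiv_fun_sub (hF.diff i j) (hH.diff i j)]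
  rfl

theorem matDeriv_sum {ι : Type*} {s : Finset ι} {F : ι → E → Matrix (Fin n) (Fin n) ℝ}
    (hF : ∀ a ∈ s, MatSmoothAt (F a) x) (v : E) :
    matDeriv (fun z => ∑ a ∈ s, F a z) x v = ∑ a ∈ s, matDeriv (F a) x v := by
  ext i j
  simp only [matDeriv, Matrix.of_apply, Matrix.sum_apply]
  rw [fderiv_fun_sum fun a ha => (hF a ha).diff i j]
  simp

theorem matDeriv_smul {f : E → ℝ} (hf : ContDiffAt ℝ ∞ f x) (hF : MatSmoothAt F x) (v : E) :
    matDeriv (fun z => f z • F z) x v = fderiv ℝ f x v • F x + f x • matDeriv F x v := by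
  ext i j
  simp only [matDeriv, Matrix.of_apply, Matrix.smul_apply, Matrix.add_apply, smul_eq_mul]
  rw [fderiv_fun_mul hf.diffAt (hF.diff i j)]
  simp only [_root_.add_apply, _root_.smul_apply, smul_eq_mul]
  ring

theorem matDeriv_mul (hF : MatSmoothAt F x) (hH : MatSmoothAt H x) (v : E) :
    matDeriv (fun z => F z * H z) x v = matDeriv F x v * H x + F x * matDeriv H x v := by
  ext i j
  simp only [matDeriv, Matrix.of_apply, Matrix.mul_apply, Matrix.add_apply]
  rw [fderiv_fun_sum fun a _ => (hF.diff i a).fun_mul (hH.diff a j), ← Finset.sum_add_distrib]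
  simp only [_root_.sum_apply]
  refine Finset.sum_congr rfl fun a _ => ?_
  rw [fderiv_fun_mul (hF.diff i a) (hH.diff a j)]
  simp only [_root_.add_apply, _root_.smul_apply, smul_eq_mul]
  ring

theorem matDeriv_transpose (v : E) : matDeriv (fun z => (F z)ᵀ) x v = (matDeriv F x v)ᵀ := rfl

theorem matDeriv_const (A : Matrix (Fin n) (Fin n) ℝ) (v : E) :
    matDeriv (fun _ : E => A) x v = 0 := by
  ext i j
  simp [matDeriv]

theorem fderiv_trace (hF : MatSmoothAt F x) (v : E) :
    fderiv ℝ (fun z => (F z).trace) x v = (matDeriv F x v).trace := by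
  simp only [Matrix.trace, Matrix.diag]
  rw [fderiv_fun_sum fun a _ => hF.diff a a]
  simp [matDeriv]

theorem det_eventually_ne_zero (hF : MatSmoothAt F x) (hdet : (F x).det ≠ 0) :
    ∀ᶠ z in 𝓝 x, (F z).det ≠ 0 :=
  hF.det.continuousAt.eventually_ne hdet

theorem matDeriv_inv (hF : MatSmoothAt F x) (hdet : (F x).det ≠ 0) (v : E) :
    matDeriv (fun z => (F z)⁻¹) x v = -((F x)⁻¹ * matDeriv F x v * (F x)⁻¹) := by
  have h1 : (fun z => F z * (F z)⁻¹) =ᶠ[𝓝 x] fun _ => 1 := by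
    filter_upwards [det_eventually_ne_zero hF hdet] with z hz
    exact Matrix.mul_nonsing_inv _ hz.isUnit
  have h2 := matDeriv_congr h1 v
  rw [matDeriv_const, matDeriv_mul hF (hF.inv hdet)] at h2
  have h3 : (F x)⁻¹ * F x = 1 := Matrix.nonsing_inv_mul _ hdet.isUnit
  have h4 : (F x)⁻¹ * (matDeriv F x v * (F x)⁻¹ + F x * matDeriv (fun z => (F z)⁻¹) x v) = 0 := by
    rw [h2, mul_zero]
  rw [mul_add, ← mul_assoc _ (F x), h3, one_mul] at h4
  rw [eq_neg_of_add_eq_zero_right h4, mul_assoc]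

/-- Jacobi's formula for the derivative of a determinant. -/
theorem fderiv_det (hF : MatSmoothAt F x) (hdet : (F x).det ≠ 0) (v : E) :
    fderiv ℝ (fun z => (F z).det) x v = (F x).det * ((F x)⁻¹ * matDeriv F x v).trace := by
  have h1 : fderiv ℝ (fun z => (F z).det) x v
      = ∑ i, ((F x).updateCol i fun k => matDeriv F x v k i).det := by
    have hd : ∀ σ : Equiv.Perm (Fin n), DifferentiableAt ℝ (fun z => ∏ i, F z (σ i) i) x :=
      fun σ => (contDiffAt_prod fun k _ => hF _ _).diffAt
    simp only [Matrix.det_apply']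
    rw [fderiv_fun_sum fun σ _ => (hd σ).const_mul _, Finset.sum_comm]
    simp only [_root_.sum_apply]
    refine Finset.sum_congr rfl fun σ _ => ?_
    rw [fderiv_const_mul (hd σ), ← Finset.mul_sum]
    simp only [_root_.smul_apply, smul_eq_mul]
    congr 1
    have h2 := HasFDerivAt.finsetProd (u := Finset.univ) (g := fun i z => F z (σ i) i) (x := x)
      fun i _ => (hF.diff (σ i) i).hasFDerivAt
    rw [h2.fderiv]
    simp only [_root_.sum_apply, _root_.smul_apply, smul_eq_mul]
    refine Finset.sum_congr rfl fun i _ => ?_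
    rw [← Finset.mul_prod_erase _ _ (Finset.mem_univ i), mul_comm]
    congr 1
    · simp [matDeriv]
    · refine Finset.prod_congr rfl fun j hj => ?_
      simp [Finset.ne_of_mem_erase hj]
  have h2 : (F x).adjugate = (F x).det • (F x)⁻¹ := by
    rw [Matrix.inv_def, smul_smul, Ring.inverse_eq_inv', mul_inv_cancel₀ hdet, one_smul]
  rw [h1, ← smul_eq_mul, ← Matrix.trace_smul, ← smul_mul_assoc, ← h2]
  simp only [Matrix.trace, Matrix.diag, ← Matrix.cramer_apply, Matrix.cramer_eq_adjugate_mulVec]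
  rfl

theorem fderiv_fderiv_comm {f : E → ℝ} (hf : ContDiffAt ℝ ∞ f x) (v w : E) :
    fderiv ℝ (fun z => fderiv ℝ f z v) x w = fderiv ℝ (fun z => fderiv ℝ f z w) x v := by
  have hs := hf.isSymmSndFDerivAt
    (by simpa using (WithTop.coe_le_coe.2 le_top : ((2 : ℕ∞) : WithTop ℕ∞) ≤ ∞))
  have hd : DifferentiableAt ℝ (fderiv ℝ f) x := (hf.fderiv_right (m := ∞) (by simp)).diffAt
  have h1 : ∀ v w : E, fderiv ℝ (fun z => fderiv ℝ f z v) x w = fderiv ℝ (fderiv ℝ f) x w v := by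
    intro v w
    rw [fderiv_clm_apply hd (differentiableAt_const v)]
    simp
  rw [h1, h1]
  exact hs w v

theorem matDeriv_comm (hF : MatSmoothAt F x) (v w : E) :
    matDeriv (fun z => matDeriv F z v) x w = matDeriv (fun z => matDeriv F z w) x v := by
  ext i j
  exact fderiv_fderiv_comm (hF i j) v w

end MatrixCalculus

/-! ### The Levi-Civita connection and its curvature as matrices -/

section LocalGeometry

variable {n : ℕ}

/-- The entrywise partial derivative `∂ₖ F` of a matrix-valued function. -/
abbrev matPderiv (k : Fin n) (F : Coord n → Matrix (Fin n) (Fin n) ℝ) (y : Coord n) :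
    Matrix (Fin n) (Fin n) ℝ :=
  matDeriv F y (EuclideanSpace.single k 1)

/-- The connection matrix `Aᵢ`, with entries `(Aᵢ)ᵏⱼ = Γᵏᵢⱼ`. -/
def conn (G : Coord n → Matrix (Fin n) (Fin n) ℝ) (i : Fin n) (y : Coord n) :
    Matrix (Fin n) (Fin n) ℝ :=
  Matrix.of fun k j => christoffel G k i j y

/-- The curvature matrix `Fᵢⱼ`, with entries `(Fᵢⱼ)ˡₖ = Rˡᵢⱼₖ`. -/
def curv (G : Coord n → Matrix (Fin n) (Fin n) ℝ) (i j : Fin n) (y : Coord n) :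
    Matrix (Fin n) (Fin n) ℝ :=
  Matrix.of fun l k => riemann G l i j k y

/-- The covariant derivative `∇ₖ h` as a matrix. -/
def cov (G h : Coord n → Matrix (Fin n) (Fin n) ℝ) (k : Fin n) (y : Coord n) :
    Matrix (Fin n) (Fin n) ℝ :=
  Matrix.of fun i j => covLocal G h k i j y

/-- The second covariant derivative `∇²ₘₖ h` as a matrix. -/
def cov₂ (G h : Coord n → Matrix (Fin n) (Fin n) ℝ) (m k : Fin n) (y : Coord n) :
    Matrix (Fin n) (Fin n) ℝ :=
  Matrix.of fun i j => covLocal₂ G h m k i j y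

theorem curv_eq (G : Coord n → Matrix (Fin n) (Fin n) ℝ) (i j : Fin n) (y : Coord n) :
    curv G i j y = matPderiv i (conn G j) y - matPderiv j (conn G i) y
      + (conn G i y * conn G j y - conn G j y * conn G i y) := by
  ext l k
  simp only [curv, riemann, conn, matDeriv, Matrix.of_apply, Matrix.add_apply, Matrix.sub_apply,
    Matrix.mul_apply, Finset.sum_sub_distrib]
  rfl

theorem ricciLocal_apply (G : Coord n → Matrix (Fin n) (Fin n) ℝ) (y : Coord n) (j k : Fin n) :
    ricciLocal G y j k = ∑ i, curv G i j y i k := rfl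

theorem curv_swap (G : Coord n → Matrix (Fin n) (Fin n) ℝ) (i j : Fin n) (y : Coord n) :
    curv G i j y = -curv G j i y := by
  rw [curv_eq, curv_eq]
  abel

theorem cov_eq (G h : Coord n → Matrix (Fin n) (Fin n) ℝ) (k : Fin n) (y : Coord n) :
    cov G h k y = matPderiv k h y - (conn G k y)ᵀ * h y - h y * conn G k y := by
  ext i j
  simp only [cov, covLocal, conn, matDeriv, Matrix.of_apply, Matrix.sub_apply, Matrix.mul_apply,
    Matrix.transpose_apply, Finset.sum_add_distrib, sub_sub]
  simp only [mul_comm (h y _ _)]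
  rfl

theorem cov₂_eq (G h : Coord n → Matrix (Fin n) (Fin n) ℝ) (m k : Fin n) (y : Coord n) :
    cov₂ G h m k y = matPderiv m (cov G h k) y - (conn G m y)ᵀ * cov G h k y
      - cov G h k y * conn G m y - ∑ l, christoffel G l m k y • cov G h l y := by
  ext i j
  simp only [cov₂, covLocal₂, cov, conn, matDeriv, Matrix.of_apply, Matrix.sub_apply,
    Matrix.mul_apply, Matrix.transpose_apply, Finset.sum_add_distrib, Matrix.sum_apply,
    Matrix.smul_apply, smul_eq_mul]
  simp only [mul_comm (covLocal _ _ _ _ _ _)]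
  change pderiv _ _ _ - _ = pderiv _ _ _ - _ - _ - _
  ring

/-- `G` is a smooth field of nondegenerate symmetric matrices on the open set `U`. -/
structure IsMetricOn (G : Coord n → Matrix (Fin n) (Fin n) ℝ) (U : Set (Coord n)) : Prop where
  isOpen : IsOpen U
  smooth : ∀ y ∈ U, MatSmoothAt G y
  symm : ∀ y ∈ U, (G y)ᵀ = G y
  det_ne : ∀ y ∈ U, (G y).det ≠ 0

namespace IsMetricOn

variable {G : Coord n → Matrix (Fin n) (Fin n) ℝ} {U : Set (Coord n)} {y : Coord n}

theorem mul_inv (hG : IsMetricOn G U) (hy : y ∈ U) : G y * (G y)⁻¹ = 1 :=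
  Matrix.mul_nonsing_inv _ (hG.det_ne y hy).isUnit

theorem inv_mul (hG : IsMetricOn G U) (hy : y ∈ U) : (G y)⁻¹ * G y = 1 :=
  Matrix.nonsing_inv_mul _ (hG.det_ne y hy).isUnit

theorem inv_symm (hG : IsMetricOn G U) (hy : y ∈ U) : ((G y)⁻¹)ᵀ = (G y)⁻¹ := by
  rw [Matrix.transpose_nonsing_inv, hG.symm y hy]

theorem mem_nhds (hG : IsMetricOn G U) (hy : y ∈ U) : U ∈ 𝓝 y := hG.isOpen.mem_nhds hy

theorem matPderiv_symm (hG : IsMetricOn G U) (hy : y ∈ U) (k : Fin n) :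
    (matPderiv k G y)ᵀ = matPderiv k G y := by
  rw [matPderiv, ← matDeriv_transpose]
  exact matDeriv_congr (by filter_upwards [hG.mem_nhds hy] with z hz using hG.symm z hz) _

theorem conn_smooth (hG : IsMetricOn G U) (hy : y ∈ U) (i : Fin n) : MatSmoothAt (conn G i) y :=
  fun k j => christoffel_contDiffAt G y (hG.smooth y hy) (hG.det_ne y hy) k i j

theorem christoffel_symm (hG : IsMetricOn G U) (hy : y ∈ U) (k i j : Fin n) :
    christoffel G k i j y = christoffel G k j i y := by
  have h : ∀ l, pderiv l (fun z => G z i j) y = pderiv l (fun z => G z j i) y := fun l =>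
    congrFun (congrFun (hG.matPderiv_symm hy l) j) i
  simp only [christoffel, h]
  congr 1
  exact Finset.sum_congr rfl fun l _ => by ring

theorem conn_symm (hG : IsMetricOn G U) (hy : y ∈ U) (k i j : Fin n) :
    conn G i y k j = conn G j y k i := hG.christoffel_symm hy k i j

/-- The Christoffel symbols of the first kind. -/
theorem lower_conn (hG : IsMetricOn G U) (hy : y ∈ U) (i l j : Fin n) :
    (G y * conn G i y) l j = (1 / 2) * (matPderiv i G y j l + matPderiv j G y i l
      - matPderiv l G y i j) := by
  have h : conn G i y = (G y)⁻¹ * Matrix.of fun l j => (1 / 2) * (matPderiv i G y j l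
      + matPderiv j G y i l - matPderiv l G y i j) := by
    ext k j
    simp only [conn, christoffel, Matrix.of_apply, Matrix.mul_apply, Finset.mul_sum]
    refine Finset.sum_congr rfl fun l _ => ?_
    simp only [matDeriv, pderiv, Matrix.of_apply]
    ring
  rw [h, ← mul_assoc, hG.mul_inv hy, one_mul, Matrix.of_apply]

theorem matPderiv_eq (hG : IsMetricOn G U) (hy : y ∈ U) (i : Fin n) :
    matPderiv i G y = (conn G i y)ᵀ * G y + G y * conn G i y := by
  have h1 : (conn G i y)ᵀ * G y = (G y * conn G i y)ᵀ := by
    rw [Matrix.transpose_mul, hG.symm y hy]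
  have h : ∀ k a b, matPderiv k G y a b = matPderiv k G y b a := fun k a b =>
    congrFun (congrFun (hG.matPderiv_symm hy k) b) a
  ext a b
  rw [h1, Matrix.add_apply, Matrix.transpose_apply, hG.lower_conn hy, hG.lower_conn hy,
    h i b a, h a i b, h b i a]
  ring

/-- A torsion-free family of connection matrices compatible with `G` is the Levi-Civita
connection. -/
theorem conn_unique (hG : IsMetricOn G U) (hy : y ∈ U) (B : Fin n → Matrix (Fin n) (Fin n) ℝ)
    (htor : ∀ i j k, B i k j = B j k i)
    (hcomp : ∀ i, matPderiv i G y = (B i)ᵀ * G y + G y * B i) (i : Fin n) :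
    conn G i y = B i := by
  have h1 : ∀ i, (B i)ᵀ * G y = (G y * B i)ᵀ := fun i => by
    rw [Matrix.transpose_mul, hG.symm y hy]
  have h2 : ∀ i l j, (G y * B i) l j = (G y * B j) l i := fun i l j => by
    simp only [Matrix.mul_apply]
    exact Finset.sum_congr rfl fun k _ => by rw [htor]
  have h3 : G y * conn G i y = G y * B i := by
    ext l j
    rw [hG.lower_conn hy, hcomp, hcomp, hcomp]
    simp only [h1, Matrix.add_apply, Matrix.transpose_apply]
    rw [h2 l i j, h2 l j i, h2 j l i]
    ring
  have h4 := congrArg ((G y)⁻¹ * ·) h3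
  simpa only [← mul_assoc, hG.inv_mul hy, one_mul] using h4

theorem matPderiv_inv (hG : IsMetricOn G U) (hy : y ∈ U) (i : Fin n) :
    matPderiv i (fun z => (G z)⁻¹) y
      = -((G y)⁻¹ * (conn G i y)ᵀ) - conn G i y * (G y)⁻¹ := by
  rw [matPderiv, matDeriv_inv (hG.smooth y hy) (hG.det_ne y hy), ← matPderiv,
    hG.matPderiv_eq hy, mul_add, add_mul, ← mul_assoc, ← mul_assoc, hG.inv_mul hy, one_mul,
    mul_assoc _ (G y), hG.mul_inv hy, mul_one]
  abel

theorem pderiv_det (hG : IsMetricOn G U) (hy : y ∈ U) (i : Fin n) :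
    pderiv i (fun z => (G z).det) y = 2 * (G y).det * (conn G i y).trace := by
  rw [pderiv, fderiv_det (hG.smooth y hy) (hG.det_ne y hy), ← matPderiv, hG.matPderiv_eq hy,
    mul_add, Matrix.trace_add, Matrix.trace_mul_comm, mul_assoc, hG.mul_inv hy, mul_one,
    ← mul_assoc, hG.inv_mul hy, one_mul, Matrix.trace_transpose]
  ring

theorem pderiv_sqrt_det (hG : IsMetricOn G U) (hy : y ∈ U) (hpos : 0 < (G y).det) (i : Fin n) :
    pderiv i (fun z => √(G z).det) y = √(G y).det * (conn G i y).trace := by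
  have h := (((hG.smooth y hy).det.diffAt.hasFDerivAt).sqrt hpos.ne').fderiv
  have h2 := hG.pderiv_det hy i
  rw [pderiv] at h2 ⊢
  rw [h]
  simp only [_root_.smul_apply, smul_eq_mul, h2]
  have h3 : √(G y).det ≠ 0 := (Real.sqrt_pos.2 hpos).ne'
  field_simp
  rw [Real.sq_sqrt hpos.le]

theorem cov_smooth (hG : IsMetricOn G U) (hy : y ∈ U) {h : Coord n → Matrix (Fin n) (Fin n) ℝ}
    (hh : MatSmoothAt h y) (k : Fin n) : MatSmoothAt (cov G h k) y :=
  fun i j => covLocal_contDiffAt G h y (hG.smooth y hy) (hG.det_ne y hy) hh k i j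

theorem cov_self (hG : IsMetricOn G U) (hy : y ∈ U) (k : Fin n) : cov G G k y = 0 := by
  rw [cov_eq, hG.matPderiv_eq hy]
  abel

/-- The Ricci identity for `2`-tensors. -/
theorem cov₂_comm (hG : IsMetricOn G U) (hy : y ∈ U) {h : Coord n → Matrix (Fin n) (Fin n) ℝ}
    (hh : ∀ y ∈ U, MatSmoothAt h y) (m k : Fin n) :
    cov₂ G h m k y - cov₂ G h k m y = -((curv G m k y)ᵀ * h y) - h y * curv G m k y := by
  have hs := hh y hy
  have key : ∀ m k, matPderiv m (cov G h k) y
      = matDeriv (fun z => matPderiv k h z) y (EuclideanSpace.single m 1)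
        - ((matPderiv m (conn G k) y)ᵀ * h y + (conn G k y)ᵀ * matPderiv m h y)
        - (matPderiv m h y * conn G k y + h y * matPderiv m (conn G k) y) := by
    intro m k
    have hA := hG.conn_smooth hy k
    rw [show cov G h k = fun z => matPderiv k h z - (conn G k z)ᵀ * h z - h z * conn G k z from
      funext fun z => cov_eq G h k z, matPderiv,
      matDeriv_sub ((hs.matDeriv _).sub (hA.transpose.mul hs)) (hs.mul hA),
      matDeriv_sub (hs.matDeriv _) (hA.transpose.mul hs), matDeriv_mul hA.transpose hs,
      matDeriv_mul hs hA]
    rfl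
  rw [cov₂_eq, cov₂_eq, key, key, matDeriv_comm hs (EuclideanSpace.single k 1), curv_eq]
  simp only [cov_eq G h m, cov_eq G h k, fun l => hG.christoffel_symm hy l m k]
  simp only [Matrix.transpose_add, Matrix.transpose_sub, Matrix.transpose_mul]
  noncomm_ring

theorem curv_transpose_mul (hG : IsMetricOn G U) (hy : y ∈ U) (i j : Fin n) :
    (curv G i j y)ᵀ * G y = -(G y * curv G i j y) := by
  have h0 : ∀ m k, cov₂ G G m k y = 0 := by
    intro m k
    have h1 : matPderiv m (cov G G k) y = 0 := by
      rw [matPderiv, matDeriv_congr (F := fun _ => 0), matDeriv_const]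
      filter_upwards [hG.mem_nhds hy] with z hz using hG.cov_self hz k
    rw [cov₂_eq, h1]
    simp [hG.cov_self hy]
  have h := hG.cov₂_comm hy hG.smooth i j
  rw [h0, h0, sub_zero] at h
  have h2 := sub_eq_zero.1 h.symm
  rw [← h2, neg_neg]

theorem inv_mul_curv_transpose (hG : IsMetricOn G U) (hy : y ∈ U) (i j : Fin n) :
    (G y)⁻¹ * (curv G i j y)ᵀ = -(curv G i j y * (G y)⁻¹) := by
  have h := congrArg (fun X => (G y)⁻¹ * X * (G y)⁻¹) (hG.curv_transpose_mul hy i j)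
  simp only [mul_neg, neg_mul] at h
  rwa [mul_assoc, mul_assoc, hG.mul_inv hy, mul_one, ← mul_assoc _ (G y), hG.inv_mul hy,
    one_mul] at h

end IsMetricOn

end LocalGeometry

/-! ### Changes of coordinates -/

section Pullback

variable {n : ℕ}

/-- The Jacobian matrix `Jᵃᵢ = ∂ᵢ ψᵃ` of a map `ψ` between coordinate domains. -/
def jac (ψ : Coord n → Coord n) (x : Coord n) : Matrix (Fin n) (Fin n) ℝ :=
  Matrix.of fun a i => pderiv i (fun z => ψ z a) x

theorem apply_contDiffAt {ψ : Coord n → Coord n} {x : Coord n} (hψ : ContDiffAt ℝ ∞ ψ x)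
    (a : Fin n) : ContDiffAt ℝ ∞ (fun z => ψ z a) x :=
  (EuclideanSpace.proj (𝕜 := ℝ) a).contDiff.contDiffAt.comp x hψ

theorem jac_apply {ψ : Coord n → Coord n} {x : Coord n} (hψ : ContDiffAt ℝ ∞ ψ x) (a i : Fin n) :
    jac ψ x a i = fderiv ℝ ψ x (EuclideanSpace.single i 1) a := by
  have h := ((EuclideanSpace.proj (𝕜 := ℝ) a).hasFDerivAt.comp x hψ.diffAt.hasFDerivAt).fderiv
  simp only [jac, pderiv, Matrix.of_apply]
  exact congrArg (fun L => L (EuclideanSpace.single i 1)) h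

theorem jac_smooth {ψ : Coord n → Coord n} {x : Coord n} (hψ : ContDiffAt ℝ ∞ ψ x) :
    MatSmoothAt (jac ψ) x :=
  fun a i => pderiv_contDiffAt i _ x (apply_contDiffAt hψ a)

theorem matPderiv_jac_symm {ψ : Coord n → Coord n} {x : Coord n} (hψ : ContDiffAt ℝ ∞ ψ x)
    (a i j : Fin n) : matPderiv i (jac ψ) x a j = matPderiv j (jac ψ) x a i :=
  fderiv_fderiv_comm (apply_contDiffAt hψ a) _ _

theorem coord_eq_sum (v : Coord n) : v = ∑ a, v a • EuclideanSpace.single a (1 : ℝ) := by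
  ext b
  simp [Pi.single_apply]

theorem pderiv_comp {ψ : Coord n → Coord n} {x : Coord n} (hψ : ContDiffAt ℝ ∞ ψ x)
    {f : Coord n → ℝ} (hf : DifferentiableAt ℝ f (ψ x)) (i : Fin n) :
    pderiv i (fun z => f (ψ z)) x = ∑ a, jac ψ x a i * pderiv a f (ψ x) := by
  have h := (hf.hasFDerivAt.comp x hψ.diffAt.hasFDerivAt).fderiv
  have h2 : pderiv i (fun z => f (ψ z)) x
      = fderiv ℝ f (ψ x) (fderiv ℝ ψ x (EuclideanSpace.single i 1)) :=
    congrArg (fun L => L (EuclideanSpace.single i 1)) h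
  rw [h2, coord_eq_sum (fderiv ℝ ψ x (EuclideanSpace.single i 1)), map_sum]
  simp only [map_smul, smul_eq_mul, jac_apply hψ, pderiv]

theorem matPderiv_comp {ψ : Coord n → Coord n} {x : Coord n} (hψ : ContDiffAt ℝ ∞ ψ x)
    {F : Coord n → Matrix (Fin n) (Fin n) ℝ} (hF : MatSmoothAt F (ψ x)) (i : Fin n) :
    matPderiv i (fun z => F (ψ z)) x = ∑ a, jac ψ x a i • matPderiv a F (ψ x) := by
  ext k l
  simp only [Matrix.sum_apply, Matrix.smul_apply, smul_eq_mul]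
  exact pderiv_comp hψ (hF.diff k l) i

/-- `G'` is the pullback of the metric `G` by `ψ`. -/
structure IsPullbackOn (G : Coord n → Matrix (Fin n) (Fin n) ℝ) (U : Set (Coord n))
    (ψ : Coord n → Coord n) (G' : Coord n → Matrix (Fin n) (Fin n) ℝ) (U' : Set (Coord n)) :
    Prop where
  metric : IsMetricOn G U
  metric' : IsMetricOn G' U'
  mapsTo : ∀ x ∈ U', ψ x ∈ U
  smooth : ∀ x ∈ U', ContDiffAt ℝ ∞ ψ x
  eq : ∀ x ∈ U', G' x = (jac ψ x)ᵀ * G (ψ x) * jac ψ x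

/-- The pullback `Pᵢ = Jᵃᵢ Aₐ ∘ ψ` of the connection matrices as a `1`-form. -/
def pullConn (G : Coord n → Matrix (Fin n) (Fin n) ℝ) (ψ : Coord n → Coord n) (i : Fin n)
    (x : Coord n) : Matrix (Fin n) (Fin n) ℝ :=
  ∑ a, jac ψ x a i • conn G a (ψ x)

namespace IsPullbackOn

variable {G G' : Coord n → Matrix (Fin n) (Fin n) ℝ} {U U' : Set (Coord n)}
  {ψ : Coord n → Coord n} {x : Coord n}

theorem det_jac_ne (hP : IsPullbackOn G U ψ G' U') (hx : x ∈ U') : (jac ψ x).det ≠ 0 := by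
  have h := hP.metric'.det_ne x hx
  rw [hP.eq x hx, Matrix.det_mul] at h
  exact right_ne_zero_of_mul h

theorem jac_mul_inv (hP : IsPullbackOn G U ψ G' U') (hx : x ∈ U') :
    jac ψ x * (jac ψ x)⁻¹ = 1 := Matrix.mul_nonsing_inv _ (hP.det_jac_ne hx).isUnit

theorem inv_jac_mul (hP : IsPullbackOn G U ψ G' U') (hx : x ∈ U') :
    (jac ψ x)⁻¹ * jac ψ x = 1 := Matrix.nonsing_inv_mul _ (hP.det_jac_ne hx).isUnit

/-- The inverse metric transforms as a contravariant tensor. -/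
theorem jac_mul_inv_mul (hP : IsPullbackOn G U ψ G' U') (hx : x ∈ U') :
    jac ψ x * (G' x)⁻¹ * (jac ψ x)ᵀ = (G (ψ x))⁻¹ := by
  have h1 := hP.jac_mul_inv hx
  have h2 := (hP.metric.mul_inv (hP.mapsTo x hx))
  have h3 : (jac ψ x)ᵀ * ((jac ψ x)⁻¹)ᵀ = 1 := by
    rw [← Matrix.transpose_mul, hP.inv_jac_mul hx, Matrix.transpose_one]
  have h4 : ((jac ψ x)⁻¹)ᵀ * (jac ψ x)ᵀ = 1 := by
    rw [← Matrix.transpose_mul, hP.jac_mul_inv hx, Matrix.transpose_one]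
  have h5 : (G' x)⁻¹ = (jac ψ x)⁻¹ * (G (ψ x))⁻¹ * ((jac ψ x)⁻¹)ᵀ := by
    refine Matrix.inv_eq_right_inv ?_
    calc G' x * ((jac ψ x)⁻¹ * (G (ψ x))⁻¹ * ((jac ψ x)⁻¹)ᵀ)
        = (jac ψ x)ᵀ * (G (ψ x) * (jac ψ x * (jac ψ x)⁻¹) * (G (ψ x))⁻¹)
          * ((jac ψ x)⁻¹)ᵀ := by rw [hP.eq x hx]; noncomm_ring
      _ = 1 := by rw [h1, mul_one, h2, mul_one, h3]
  calc jac ψ x * (G' x)⁻¹ * (jac ψ x)ᵀ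
      = (jac ψ x * (jac ψ x)⁻¹) * (G (ψ x))⁻¹ * (((jac ψ x)⁻¹)ᵀ * (jac ψ x)ᵀ) := by
        rw [h5]; noncomm_ring
    _ = _ := by rw [h1, h4, one_mul, mul_one]

theorem pullConn_smooth (hP : IsPullbackOn G U ψ G' U') (hx : x ∈ U') (i : Fin n) :
    MatSmoothAt (pullConn G ψ i) x :=
  MatSmoothAt.sum fun a _ => MatSmoothAt.smul (jac_smooth (hP.smooth x hx) a i)
    ((hP.metric.conn_smooth (hP.mapsTo x hx) a).comp (hP.smooth x hx))

/-- The transformation law of the Christoffel symbols. -/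
theorem jac_mul_conn (hP : IsPullbackOn G U ψ G' U') (hx : x ∈ U') (i : Fin n) :
    jac ψ x * conn G' i x = pullConn G ψ i x * jac ψ x + matPderiv i (jac ψ) x := by
  have hψ := hP.smooth x hx
  have hJ := jac_smooth hψ
  have hm := hP.mapsTo x hx
  have hGψ : MatSmoothAt (fun z => G (ψ z)) x := (hP.metric.smooth _ hm).comp hψ
  set B : Fin n → Matrix (Fin n) (Fin n) ℝ := fun i =>
    (jac ψ x)⁻¹ * (pullConn G ψ i x * jac ψ x + matPderiv i (jac ψ) x) with hB
  have hJB : ∀ i, jac ψ x * B i = pullConn G ψ i x * jac ψ x + matPderiv i (jac ψ) x := by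
    intro i
    rw [hB, ← mul_assoc, hP.jac_mul_inv hx, one_mul]
  rw [hP.metric'.conn_unique hx B ?_ ?_, hJB]
  · intro i j k
    have h1 : ∀ c, (pullConn G ψ i x * jac ψ x) c j = (pullConn G ψ j x * jac ψ x) c i := by
      intro c
      simp only [pullConn, Matrix.mul_apply, Matrix.sum_apply, Matrix.smul_apply, smul_eq_mul,
        Finset.sum_mul]
      rw [Finset.sum_comm]
      refine Finset.sum_congr rfl fun a _ => Finset.sum_congr rfl fun b _ => ?_
      rw [hP.metric.conn_symm hm c b a]
      ring
    simp only [hB]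
    rw [Matrix.mul_apply, Matrix.mul_apply]
    simp only [Matrix.add_apply, h1, fun c => matPderiv_jac_symm hψ c i j]
  · clear_value B
    intro i
    have h1 : matPderiv i G' x = (matPderiv i (jac ψ) x)ᵀ * G (ψ x) * jac ψ x
        + (jac ψ x)ᵀ * matPderiv i (fun z => G (ψ z)) x * jac ψ x
        + (jac ψ x)ᵀ * G (ψ x) * matPderiv i (jac ψ) x := by
      have h0 : G' =ᶠ[𝓝 x] fun z => (jac ψ z)ᵀ * G (ψ z) * jac ψ z := by
        filter_upwards [hP.metric'.mem_nhds hx] with z hz using hP.eq z hz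
      rw [matPderiv, matDeriv_congr h0, matDeriv_mul (hJ.transpose.mul hGψ) hJ,
        matDeriv_mul hJ.transpose hGψ, matDeriv_transpose]
      noncomm_ring
    have h2 : matPderiv i (fun z => G (ψ z)) x
        = (pullConn G ψ i x)ᵀ * G (ψ x) + G (ψ x) * pullConn G ψ i x := by
      rw [matPderiv_comp hψ (hP.metric.smooth _ hm)]
      simp only [hP.metric.matPderiv_eq hm, pullConn, Matrix.transpose_sum, Matrix.transpose_smul,
        Finset.sum_mul, Finset.mul_sum, ← Finset.sum_add_distrib, smul_add, smul_mul_assoc,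
        mul_smul_comm]
    have h3 : (B i)ᵀ * ((jac ψ x)ᵀ * G (ψ x) * jac ψ x)
        = (jac ψ x * B i)ᵀ * G (ψ x) * jac ψ x := by
      rw [Matrix.transpose_mul]; noncomm_ring
    have h4 : ((jac ψ x)ᵀ * G (ψ x) * jac ψ x) * B i
        = (jac ψ x)ᵀ * G (ψ x) * (jac ψ x * B i) := by noncomm_ring
    rw [h1, h2, hP.eq x hx, h3, h4, hJB, Matrix.transpose_add, Matrix.transpose_mul]
    noncomm_ring

/-- The curvature transforms as a tensor. -/
theorem jac_mul_curv (hP : IsPullbackOn G U ψ G' U') (hx : x ∈ U') (i j : Fin n) :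
    jac ψ x * curv G' i j x
      = (∑ a, ∑ b, (jac ψ x a i * jac ψ x b j) • curv G a b (ψ x)) * jac ψ x := by
  have hψ := hP.smooth x hx
  have hJ := jac_smooth hψ
  have hm := hP.mapsTo x hx
  have hA := fun a => hP.metric.conn_smooth hm a
  have hA' := fun a => hP.metric'.conn_smooth hx a
  have hp := fun a => hP.pullConn_smooth hx a
  have key : ∀ i j, matPderiv i (jac ψ) x * conn G' j x + jac ψ x * matPderiv i (conn G' j) x
      = matPderiv i (pullConn G ψ j) x * jac ψ x + pullConn G ψ j x * matPderiv i (jac ψ) x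
        + matPderiv i (matPderiv j (jac ψ)) x := by
    intro i j
    have h0 : (fun z => jac ψ z * conn G' j z)
        =ᶠ[𝓝 x] fun z => pullConn G ψ j z * jac ψ z + matPderiv j (jac ψ) z := by
      filter_upwards [hP.metric'.mem_nhds hx] with z hz using hP.jac_mul_conn hz j
    have h1 := matDeriv_congr h0 (EuclideanSpace.single i 1)
    rwa [matDeriv_mul hJ (hA' j), matDeriv_add ((hp j).mul hJ) (hJ.matDeriv _),
      matDeriv_mul (hp j) hJ] at h1
  have hP1 : ∀ i j, matPderiv i (pullConn G ψ j) x
      = ∑ a, matPderiv i (jac ψ) x a j • conn G a (ψ x)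
        + ∑ a, ∑ b, (jac ψ x a i * jac ψ x b j) • matPderiv a (conn G b) (ψ x) := by
    intro i j
    have hA2 := fun a => (hA a).comp hψ
    rw [show pullConn G ψ j = fun z => ∑ a, jac ψ z a j • conn G a (ψ z) from rfl, matPderiv,
      matDeriv_sum fun a _ => MatSmoothAt.smul (hJ a j) (hA2 a), Finset.sum_comm (γ := Fin n),
      ← Finset.sum_add_distrib]
    refine Finset.sum_congr rfl fun a _ => ?_
    rw [matDeriv_smul (hJ a j) (hA2 a)]
    congr 1
    have := matPderiv_comp hψ (hA a) i
    rw [matPderiv] at this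
    rw [this, Finset.smul_sum]
    exact Finset.sum_congr rfl fun b _ => by rw [smul_smul, mul_comm]
  have hF : (∑ a, ∑ b, (jac ψ x a i * jac ψ x b j) • curv G a b (ψ x))
      = matPderiv i (pullConn G ψ j) x - matPderiv j (pullConn G ψ i) x
        + (pullConn G ψ i x * pullConn G ψ j x - pullConn G ψ j x * pullConn G ψ i x) := by
    have e1 : pullConn G ψ i x * pullConn G ψ j x = ∑ a, ∑ b, (jac ψ x a i * jac ψ x b j) •
        (conn G a (ψ x) * conn G b (ψ x)) := by
      simp only [pullConn, Finset.sum_mul_sum, smul_mul_smul_comm]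
    have e2 : pullConn G ψ j x * pullConn G ψ i x = ∑ a, ∑ b, (jac ψ x a i * jac ψ x b j) •
        (conn G b (ψ x) * conn G a (ψ x)) := by
      simp only [pullConn, Finset.sum_mul_sum, smul_mul_smul_comm]
      rw [Finset.sum_comm]
      simp only [mul_comm]
    have e3 : ∑ a, ∑ b, (jac ψ x a j * jac ψ x b i) • matPderiv a (conn G b) (ψ x)
        = ∑ a, ∑ b, (jac ψ x a i * jac ψ x b j) • matPderiv b (conn G a) (ψ x) := by
      rw [Finset.sum_comm]
      simp only [mul_comm]
    rw [e1, e2, hP1, hP1, e3]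
    simp only [curv_eq, smul_add, smul_sub, Finset.sum_add_distrib, Finset.sum_sub_distrib,
      fun a => matPderiv_jac_symm hψ a i j]
    abel
  have k1 := key i j
  have k2 := key j i
  have hc : matPderiv i (matPderiv j (jac ψ)) x = matPderiv j (matPderiv i (jac ψ)) x :=
    matDeriv_comm hJ _ _
  have c1 := hP.jac_mul_conn hx i
  have c2 := hP.jac_mul_conn hx j
  rw [hF, curv_eq]
  calc jac ψ x * (matPderiv i (conn G' j) x - matPderiv j (conn G' i) x
        + (conn G' i x * conn G' j x - conn G' j x * conn G' i x))
      = (matPderiv i (jac ψ) x * conn G' j x + jac ψ x * matPderiv i (conn G' j) x)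
        - (matPderiv j (jac ψ) x * conn G' i x + jac ψ x * matPderiv j (conn G' i) x)
        - matPderiv i (jac ψ) x * conn G' j x + matPderiv j (jac ψ) x * conn G' i x
        + (jac ψ x * conn G' i x) * conn G' j x - (jac ψ x * conn G' j x) * conn G' i x := by
        noncomm_ring
    _ = (matPderiv i (pullConn G ψ j) x * jac ψ x + pullConn G ψ j x * matPderiv i (jac ψ) x
          + matPderiv i (matPderiv j (jac ψ)) x)
        - (matPderiv j (pullConn G ψ i) x * jac ψ x + pullConn G ψ i x * matPderiv j (jac ψ) x
          + matPderiv i (matPderiv j (jac ψ)) x)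
        - matPderiv i (jac ψ) x * conn G' j x + matPderiv j (jac ψ) x * conn G' i x
        + (pullConn G ψ i x * jac ψ x + matPderiv i (jac ψ) x) * conn G' j x
        - (pullConn G ψ j x * jac ψ x + matPderiv j (jac ψ) x) * conn G' i x := by
        rw [k1, k2, c1, c2, hc]
    _ = (matPderiv i (pullConn G ψ j) x - matPderiv j (pullConn G ψ i) x) * jac ψ x
        + pullConn G ψ j x * matPderiv i (jac ψ) x - pullConn G ψ i x * matPderiv j (jac ψ) x
        + pullConn G ψ i x * (jac ψ x * conn G' j x)
        - pullConn G ψ j x * (jac ψ x * conn G' i x) := by noncomm_ring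
    _ = _ := by rw [c1, c2]; noncomm_ring

/-- The Ricci tensor transforms as a tensor. -/
theorem ricci_eq (hP : IsPullbackOn G U ψ G' U') (hx : x ∈ U') :
    ricciLocal G' x = (jac ψ x)ᵀ * ricciLocal G (ψ x) * jac ψ x := by
  ext j k
  have h1 : ∀ i, curv G' i j x = (jac ψ x)⁻¹ *
      ((∑ a, ∑ b, (jac ψ x a i * jac ψ x b j) • curv G a b (ψ x)) * jac ψ x) := by
    intro i
    rw [← hP.jac_mul_curv hx, ← mul_assoc, hP.inv_jac_mul hx, one_mul]
  have h2 : ∀ a c : Fin n, ∑ i, jac ψ x a i * (jac ψ x)⁻¹ i c = if a = c then 1 else 0 := by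
    intro a c
    rw [← Matrix.mul_apply, hP.jac_mul_inv hx, Matrix.one_apply]
  have h3 : ∑ i, curv G' i j x i k
      = ∑ i, ∑ c, ∑ a, ∑ b, (jac ψ x a i * (jac ψ x)⁻¹ i c)
        * (jac ψ x b j * (curv G a b (ψ x) * jac ψ x) c k) := by
    refine Finset.sum_congr rfl fun i _ => ?_
    rw [h1, Matrix.mul_apply]
    refine Finset.sum_congr rfl fun c _ => ?_
    simp only [Finset.sum_mul, Matrix.sum_apply, smul_mul_assoc, Matrix.smul_apply, smul_eq_mul,
      Finset.mul_sum]
    exact Finset.sum_congr rfl fun a _ => Finset.sum_congr rfl fun b _ => by ring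
  have h4 : ∑ i, curv G' i j x i k
      = ∑ a, ∑ b, jac ψ x b j * (curv G a b (ψ x) * jac ψ x) a k := by
    rw [h3, Finset.sum_comm]
    simp only [Finset.sum_comm (s := Finset.univ (α := Fin n)) (f := fun i a => ∑ b,
      (jac ψ x a i * (jac ψ x)⁻¹ i _) * (jac ψ x b j * (curv G a b (ψ x) * jac ψ x) _ k))]
    simp only [Finset.sum_comm (s := Finset.univ (α := Fin n)) (f := fun i b =>
      (jac ψ x _ i * (jac ψ x)⁻¹ i _) * (jac ψ x b j * (curv G _ b (ψ x) * jac ψ x) _ k)),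
      ← Finset.sum_mul, h2]
    simp
  rw [ricciLocal_apply, h4, mul_assoc, Matrix.mul_apply, Finset.sum_comm]
  refine Finset.sum_congr rfl fun b _ => ?_
  rw [← Finset.mul_sum, Matrix.transpose_apply]
  congr 1
  simp only [Matrix.mul_apply, ricciLocal_apply, Finset.sum_mul]
  rw [Finset.sum_comm]

theorem scal_eq_trace (hG : IsMetricOn G U) {y : Coord n} (hy : y ∈ U) :
    scalLocal G y = ((G y)⁻¹ * ricciLocal G y).trace := by
  have h : ∀ j k, (G y)⁻¹ j k = (G y)⁻¹ k j := fun j k =>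
    congrFun (congrFun (hG.inv_symm hy) k) j
  simp only [scalLocal, Matrix.trace, Matrix.diag, Matrix.mul_apply]
  rw [Finset.sum_comm]
  exact Finset.sum_congr rfl fun k _ => Finset.sum_congr rfl fun j _ => by rw [h]

/-- The trace of a tensor does not depend on the coordinates. -/
theorem trace_inv_mul (hP : IsPullbackOn G U ψ G' U') (hx : x ∈ U')
    (A : Matrix (Fin n) (Fin n) ℝ) :
    ((G' x)⁻¹ * ((jac ψ x)ᵀ * A * jac ψ x)).trace = ((G (ψ x))⁻¹ * A).trace := by
  rw [← hP.jac_mul_inv_mul hx, ← mul_assoc, Matrix.trace_mul_comm]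
  congr 1
  noncomm_ring

theorem scal_eq (hP : IsPullbackOn G U ψ G' U') (hx : x ∈ U') :
    scalLocal G' x = scalLocal G (ψ x) := by
  rw [scal_eq_trace hP.metric' hx, scal_eq_trace hP.metric (hP.mapsTo x hx), hP.ricci_eq hx,
    hP.trace_inv_mul hx]

/-- The covariant derivative of a tensor transforms as a tensor. -/
theorem cov_eq (hP : IsPullbackOn G U ψ G' U') (hx : x ∈ U')
    {h h' : Coord n → Matrix (Fin n) (Fin n) ℝ} (hh : MatSmoothAt h (ψ x))
    (heq : ∀ x ∈ U', h' x = (jac ψ x)ᵀ * h (ψ x) * jac ψ x) (k : Fin n) :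
    cov G' h' k x = (jac ψ x)ᵀ * (∑ a, jac ψ x a k • cov G h a (ψ x)) * jac ψ x := by
  have hψ := hP.smooth x hx
  have hJ := jac_smooth hψ
  have hhψ : MatSmoothAt (fun z => h (ψ z)) x := hh.comp hψ
  have h1 : matPderiv k h' x = (matPderiv k (jac ψ) x)ᵀ * h (ψ x) * jac ψ x
      + (jac ψ x)ᵀ * matPderiv k (fun z => h (ψ z)) x * jac ψ x
      + (jac ψ x)ᵀ * h (ψ x) * matPderiv k (jac ψ) x := by
    have h0 : h' =ᶠ[𝓝 x] fun z => (jac ψ z)ᵀ * h (ψ z) * jac ψ z := by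
      filter_upwards [hP.metric'.mem_nhds hx] with z hz using heq z hz
    rw [matPderiv, matDeriv_congr h0, matDeriv_mul (hJ.transpose.mul hhψ) hJ,
      matDeriv_mul hJ.transpose hhψ, matDeriv_transpose]
    noncomm_ring
  have h2 : matPderiv k (fun z => h (ψ z)) x = (∑ a, jac ψ x a k • cov G h a (ψ x))
      + (pullConn G ψ k x)ᵀ * h (ψ x) + h (ψ x) * pullConn G ψ k x := by
    rw [matPderiv_comp hψ hh]
    simp only [EinsteinDeformation.cov_eq, pullConn, Matrix.transpose_sum, Matrix.transpose_smul,
      Finset.sum_mul, Finset.mul_sum, ← Finset.sum_add_distrib, smul_mul_assoc, mul_smul_comm]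
    refine Finset.sum_congr rfl fun a _ => ?_
    module
  have h3 : (conn G' k x)ᵀ * ((jac ψ x)ᵀ * h (ψ x) * jac ψ x)
      = (jac ψ x * conn G' k x)ᵀ * h (ψ x) * jac ψ x := by
    rw [Matrix.transpose_mul]; noncomm_ring
  have h4 : ((jac ψ x)ᵀ * h (ψ x) * jac ψ x) * conn G' k x
      = (jac ψ x)ᵀ * h (ψ x) * (jac ψ x * conn G' k x) := by noncomm_ring
  rw [EinsteinDeformation.cov_eq, h1, h2, heq x hx, h3, h4, hP.jac_mul_conn hx,
    Matrix.transpose_add, Matrix.transpose_mul]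
  noncomm_ring

theorem div_eq (hP : IsPullbackOn G U ψ G' U') (hx : x ∈ U')
    {h h' : Coord n → Matrix (Fin n) (Fin n) ℝ} (hh : MatSmoothAt h (ψ x))
    (heq : ∀ x ∈ U', h' x = (jac ψ x)ᵀ * h (ψ x) * jac ψ x) (j : Fin n) :
    divLocal G' h' x j = ∑ b, jac ψ x b j * divLocal G h (ψ x) b := by
  have e : ∀ (G h : Coord n → Matrix (Fin n) (Fin n) ℝ) (y : Coord n) (j : Fin n),
      divLocal G h y j = -∑ k, ((G y)⁻¹ * cov G h k y) k j := fun _ _ _ _ => rfl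
  have h1 : ∑ k, ((G' x)⁻¹ * cov G' h' k x) k j
      = ∑ k, ∑ a, jac ψ x a k * ((G' x)⁻¹ * (jac ψ x)ᵀ * cov G h a (ψ x) * jac ψ x) k j := by
    refine Finset.sum_congr rfl fun k _ => ?_
    rw [hP.cov_eq hx hh heq]
    simp only [Finset.sum_mul, Finset.mul_sum, smul_mul_assoc, mul_smul_comm, Matrix.sum_apply,
      Matrix.smul_apply, smul_eq_mul, ← mul_assoc]
  have h2 : ∀ a, ∑ k, jac ψ x a k * ((G' x)⁻¹ * (jac ψ x)ᵀ * cov G h a (ψ x) * jac ψ x) k j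
      = ∑ b, jac ψ x b j * ((G (ψ x))⁻¹ * cov G h a (ψ x)) a b := by
    intro a
    rw [← Matrix.mul_apply, ← hP.jac_mul_inv_mul hx]
    simp only [← mul_assoc]
    rw [Matrix.mul_apply]
    exact Finset.sum_congr rfl fun b _ => mul_comm _ _
  rw [e, h1, Finset.sum_comm]
  simp only [h2, e, mul_neg, Finset.sum_neg_distrib, Finset.mul_sum]
  rw [Finset.sum_comm]

end IsPullbackOn

end Pullback

/-! ### Smooth families of metrics -/

section Family

variable {n : ℕ} {E : Type*} [NormedAddCommGroup E] [NormedSpace ℝ E]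

theorem pderiv_slice {f : E × Coord n → ℝ} {x : E × Coord n} (hf : DifferentiableAt ℝ f x)
    (k : Fin n) :
    pderiv k (fun z => f (x.1, z)) x.2 = fderiv ℝ f x (0, EuclideanSpace.single k 1) := by
  have h := (HasFDerivAt.comp (f := fun z : Coord n => (x.1, z)) (g := f) x.2
    (hf.hasFDerivAt) (hasFDerivAt_prodMk_right x.1 x.2)).fderiv
  exact congrArg (fun L => L (EuclideanSpace.single k 1)) h

theorem matPderiv_slice {F : E × Coord n → Matrix (Fin n) (Fin n) ℝ} {x : E × Coord n}
    (hF : MatSmoothAt F x) (k : Fin n) :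
    matPderiv k (fun z => F (x.1, z)) x.2 = matDeriv F x (0, EuclideanSpace.single k 1) := by
  ext i j
  exact pderiv_slice (hF.diff i j) k

theorem contDiffAt_slice (x : E × Coord n) :
    ContDiffAt ℝ ∞ (fun z : Coord n => (x.1, z)) x.2 :=
  contDiffAt_const.prodMk contDiffAt_id

theorem MatSmoothAt.slice {F : E × Coord n → Matrix (Fin n) (Fin n) ℝ} {x : E × Coord n}
    (hF : MatSmoothAt F x) : MatSmoothAt (fun z => F (x.1, z)) x.2 :=
  MatSmoothAt.comp (f := fun z : Coord n => (x.1, z)) hF (contDiffAt_slice x)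

/-- `G` is a smooth family of nondegenerate symmetric matrix fields on the open set `O` of
parameters and points. -/
structure IsFamilyOn (G : E × Coord n → Matrix (Fin n) (Fin n) ℝ) (O : Set (E × Coord n)) :
    Prop where
  isOpen : IsOpen O
  smooth : ∀ x ∈ O, MatSmoothAt G x
  symm : ∀ x ∈ O, (G x)ᵀ = G x
  det_ne : ∀ x ∈ O, (G x).det ≠ 0

/-- The connection matrices of a family of metrics. -/
def famConn (G : E × Coord n → Matrix (Fin n) (Fin n) ℝ) (i : Fin n) (x : E × Coord n) :
    Matrix (Fin n) (Fin n) ℝ :=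
  conn (fun z => G (x.1, z)) i x.2

/-- The curvature matrices of a family of metrics. -/
def famCurv (G : E × Coord n → Matrix (Fin n) (Fin n) ℝ) (i j : Fin n) (x : E × Coord n) :
    Matrix (Fin n) (Fin n) ℝ :=
  curv (fun z => G (x.1, z)) i j x.2

/-- The Ricci tensors of a family of metrics. -/
def famRicci (G : E × Coord n → Matrix (Fin n) (Fin n) ℝ) (x : E × Coord n) :
    Matrix (Fin n) (Fin n) ℝ :=
  ricciLocal (fun z => G (x.1, z)) x.2

/-- The scalar curvatures of a family of metrics. -/
def famScal (G : E × Coord n → Matrix (Fin n) (Fin n) ℝ) (x : E × Coord n) : ℝ :=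
  scalLocal (fun z => G (x.1, z)) x.2

/-- The derivative of the connection matrices in the direction `w` of the parameter space. -/
def dConn (G : E × Coord n → Matrix (Fin n) (Fin n) ℝ) (w : E) (i : Fin n) (x : E × Coord n) :
    Matrix (Fin n) (Fin n) ℝ :=
  matDeriv (famConn G i) x (w, 0)

/-- The vector field `Xᵐ = gʲᵏ Ċᵐⱼₖ - gᵐᵏ Ċʲⱼₖ`, where `Ċ` is the derivative of the Christoffel
symbols. Its divergence is `gʲᵏ` times the derivative of the Ricci tensor. -/
def varField (G : E × Coord n → Matrix (Fin n) (Fin n) ℝ) (w : E) (m : Fin n)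
    (x : E × Coord n) : ℝ :=
  ∑ j, ((dConn G w j x * (G x)⁻¹) m j - (dConn G w j x * (G x)⁻¹) j m)

namespace IsFamilyOn

variable {G : E × Coord n → Matrix (Fin n) (Fin n) ℝ} {O : Set (E × Coord n)} {x : E × Coord n}

theorem mem_nhds (hG : IsFamilyOn G O) (hx : x ∈ O) : O ∈ 𝓝 x := hG.isOpen.mem_nhds hx

theorem slice (hG : IsFamilyOn G O) (v : E) :
    IsMetricOn (fun z => G (v, z)) {z | (v, z) ∈ O} where
  isOpen := hG.isOpen.preimage (by fun_prop)
  smooth y hy := (hG.smooth (v, y) hy).slice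
  symm y hy := hG.symm (v, y) hy
  det_ne y hy := hG.det_ne (v, y) hy

theorem famConn_smooth (hG : IsFamilyOn G O) (hx : x ∈ O) (i : Fin n) :
    MatSmoothAt (famConn G i) x := by
  have h1 : famConn G i =ᶠ[𝓝 x] fun x => (G x)⁻¹ * Matrix.of fun l j => (1 / 2) *
      (matDeriv G x (0, EuclideanSpace.single i 1) j l
        + matDeriv G x (0, EuclideanSpace.single j 1) i l
        - matDeriv G x (0, EuclideanSpace.single l 1) i j) := by
    filter_upwards [hG.mem_nhds hx] with z hz
    ext k j
    have h2 : ∀ k i j, pderiv k (fun y => G (z.1, y) i j) z.2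
        = matDeriv G z (0, EuclideanSpace.single k 1) i j :=
      fun k i j => pderiv_slice ((hG.smooth z hz).diff i j) k
    simp only [famConn, conn, christoffel, h2, Matrix.of_apply, Matrix.mul_apply, Finset.mul_sum]
    exact Finset.sum_congr rfl fun l _ => by ring
  refine MatSmoothAt.congr (((hG.smooth x hx).inv (hG.det_ne x hx)).mul fun l j => ?_) h1
  have h3 := fun v => (hG.smooth x hx).matDeriv v
  exact contDiffAt_const.mul (((h3 _ _ _).add (h3 _ _ _)).sub (h3 _ _ _))

theorem famCurv_eq (hG : IsFamilyOn G O) (hx : x ∈ O) (i j : Fin n) :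
    famCurv G i j x = matDeriv (famConn G j) x (0, EuclideanSpace.single i 1)
      - matDeriv (famConn G i) x (0, EuclideanSpace.single j 1)
      + (famConn G i x * famConn G j x - famConn G j x * famConn G i x) := by
  rw [← matPderiv_slice (hG.famConn_smooth hx j), ← matPderiv_slice (hG.famConn_smooth hx i),
    famCurv, curv_eq]
  rfl

theorem famCurv_smooth (hG : IsFamilyOn G O) (hx : x ∈ O) (i j : Fin n) :
    MatSmoothAt (famCurv G i j) x := by
  have hA := hG.famConn_smooth hx
  refine MatSmoothAt.congr ((((hA j).matDeriv (0, EuclideanSpace.single i 1)).sub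
    ((hA i).matDeriv (0, EuclideanSpace.single j 1))).add
    (((hA i).mul (hA j)).sub ((hA j).mul (hA i)))) ?_
  filter_upwards [hG.mem_nhds hx] with z hz using hG.famCurv_eq hz i j

theorem famRicci_smooth (hG : IsFamilyOn G O) (hx : x ∈ O) : MatSmoothAt (famRicci G) x :=
  fun j k => ContDiffAt.sum (s := Finset.univ) fun i _ => hG.famCurv_smooth hx i j i k

theorem inv_smooth (hG : IsFamilyOn G O) (hx : x ∈ O) : MatSmoothAt (fun x => (G x)⁻¹) x :=
  (hG.smooth x hx).inv (hG.det_ne x hx)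

theorem famScal_eq (hG : IsFamilyOn G O) (hx : x ∈ O) :
    famScal G x = ((G x)⁻¹ * famRicci G x).trace :=
  IsPullbackOn.scal_eq_trace (hG.slice x.1) (y := x.2) hx

theorem famScal_smooth (hG : IsFamilyOn G O) (hx : x ∈ O) : ContDiffAt ℝ ∞ (famScal G) x := by
  refine ((hG.inv_smooth hx).mul (hG.famRicci_smooth hx)).trace.congr_of_eventuallyEq ?_
  filter_upwards [hG.mem_nhds hx] with z hz using hG.famScal_eq hz

theorem sqrt_det_smooth (hG : IsFamilyOn G O) (hx : x ∈ O) :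
    ContDiffAt ℝ ∞ (fun x => √(G x).det) x :=
  (hG.smooth x hx).det.sqrt (hG.det_ne x hx)

theorem dConn_smooth (hG : IsFamilyOn G O) (hx : x ∈ O) (w : E) (i : Fin n) :
    MatSmoothAt (dConn G w i) x :=
  (hG.famConn_smooth hx i).matDeriv _

theorem varField_smooth (hG : IsFamilyOn G O) (hx : x ∈ O) (w : E) (m : Fin n) :
    ContDiffAt ℝ ∞ (varField G w m) x := by
  have h := fun j => (hG.dConn_smooth hx w j).mul (hG.inv_smooth hx)
  exact ContDiffAt.sum fun j _ => (h j m j).sub (h j j m)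

theorem famConn_symm (hG : IsFamilyOn G O) (hx : x ∈ O) (k i j : Fin n) :
    famConn G i x k j = famConn G j x k i :=
  (hG.slice x.1).conn_symm (y := x.2) hx k i j

theorem dConn_symm (hG : IsFamilyOn G O) (hx : x ∈ O) (w : E) (k i j : Fin n) :
    dConn G w i x k j = dConn G w j x k i := by
  have h : (fun x => famConn G i x k j) =ᶠ[𝓝 x] fun x => famConn G j x k i := by
    filter_upwards [hG.mem_nhds hx] with z hz using hG.famConn_symm hz k i j
  simp only [dConn, matDeriv, Matrix.of_apply, h.fderiv_eq]

/-- The derivative of the curvature along a family of metrics. -/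
theorem matDeriv_famCurv (hG : IsFamilyOn G O) (hx : x ∈ O) (w : E) (i j : Fin n) :
    matDeriv (famCurv G i j) x (w, 0)
      = matDeriv (dConn G w j) x (0, EuclideanSpace.single i 1)
        - matDeriv (dConn G w i) x (0, EuclideanSpace.single j 1)
        + (dConn G w i x * famConn G j x + famConn G i x * dConn G w j x
          - (dConn G w j x * famConn G i x + famConn G j x * dConn G w i x)) := by
  have hA := hG.famConn_smooth hx
  have h : famCurv G i j =ᶠ[𝓝 x] fun x =>
      matDeriv (famConn G j) x (0, EuclideanSpace.single i 1)
      - matDeriv (famConn G i) x (0, EuclideanSpace.single j 1)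
      + (famConn G i x * famConn G j x - famConn G j x * famConn G i x) := by
    filter_upwards [hG.mem_nhds hx] with z hz using hG.famCurv_eq hz i j
  rw [matDeriv_congr h, matDeriv_add (((hA j).matDeriv _).sub ((hA i).matDeriv _))
    (((hA i).mul (hA j)).sub ((hA j).mul (hA i))),
    matDeriv_sub ((hA j).matDeriv _) ((hA i).matDeriv _),
    matDeriv_sub ((hA i).mul (hA j)) ((hA j).mul (hA i)), matDeriv_mul (hA i) (hA j),
    matDeriv_mul (hA j) (hA i), matDeriv_comm (hA j), matDeriv_comm (hA i)]
  rfl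

theorem matDeriv_famRicci (hG : IsFamilyOn G O) (hx : x ∈ O) (w : E × Coord n) (j k : Fin n) :
    matDeriv (famRicci G) x w j k = ∑ i, matDeriv (famCurv G i j) x w i k := by
  simp only [matDeriv, Matrix.of_apply]
  change fderiv ℝ (fun z => ∑ i, famCurv G i j z i k) x w = _
  rw [fderiv_fun_sum fun i _ => (hG.famCurv_smooth hx i j).diff i k]
  simp

end IsFamilyOn

section Algebra

/-- The algebraic core of the divergence identity `varField_divergence`: `M i j` stands for
`∂ᵢ Ċⱼ`, and only the vanishing of the torsion of `A` is used. -/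
theorem sum_curvature_variation (A C : Fin n → Matrix (Fin n) (Fin n) ℝ)
    (M : Fin n → Fin n → Matrix (Fin n) (Fin n) ℝ) (W : Matrix (Fin n) (Fin n) ℝ)
    (hA : ∀ k i j, A i k j = A j k i) :
    ∑ i, ∑ j, ((M i j - M j i + (C i * A j + A i * C j - (C j * A i + A j * C i))) * W) i j
      = ∑ i, ((A i).trace * ∑ j, ((C j * W) i j - (C j * W) j i)
        + ∑ j, ((M i j * W + C j * (-(W * (A i)ᵀ) - A i * W)) i j
          - (M i j * W + C j * (-(W * (A i)ᵀ) - A i * W)) j i)) := by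
  have f1 : ∑ i, ∑ j, (C j * W * (A i)ᵀ) i j = ∑ i, ∑ j, (A j * (C i * W)) i j := by
    simp only [Matrix.mul_apply (N := (A _)ᵀ), Matrix.mul_apply (M := A _), Matrix.transpose_apply]
    calc ∑ i, ∑ j, ∑ m, (C j * W) i m * A i j m
        = ∑ j, ∑ i, ∑ m, A m j i * (C j * W) i m := by
          rw [Finset.sum_comm]
          exact Finset.sum_congr rfl fun j _ => Finset.sum_congr rfl fun i _ =>
            Finset.sum_congr rfl fun m _ => by rw [hA j i m, mul_comm]
      _ = _ := Finset.sum_congr rfl fun j _ => Finset.sum_comm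
  have f2 : ∑ i, ∑ j, (C i * W * (A j)ᵀ) i j = ∑ i, (A i).trace * ∑ j, (C j * W) j i := by
    simp only [Matrix.mul_apply (N := (A _)ᵀ), Matrix.transpose_apply, Matrix.trace, Matrix.diag,
      Finset.sum_mul_sum]
    calc ∑ i, ∑ j, ∑ m, (C i * W) i m * A j j m
        = ∑ i, ∑ m, ∑ j, A m j j * (C i * W) i m := by
          refine Finset.sum_congr rfl fun i _ => ?_
          rw [Finset.sum_comm]
          exact Finset.sum_congr rfl fun m _ => Finset.sum_congr rfl fun j _ => by
            rw [hA j j m, mul_comm]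
      _ = ∑ m, ∑ i, ∑ j, A m j j * (C i * W) i m := Finset.sum_comm
      _ = _ := Finset.sum_congr rfl fun m _ => Finset.sum_comm
  have f3 : ∑ i, ∑ j, (A i * (C j * W)) i j = ∑ i, (A i).trace * ∑ j, (C j * W) i j := by
    simp only [Matrix.mul_apply (M := A _), Matrix.trace, Matrix.diag, Finset.sum_mul_sum]
    calc ∑ i, ∑ j, ∑ m, A i i m * (C j * W) m j
        = ∑ i, ∑ m, ∑ j, A m i i * (C j * W) m j := by
          refine Finset.sum_congr rfl fun i _ => ?_
          rw [Finset.sum_comm]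
          exact Finset.sum_congr rfl fun m _ => Finset.sum_congr rfl fun j _ => by
            rw [hA i i m]
      _ = _ := Finset.sum_comm
  have f4 : ∑ i, ∑ j, (M i j * W + C j * (-(W * (A i)ᵀ) - A i * W)) j i
      = ∑ i, ∑ j, (M j i * W + C i * (-(W * (A j)ᵀ) - A j * W)) i j := Finset.sum_comm
  have f5 : ∀ i j, ((M i j - M j i + (C i * A j + A i * C j - (C j * A i + A j * C i))) * W) i j
      = (M i j * W + C j * (-(W * (A i)ᵀ) - A i * W)) i j
        - (M j i * W + C i * (-(W * (A j)ᵀ) - A j * W)) i j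
        + (C j * W * (A i)ᵀ) i j - (A j * (C i * W)) i j
        + (A i * (C j * W)) i j - (C i * W * (A j)ᵀ) i j := by
    intro i j
    have hm : (M i j - M j i + (C i * A j + A i * C j - (C j * A i + A j * C i))) * W
        = M i j * W + C j * (-(W * (A i)ᵀ) - A i * W)
          - (M j i * W + C i * (-(W * (A j)ᵀ) - A j * W))
          + C j * W * (A i)ᵀ - A j * (C i * W) + A i * (C j * W) - C i * W * (A j)ᵀ := by
      noncomm_ring
    rw [hm]
    rfl
  simp only [f5, Finset.sum_add_distrib, Finset.sum_sub_distrib, f4,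
    mul_sub (Matrix.trace (A _)), f1, f2, f3]
  ring

end Algebra

namespace IsFamilyOn

variable {G : E × Coord n → Matrix (Fin n) (Fin n) ℝ} {O : Set (E × Coord n)} {x : E × Coord n}

/-- The trace of the derivative of the Ricci tensor is a divergence. -/
theorem varField_divergence (hG : IsFamilyOn G O) (hx : x ∈ O) (hpos : 0 < (G x).det) (w : E) :
    ∑ m, pderiv m (fun z => √(G (x.1, z)).det * varField G w m (x.1, z)) x.2
      = √(G x).det * ((G x)⁻¹ * matDeriv (famRicci G) x (w, 0)).trace := by
  have hGs := hG.slice x.1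
  have hx2 : x.2 ∈ {z | (x.1, z) ∈ O} := hx
  have hT : ∀ j, MatSmoothAt (fun x => dConn G w j x * (G x)⁻¹) x :=
    fun j => (hG.dConn_smooth hx w j).mul (hG.inv_smooth hx)
  have hdT : ∀ i j, matPderiv i (fun z => dConn G w j (x.1, z) * (G (x.1, z))⁻¹) x.2
      = matDeriv (dConn G w j) x (0, EuclideanSpace.single i 1) * (G x)⁻¹
        + dConn G w j x * (-((G x)⁻¹ * (famConn G i x)ᵀ) - famConn G i x * (G x)⁻¹) := by
    intro i j
    have h1 := hGs.matPderiv_inv hx2 i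
    rw [matPderiv, matDeriv_mul (hG.dConn_smooth hx w j).slice (hG.inv_smooth hx).slice,
      ← matPderiv, ← matPderiv, h1, matPderiv_slice (hG.dConn_smooth hx w j)]
    rfl
  have hX : ∀ i, pderiv i (fun z => √(G (x.1, z)).det * varField G w i (x.1, z)) x.2
      = √(G x).det * ((famConn G i x).trace * varField G w i x
        + ∑ j, (matPderiv i (fun z => dConn G w j (x.1, z) * (G (x.1, z))⁻¹) x.2 i j
          - matPderiv i (fun z => dConn G w j (x.1, z) * (G (x.1, z))⁻¹) x.2 j i)) := by
    intro i
    have hd := hGs.pderiv_sqrt_det hx2 hpos i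
    have d1 : DifferentiableAt ℝ (fun z => √(G (x.1, z)).det) x.2 :=
      ContDiffAt.diffAt ((hG.sqrt_det_smooth hx).comp (f := fun z : Coord n => (x.1, z)) x.2
        (contDiffAt_slice x))
    have d2 : DifferentiableAt ℝ (fun z => varField G w i (x.1, z)) x.2 :=
      ContDiffAt.diffAt ((hG.varField_smooth hx w i).comp (f := fun z : Coord n => (x.1, z)) x.2
        (contDiffAt_slice x))
    have h2 : pderiv i (fun z => varField G w i (x.1, z)) x.2
        = ∑ j, (matPderiv i (fun z => dConn G w j (x.1, z) * (G (x.1, z))⁻¹) x.2 i j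
          - matPderiv i (fun z => dConn G w j (x.1, z) * (G (x.1, z))⁻¹) x.2 j i) := by
      simp only [pderiv, varField, matDeriv, Matrix.of_apply]
      have d3 := fun j a b => (hT j).slice.diff a b
      rw [fderiv_fun_sum fun j _ => (d3 j i j).fun_sub (d3 j j i)]
      simp only [_root_.sum_apply]
      refine Finset.sum_congr rfl fun j _ => ?_
      rw [fderiv_fun_sub (d3 j i j) (d3 j j i)]
      rfl
    rw [← h2]
    simp only [pderiv] at hd ⊢
    rw [fderiv_fun_mul d1 d2]
    simp only [_root_.add_apply, _root_.smul_apply, smul_eq_mul, hd]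
    change _ + varField G w i x * _ = _
    simp only [famConn]
    ring
  simp only [hX, ← Finset.mul_sum, hdT]
  congr 1
  have h := sum_curvature_variation (fun i => famConn G i x) (fun i => dConn G w i x)
    (fun i j => matDeriv (dConn G w j) x (0, EuclideanSpace.single i 1)) (G x)⁻¹
    (fun k i j => hG.famConn_symm hx k i j)
  simp only [← hG.matDeriv_famCurv hx] at h
  refine Eq.trans h.symm ?_
  simp only [Matrix.trace, Matrix.diag, Matrix.mul_apply, hG.matDeriv_famRicci hx, Finset.mul_sum]
  calc ∑ i, ∑ j, ∑ k, matDeriv (famCurv G i j) x (w, 0) i k * (G x)⁻¹ k j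
      = ∑ j, ∑ i, ∑ k, (G x)⁻¹ k j * matDeriv (famCurv G i j) x (w, 0) i k := by
        rw [Finset.sum_comm]
        simp only [mul_comm]
    _ = ∑ j, ∑ k, ∑ i, (G x)⁻¹ k j * matDeriv (famCurv G i j) x (w, 0) i k :=
        Finset.sum_congr rfl fun j _ => Finset.sum_comm
    _ = _ := Finset.sum_comm

theorem fderiv_famScal (hG : IsFamilyOn G O) (hx : x ∈ O) (w : E) :
    fderiv ℝ (famScal G) x (w, 0) = ((G x)⁻¹ * matDeriv (famRicci G) x (w, 0)).trace
      - ((G x)⁻¹ * famRicci G x * (G x)⁻¹ * matDeriv G x (w, 0)).trace := by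
  have hW := hG.inv_smooth hx
  have hR := hG.famRicci_smooth hx
  have h0 : famScal G =ᶠ[𝓝 x] fun x => ((G x)⁻¹ * famRicci G x).trace := by
    filter_upwards [hG.mem_nhds hx] with z hz using hG.famScal_eq hz
  rw [h0.fderiv_eq, fderiv_trace (hW.mul hR), matDeriv_mul hW hR,
    matDeriv_inv (hG.smooth x hx) (hG.det_ne x hx), Matrix.trace_add, neg_mul,
    Matrix.trace_neg, Matrix.trace_mul_comm (_ * _ * _)]
  have : (famRicci G x * ((G x)⁻¹ * matDeriv G x (w, 0) * (G x)⁻¹)).trace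
      = ((G x)⁻¹ * famRicci G x * (G x)⁻¹ * matDeriv G x (w, 0)).trace := by
    rw [← mul_assoc, Matrix.trace_mul_comm]
    congr 1
    noncomm_ring
  rw [this]
  ring

/-- The first variation of the density `(scal + c) √det G` of the Einstein--Hilbert functional. -/
theorem fderiv_scal_density (hG : IsFamilyOn G O) (hx : x ∈ O) (hpos : 0 < (G x).det) (w : E)
    (c : ℝ) :
    fderiv ℝ (fun x => (famScal G x + c) * √(G x).det) x (w, 0)
      = √(G x).det * (((G x)⁻¹ * matDeriv (famRicci G) x (w, 0)).trace
        - ((G x)⁻¹ * famRicci G x * (G x)⁻¹ * matDeriv G x (w, 0)).trace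
        + (1 / 2) * (famScal G x + c) * ((G x)⁻¹ * matDeriv G x (w, 0)).trace) := by
  have h1 := hG.fderiv_famScal hx w
  have hd : fderiv ℝ (fun x => √(G x).det) x (w, 0)
      = (1 / 2) * √(G x).det * ((G x)⁻¹ * matDeriv G x (w, 0)).trace := by
    have h := (((hG.smooth x hx).det.diffAt.hasFDerivAt).sqrt hpos.ne').fderiv
    rw [h]
    simp only [_root_.smul_apply, smul_eq_mul, fderiv_det (hG.smooth x hx) (hG.det_ne x hx)]
    have h3 : √(G x).det ≠ 0 := (Real.sqrt_pos.2 hpos).ne'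
    field_simp
    rw [Real.sq_sqrt hpos.le]
  rw [fderiv_fun_mul ((hG.famScal_smooth hx).diffAt.add_const c) (hG.sqrt_det_smooth hx).diffAt,
    fderiv_add_const]
  simp only [_root_.add_apply, _root_.smul_apply, smul_eq_mul, h1, hd]
  ring

end IsFamilyOn

end Family

/-! ### Infinitesimal Einstein deformations to first order -/

section Deformation

variable {n : ℕ} {E : Type*} [NormedAddCommGroup E] [NormedSpace ℝ E]

theorem divLocal_eq (G h : Coord n → Matrix (Fin n) (Fin n) ℝ) (y : Coord n) (j : Fin n) :
    divLocal G h y j = -∑ k, ((G y)⁻¹ * cov G h k y) k j := rfl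

theorem curvActionLocal_eq (G : Coord n → Matrix (Fin n) (Fin n) ℝ)
    {h : Coord n → Matrix (Fin n) (Fin n) ℝ} {y : Coord n} (hs : (h y)ᵀ = h y) (j k : Fin n) :
    curvActionLocal G h y j k = ∑ i, ((G y)⁻¹ * h y * curv G i j y) i k := by
  have h1 : ∀ a b, h y a b = h y b a := fun a b => congrFun (congrFun hs b) a
  simp only [curvActionLocal, Matrix.of_apply, ← Finset.sum_neg_distrib, Matrix.mul_apply,
    Finset.sum_mul]
  refine Finset.sum_congr rfl fun a _ => ?_
  rw [Finset.sum_comm]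
  refine Finset.sum_congr rfl fun l _ => Finset.sum_congr rfl fun b _ => ?_
  have h2 : riemann G l j a k y = -curv G a j y l k := by
    rw [curv_swap G a j, Matrix.neg_apply, neg_neg]
    rfl
  rw [h2, h1 b l]
  ring

namespace IsMetricOn

variable {G : Coord n → Matrix (Fin n) (Fin n) ℝ} {U : Set (Coord n)} {y : Coord n}

/-- Commuting the covariant derivatives in `gⁱˡ ∇ᵢ ∇ⱼ hₗₖ` for a divergence-free tensor on an
Einstein manifold. -/
theorem sum_inv_mul_cov₂ (hG : IsMetricOn G U) (hy : y ∈ U)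
    {h : Coord n → Matrix (Fin n) (Fin n) ℝ} (hh : ∀ y ∈ U, MatSmoothAt h y)
    (hs : (h y)ᵀ = h y) (hdiv : ∀ y ∈ U, divLocal G h y = 0) {lam : ℝ}
    (hE : ricciLocal G y = lam • G y) (j k : Fin n) :
    ∑ i, ((G y)⁻¹ * cov₂ G h i j y) i k = lam * h y j k - curvActionLocal G h y j k := by
  have hdiv' : ∀ z ∈ U, ∀ k, ∑ i, ((G z)⁻¹ * cov G h i z) i k = 0 := by
    intro z hz k
    have := congrFun (hdiv z hz) k
    rw [divLocal_eq] at this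
    simpa using this
  have hW := (hG.smooth y hy).inv (hG.det_ne y hy)
  have hH := fun i => hG.cov_smooth hy (hh y hy) i
  -- the divergence of `∇ⱼ h` vanishes
  have h1 : ∑ i, ((G y)⁻¹ * cov₂ G h j i y) i k = 0 := by
    have e1 : ∀ i, (G y)⁻¹ * cov₂ G h j i y
        = matPderiv j (fun z => (G z)⁻¹ * cov G h i z) y
          + conn G j y * ((G y)⁻¹ * cov G h i y) - (G y)⁻¹ * cov G h i y * conn G j y
          - ∑ l, conn G j y l i • ((G y)⁻¹ * cov G h l y) := by
      intro i
      rw [matPderiv, matDeriv_mul hW (hH i), ← matPderiv, ← matPderiv, hG.matPderiv_inv hy,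
        cov₂_eq]
      have : ∑ l, conn G j y l i • ((G y)⁻¹ * cov G h l y)
          = (G y)⁻¹ * ∑ l, christoffel G l j i y • cov G h l y := by
        simp only [Finset.mul_sum, mul_smul_comm]
        rfl
      rw [this]
      noncomm_ring
    have e2 : ∑ i, matPderiv j (fun z => (G z)⁻¹ * cov G h i z) y i k = 0 := by
      have h0 : (fun z => ∑ i, ((G z)⁻¹ * cov G h i z) i k) =ᶠ[𝓝 y] fun _ => 0 := by
        filter_upwards [hG.mem_nhds hy] with z hz using hdiv' z hz k
      have h2 := congrArg (fun T : Coord n →L[ℝ] ℝ => T (EuclideanSpace.single j (1 : ℝ)))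
        h0.fderiv_eq
      rw [fderiv_fun_sum fun i _ => (hW.mul (hH i)).diff i k] at h2
      simpa [matDeriv] using h2
    have e3 : ∑ i, ((G y)⁻¹ * cov G h i y * conn G j y) i k = 0 := by
      simp only [Matrix.mul_apply (M := (G y)⁻¹ * _)]
      rw [Finset.sum_comm]
      simp only [← Finset.sum_mul, hdiv' y hy, zero_mul, Finset.sum_const_zero]
    have e4 : ∑ i, (∑ l, conn G j y l i • ((G y)⁻¹ * cov G h l y)) i k
        = ∑ i, (conn G j y * ((G y)⁻¹ * cov G h i y)) i k := by
      simp only [Matrix.sum_apply, Matrix.smul_apply, smul_eq_mul,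
        Matrix.mul_apply (M := conn G j y)]
      exact Finset.sum_comm
    simp only [e1, Matrix.sub_apply, Matrix.add_apply, Finset.sum_sub_distrib,
      Finset.sum_add_distrib, e2, e3, e4]
    ring
  have h2 : ∀ i, (G y)⁻¹ * cov₂ G h i j y = (G y)⁻¹ * cov₂ G h j i y
      + curv G i j y * ((G y)⁻¹ * h y) - (G y)⁻¹ * h y * curv G i j y := by
    intro i
    have e := hG.cov₂_comm hy hh i j
    have e' : cov₂ G h i j y
        = cov₂ G h j i y + (-((curv G i j y)ᵀ * h y) - h y * curv G i j y) := by
      rw [← e]; abel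
    rw [e', mul_add, mul_sub, mul_neg, ← mul_assoc, hG.inv_mul_curv_transpose hy]
    noncomm_ring
  have h3 : ∑ i, (curv G i j y * ((G y)⁻¹ * h y)) i k = lam * h y j k := by
    have : ∑ i, (curv G i j y * ((G y)⁻¹ * h y)) i k
        = (ricciLocal G y * ((G y)⁻¹ * h y)) j k := by
      simp only [Matrix.mul_apply (N := (G y)⁻¹ * _), ricciLocal_apply, Finset.sum_mul]
      exact Finset.sum_comm
    rw [this, hE, smul_mul_assoc, ← mul_assoc, hG.mul_inv hy, one_mul]
    rfl
  simp only [h2, Matrix.sub_apply, Matrix.add_apply, Finset.sum_sub_distrib,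
    Finset.sum_add_distrib, h1, h3, curvActionLocal_eq G hs]
  ring

theorem cov_symm (hG : IsMetricOn G U) (hy : y ∈ U) {h : Coord n → Matrix (Fin n) (Fin n) ℝ}
    (hs : ∀ y ∈ U, (h y)ᵀ = h y) (k : Fin n) : (cov G h k y)ᵀ = cov G h k y := by
  have h1 : (matPderiv k h y)ᵀ = matPderiv k h y := by
    rw [matPderiv, ← matDeriv_transpose]
    exact matDeriv_congr (by filter_upwards [hG.mem_nhds hy] with z hz using hs z hz) _
  rw [cov_eq, Matrix.transpose_sub, Matrix.transpose_sub, Matrix.transpose_mul,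
    Matrix.transpose_mul, Matrix.transpose_transpose, hs y hy, h1]
  abel

theorem cov₂_symm (hG : IsMetricOn G U) (hy : y ∈ U) {h : Coord n → Matrix (Fin n) (Fin n) ℝ}
    (hs : ∀ y ∈ U, (h y)ᵀ = h y) (m k : Fin n) : (cov₂ G h m k y)ᵀ = cov₂ G h m k y := by
  have h1 : (matPderiv m (cov G h k) y)ᵀ = matPderiv m (cov G h k) y := by
    rw [matPderiv, ← matDeriv_transpose]
    exact matDeriv_congr
      (by filter_upwards [hG.mem_nhds hy] with z hz using hG.cov_symm hz hs k) _
  rw [cov₂_eq, Matrix.transpose_sub, Matrix.transpose_sub, Matrix.transpose_sub,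
    Matrix.transpose_mul, Matrix.transpose_mul, Matrix.transpose_transpose, h1,
    Matrix.transpose_sum]
  simp only [Matrix.transpose_smul, hG.cov_symm hy hs]
  abel

end IsMetricOn

namespace IsFamilyOn

variable {G : E × Coord n → Matrix (Fin n) (Fin n) ℝ} {O : Set (E × Coord n)} {x : E × Coord n}

/-- The derivative of the Levi-Civita connection with a lowered index determines the covariant
derivative of the variation of the metric. -/
theorem cov_variation (hG : IsFamilyOn G O) (hx : x ∈ O) (w : E) (i : Fin n) :
    cov (fun z => G (x.1, z)) (fun z => matDeriv G (x.1, z) (w, 0)) i x.2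
      = (G x * dConn G w i x)ᵀ + G x * dConn G w i x := by
  have hs := hG.smooth x hx
  have hA := hG.famConn_smooth hx i
  have h1 : (fun x => matDeriv G x (0, EuclideanSpace.single i 1)) =ᶠ[𝓝 x]
      fun x => (famConn G i x)ᵀ * G x + G x * famConn G i x := by
    filter_upwards [hG.mem_nhds hx] with z hz
    rw [← matPderiv_slice (hG.smooth z hz)]
    exact (hG.slice z.1).matPderiv_eq (y := z.2) hz i
  have h2 := matDeriv_congr h1 (w, 0)
  rw [matDeriv_comm hs, matDeriv_add (hA.transpose.mul hs) (hs.mul hA),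
    matDeriv_mul hA.transpose hs, matDeriv_mul hs hA, matDeriv_transpose] at h2
  rw [cov_eq, matPderiv_slice (F := fun z => matDeriv G z (w, 0)) (hs.matDeriv _), h2,
    Matrix.transpose_mul, hG.symm x hx]
  simp only [famConn, dConn]
  abel

theorem lower_dConn_symm (hG : IsFamilyOn G O) (hx : x ∈ O) (w : E) (l i j : Fin n) :
    (G x * dConn G w i x) l j = (G x * dConn G w j x) l i := by
  simp only [Matrix.mul_apply]
  exact Finset.sum_congr rfl fun k _ => by rw [hG.dConn_symm hx w k i j]

/-- The derivative of the Levi-Civita connection in terms of the variation of the metric. -/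
theorem lower_dConn (hG : IsFamilyOn G O) (hx : x ∈ O) (w : E) (j l k : Fin n) :
    (G x * dConn G w j x) l k = (1 / 2) *
      (cov (fun z => G (x.1, z)) (fun z => matDeriv G (x.1, z) (w, 0)) j x.2 l k
      + cov (fun z => G (x.1, z)) (fun z => matDeriv G (x.1, z) (w, 0)) k x.2 l j
      - cov (fun z => G (x.1, z)) (fun z => matDeriv G (x.1, z) (w, 0)) l x.2 j k) := by
  have hs := fun l i j => hG.lower_dConn_symm hx w l i j
  simp only [hG.cov_variation hx, Matrix.add_apply, Matrix.transpose_apply]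
  rw [hs k j l, hs j k l, hs l k j]
  ring

/-- For a trace-free variation of the metric, the derivative of the volume form, and with it the
trace of the derivative of the connection, vanishes. -/
theorem trace_dConn_eq_zero (hG : IsFamilyOn G O) (hx : x ∈ O) {w : E}
    (htr : ∀ z, (x.1, z) ∈ O → ((G (x.1, z))⁻¹ * matDeriv G (x.1, z) (w, 0)).trace = 0)
    (i : Fin n) : (dConn G w i x).trace = 0 := by
  have hGs := hG.slice x.1
  have hx2 : x.2 ∈ {z | (x.1, z) ∈ O} := hx
  have hh : MatSmoothAt (fun z => matDeriv G (x.1, z) (w, 0)) x.2 :=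
    ((hG.smooth x hx).matDeriv (w, 0)).slice
  have h0 : (fun z => ((G (x.1, z))⁻¹ * matDeriv G (x.1, z) (w, 0)).trace) =ᶠ[𝓝 x.2]
      fun _ => 0 := by
    filter_upwards [hGs.mem_nhds hx2] with z hz using htr z hz
  have h1 := congrArg (fun T : Coord n →L[ℝ] ℝ => T (EuclideanSpace.single i (1 : ℝ))) h0.fderiv_eq
  have hW := (hG.inv_smooth hx).slice
  simp only [fderiv_trace (hW.mul hh), matDeriv_mul hW hh] at h1
  have h2 := hGs.matPderiv_inv hx2 i
  have h3 := hG.cov_variation hx w i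
  rw [cov_eq] at h3
  rw [matPderiv] at h2 h3
  rw [h2] at h1
  have h4 : matDeriv (fun z => matDeriv G (x.1, z) (w, 0)) x.2 (EuclideanSpace.single i 1)
      = (G x * dConn G w i x)ᵀ + G x * dConn G w i x
        + (conn (fun z => G (x.1, z)) i x.2)ᵀ * matDeriv G x (w, 0)
        + matDeriv G x (w, 0) * conn (fun z => G (x.1, z)) i x.2 := by
    rw [← h3]
    abel
  have h5 : ((G x)⁻¹ * (G x * dConn G w i x)ᵀ).trace = (dConn G w i x).trace := by
    rw [Matrix.transpose_mul, hG.symm x hx, Matrix.trace_mul_comm, mul_assoc,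
      show G x * (G x)⁻¹ = 1 from hGs.mul_inv hx2, mul_one, Matrix.trace_transpose]
  have h6 : (G x)⁻¹ * G x = 1 := hGs.inv_mul hx2
  rw [h4] at h1
  simp only [mul_add] at h1
  rw [← mul_assoc _ (G x), h6, one_mul] at h1
  simp only [Matrix.trace_add, h5, sub_mul, neg_mul, Matrix.trace_sub,
    Matrix.trace_neg, fderiv_fun_const, Pi.zero_apply, _root_.zero_apply] at h1
  have h7 : (conn (fun z => G (x.1, z)) i x.2 * (G x)⁻¹ * matDeriv G x (w, 0)).trace
      = ((G x)⁻¹ * (matDeriv G x (w, 0) * conn (fun z => G (x.1, z)) i x.2)).trace := by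
    rw [mul_assoc, Matrix.trace_mul_comm, mul_assoc]
  have h8 : (G x)⁻¹ * (conn (fun z => G (x.1, z)) i x.2)ᵀ * matDeriv G x (w, 0)
      = (G x)⁻¹ * ((conn (fun z => G (x.1, z)) i x.2)ᵀ * matDeriv G x (w, 0)) := mul_assoc _ _ _
  change -((G x)⁻¹ * (conn (fun z => G (x.1, z)) i x.2)ᵀ * matDeriv G x (w, 0)).trace
    - (conn (fun z => G (x.1, z)) i x.2 * (G x)⁻¹ * matDeriv G x (w, 0)).trace + _ = 0 at h1
  rw [h7, h8] at h1
  linarith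

/-- The derivative of the Ricci tensor in the direction of an infinitesimal Einstein deformation
`h` of an Einstein metric is `λ h`: for a divergence-free and trace-free `h` it is
`½ ∇*∇ h + λ h - R̊ h`. -/
theorem matDeriv_famRicci_eq (hG : IsFamilyOn G O) (hx : x ∈ O) {w : E} {lam : ℝ}
    (htr : ∀ z, (x.1, z) ∈ O → ((G (x.1, z))⁻¹ * matDeriv G (x.1, z) (w, 0)).trace = 0)
    (hdiv : ∀ z, (x.1, z) ∈ O →
      divLocal (fun z => G (x.1, z)) (fun z => matDeriv G (x.1, z) (w, 0)) z = 0)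
    (hop : einsteinOpLocal (fun z => G (x.1, z)) (fun z => matDeriv G (x.1, z) (w, 0)) x.2 = 0)
    (hE : famRicci G x = lam • G x) :
    matDeriv (famRicci G) x (w, 0) = lam • matDeriv G x (w, 0) := by
  set g : Coord n → Matrix (Fin n) (Fin n) ℝ := fun z => G (x.1, z) with hg
  set h : Coord n → Matrix (Fin n) (Fin n) ℝ := fun z => matDeriv G (x.1, z) (w, 0) with hh
  set U : Set (Coord n) := {z | (x.1, z) ∈ O} with hU
  have hGs : IsMetricOn g U := hG.slice x.1
  have hx2 : x.2 ∈ U := hx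
  have hhs : ∀ z ∈ U, MatSmoothAt h z := fun z hz =>
    ((hG.smooth (x.1, z) hz).matDeriv (w, 0)).slice
  have hsym : ∀ z ∈ U, (h z)ᵀ = h z := by
    intro z hz
    rw [hh, ← matDeriv_transpose]
    refine matDeriv_congr ?_ _
    filter_upwards [hG.mem_nhds hz] with u hu using hG.symm u hu
  have hC := fun i => hG.dConn_smooth hx w i
  have hA := fun i => hG.famConn_smooth hx i
  have hK := fun i => (hG.smooth x hx).mul (hC i)
  -- `L i j` is the covariant derivative `∇ᵢ` of the tensor `K j = G Ċⱼ`
  set L : Fin n → Fin n → Matrix (Fin n) (Fin n) ℝ := fun i j =>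
    matPderiv i (fun z => G (x.1, z) * dConn G w j (x.1, z)) x.2
      - (conn g i x.2)ᵀ * (G x * dConn G w j x) - (G x * dConn G w j x) * conn g i x.2
      - ∑ m, christoffel g m i j x.2 • (G x * dConn G w m x) with hL
  have hWG : (G x)⁻¹ * G x = 1 := hGs.inv_mul hx2
  have htr0 : ∀ z ∈ U, ∀ k, ∑ i, dConn G w i (x.1, z) i k = 0 := by
    intro z hz k
    have := hG.trace_dConn_eq_zero (x := (x.1, z)) hz htr k
    rw [← this]
    exact Finset.sum_congr rfl fun i _ => hG.dConn_symm hz w i i k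
  have hRic : ∀ j k, matDeriv (famRicci G) x (w, 0) j k = ∑ i, ((G x)⁻¹ * L i j) i k := by
    intro j k
    have e1 : ∀ i, (G x)⁻¹ * L i j = matDeriv (dConn G w j) x (0, EuclideanSpace.single i 1)
        + famConn G i x * dConn G w j x - dConn G w j x * famConn G i x
        - ∑ m, conn g i x.2 m j • dConn G w m x := by
      intro i
      have a1 : matPderiv i (fun z => dConn G w j (x.1, z)) x.2
          = matPderiv i (fun z => (g z)⁻¹ * (G (x.1, z) * dConn G w j (x.1, z))) x.2 := by
        refine matDeriv_congr ?_ _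
        filter_upwards [hGs.mem_nhds hx2] with z hz
        rw [← mul_assoc, hGs.inv_mul hz, one_mul]
      rw [← matPderiv_slice (hC j), a1, matPderiv,
        matDeriv_mul (F := fun z => (g z)⁻¹) (hG.inv_smooth hx).slice (hK j).slice, ← matPderiv,
        ← matPderiv, hGs.matPderiv_inv hx2 i]
      have a2 : (G x)⁻¹ * ∑ m, christoffel g m i j x.2 • (G x * dConn G w m x)
          = ∑ m, conn g i x.2 m j • dConn G w m x := by
        simp only [Finset.mul_sum, mul_smul_comm, ← mul_assoc, hWG, one_mul]
        rfl
      change (G x)⁻¹ * L i j = (-((G x)⁻¹ * (conn g i x.2)ᵀ) - conn g i x.2 * (G x)⁻¹)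
        * (G x * dConn G w j x) + (G x)⁻¹ * _ + conn g i x.2 * dConn G w j x
        - dConn G w j x * conn g i x.2 - _
      simp only [hL, mul_sub, a2, sub_mul, neg_mul]
      have a3 : conn g i x.2 * (G x)⁻¹ * (G x * dConn G w j x) = conn g i x.2 * dConn G w j x := by
        rw [mul_assoc, ← mul_assoc _ (G x), hWG, one_mul]
      have a4 : (G x)⁻¹ * (G x * dConn G w j x * conn g i x.2)
          = dConn G w j x * conn g i x.2 := by
        rw [mul_assoc (G x), ← mul_assoc _ (G x), hWG, one_mul]
      rw [a3, a4, mul_assoc]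
      abel
    have e2 : ∑ i, matDeriv (dConn G w i) x (0, EuclideanSpace.single j 1) i k = 0 := by
      have h0 : (fun z => ∑ i, dConn G w i (x.1, z) i k) =ᶠ[𝓝 x.2] fun _ => 0 := by
        filter_upwards [hGs.mem_nhds hx2] with z hz using htr0 z hz k
      have h2 := congrArg (fun T : Coord n →L[ℝ] ℝ => T (EuclideanSpace.single j (1 : ℝ)))
        h0.fderiv_eq
      rw [fderiv_fun_sum fun i _ => (hC i).slice.diff i k] at h2
      simp only [← matPderiv_slice (hC _)]
      simpa [matDeriv] using h2
    have e3 : ∑ i, (dConn G w i x * famConn G j x) i k = 0 := by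
      simp only [Matrix.mul_apply]
      rw [Finset.sum_comm]
      have := htr0 x.2 hx2
      simp only [← Finset.sum_mul]
      exact Finset.sum_eq_zero fun m _ => by rw [this m, zero_mul]
    have e4 : ∑ i, (∑ m, conn g i x.2 m j • dConn G w m x) i k
        = ∑ i, (famConn G j x * dConn G w i x) i k := by
      simp only [Matrix.sum_apply, Matrix.smul_apply, smul_eq_mul, Matrix.mul_apply]
      rw [Finset.sum_comm]
      exact Finset.sum_congr rfl fun m _ => Finset.sum_congr rfl fun i _ => by
        rw [hGs.conn_symm hx2 m i j]; rfl
    rw [hG.matDeriv_famRicci hx]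
    simp only [hG.matDeriv_famCurv hx, e1, Matrix.add_apply, Matrix.sub_apply,
      Finset.sum_add_distrib, Finset.sum_sub_distrib, e2, e3, e4]
    ring
  have hLcov : ∀ i j l k, L i j l k
      = (1 / 2) * (cov₂ g h i j x.2 l k + cov₂ g h i k x.2 l j - cov₂ g h i l x.2 j k) := by
    intro i j l k
    have a1 : ∀ z ∈ U, ∀ j l k, (G (x.1, z) * dConn G w j (x.1, z)) l k
        = (1 / 2) * (cov g h j z l k + cov g h k z l j - cov g h l z j k) :=
      fun z hz j l k => hG.lower_dConn (x := (x.1, z)) hz w j l k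
    have hH := fun i => hGs.cov_smooth hx2 (hhs _ hx2) i
    have a2 : matPderiv i (fun z => G (x.1, z) * dConn G w j (x.1, z)) x.2 l k
        = (1 / 2) * (matPderiv i (cov g h j) x.2 l k + matPderiv i (cov g h k) x.2 l j
          - matPderiv i (cov g h l) x.2 j k) := by
      have h0 : (fun z => (G (x.1, z) * dConn G w j (x.1, z)) l k) =ᶠ[𝓝 x.2]
          fun z => (1 / 2) * (cov g h j z l k + cov g h k z l j - cov g h l z j k) := by
        filter_upwards [hGs.mem_nhds hx2] with z hz using a1 z hz j l k
      simp only [matDeriv, Matrix.of_apply]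
      rw [h0.fderiv_eq, fderiv_const_mul ((((hH j).diff l k).fun_add ((hH k).diff l j)).fun_sub
        ((hH l).diff j k)), fderiv_fun_sub (((hH j).diff l k).fun_add ((hH k).diff l j))
        ((hH l).diff j k), fderiv_fun_add ((hH j).diff l k) ((hH k).diff l j)]
      rfl
    have a3 : ∀ j l k, (G x * dConn G w j x) l k
        = (1 / 2) * (cov g h j x.2 l k + cov g h k x.2 l j - cov g h l x.2 j k) :=
      a1 x.2 hx2
    simp only [hL, cov₂_eq, Matrix.sub_apply, a2, Matrix.mul_apply (M := (conn g i x.2)ᵀ),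
      Matrix.mul_apply (N := conn g i x.2), Matrix.sum_apply, Matrix.smul_apply, smul_eq_mul]
    simp only [Matrix.transpose_apply, a3, conn, Matrix.of_apply]
    have hcs : ∀ m l k, cov g h m x.2 l k = cov g h m x.2 k l := fun m l k =>
      congrFun (congrFun (hGs.cov_symm hx2 hsym m) k) l
    have a4 : ∑ m, christoffel g m i l x.2 * ((1 / 2) * (cov g h j x.2 m k + cov g h k x.2 m j
            - cov g h m x.2 j k))
        + ∑ m, (1 / 2) * (cov g h j x.2 l m + cov g h m x.2 l j - cov g h l x.2 j m)
            * christoffel g m i k x.2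
        + ∑ m, christoffel g m i j x.2 * ((1 / 2) * (cov g h m x.2 l k + cov g h k x.2 l m
            - cov g h l x.2 m k))
        = (1 / 2) * ((∑ m, christoffel g m i l x.2 * cov g h j x.2 m k
              + ∑ m, cov g h j x.2 l m * christoffel g m i k x.2
              + ∑ m, christoffel g m i j x.2 * cov g h m x.2 l k)
            + (∑ m, christoffel g m i l x.2 * cov g h k x.2 m j
              + ∑ m, cov g h k x.2 l m * christoffel g m i j x.2
              + ∑ m, christoffel g m i k x.2 * cov g h m x.2 l j)
            - (∑ m, christoffel g m i j x.2 * cov g h l x.2 m k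
              + ∑ m, cov g h l x.2 j m * christoffel g m i k x.2
              + ∑ m, christoffel g m i l x.2 * cov g h m x.2 j k)) := by
      simp only [← Finset.sum_add_distrib, ← Finset.sum_sub_distrib, Finset.mul_sum]
      exact Finset.sum_congr rfl fun m _ => by ring
    linarith
  have hrough : ∀ j k, roughLaplacianLocal g h x.2 j k
      = -∑ i, ∑ l, (G x)⁻¹ i l * cov₂ g h i l x.2 j k := fun j k => rfl
  have hop' : ∀ j k, roughLaplacianLocal g h x.2 j k = 2 * curvActionLocal g h x.2 j k := by
    intro j k
    have := congrFun (congrFun hop j) k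
    simp only [einsteinOpLocal, Matrix.sub_apply, Matrix.smul_apply, smul_eq_mul,
      Matrix.zero_apply] at this
    linarith
  have hrs : ∀ j k, roughLaplacianLocal g h x.2 j k = roughLaplacianLocal g h x.2 k j := by
    intro j k
    rw [hrough, hrough]
    congr 1
    refine Finset.sum_congr rfl fun i _ => Finset.sum_congr rfl fun l _ => ?_
    rw [show cov₂ g h i l x.2 j k = cov₂ g h i l x.2 k j from
      congrFun (congrFun (hGs.cov₂_symm hx2 hsym i l) k) j]
  ext j k
  have hsum : ∀ j k, ∑ i, ∑ l, (G x)⁻¹ i l * cov₂ g h i j x.2 l k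
      = lam * h x.2 j k - curvActionLocal g h x.2 j k := fun j k =>
    hGs.sum_inv_mul_cov₂ hx2 hhs (hsym _ hx2) hdiv hE j k
  have hexp : ∑ i, ((G x)⁻¹ * L i j) i k
      = (1 / 2) * (∑ i, ∑ l, (G x)⁻¹ i l * cov₂ g h i j x.2 l k
        + ∑ i, ∑ l, (G x)⁻¹ i l * cov₂ g h i k x.2 l j
        - ∑ i, ∑ l, (G x)⁻¹ i l * cov₂ g h i l x.2 j k) := by
    simp only [Matrix.mul_apply, hLcov, ← Finset.sum_add_distrib, ← Finset.sum_sub_distrib,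
      Finset.mul_sum]
    exact Finset.sum_congr rfl fun i _ => Finset.sum_congr rfl fun l _ => by ring
  have hsjk : h x.2 k j = h x.2 j k := congrFun (congrFun (hsym _ hx2) j) k
  have r1 := hop' j k
  have r2 := hop' k j
  have r3 := hrs j k
  have r4 := hrough j k
  rw [hRic, hexp, hsum, hsum, hsjk, Matrix.smul_apply, smul_eq_mul]
  change _ = lam * h x.2 j k
  linarith

end IsFamilyOn

end Deformation

/-! ### Changes of coordinates in families of metrics -/

section FamilyPullback

variable {n : ℕ} {E : Type*} [NormedAddCommGroup E] [NormedSpace ℝ E]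

theorem contDiffAt_slice_left (x : E × Coord n) :
    ContDiffAt ℝ ∞ (fun u : E => (u, x.2)) x.1 :=
  contDiffAt_id.prodMk contDiffAt_const

theorem MatSmoothAt.slice_left {F : E × Coord n → Matrix (Fin n) (Fin n) ℝ} {x : E × Coord n}
    (hF : MatSmoothAt F x) : MatSmoothAt (fun u => F (u, x.2)) x.1 :=
  MatSmoothAt.comp (f := fun u : E => (u, x.2)) hF (contDiffAt_slice_left x)

theorem fderiv_slice_left {f : E × Coord n → ℝ} {x : E × Coord n} (hf : DifferentiableAt ℝ f x)
    (w : E) : fderiv ℝ (fun u => f (u, x.2)) x.1 w = fderiv ℝ f x (w, 0) := by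
  have h := (HasFDerivAt.comp (f := fun u : E => (u, x.2)) (g := f) x.1
    (hf.hasFDerivAt) (hasFDerivAt_prodMk_left x.1 x.2)).fderiv
  exact congrArg (fun T : E →L[ℝ] ℝ => T w) h

theorem matDeriv_slice_left {F : E × Coord n → Matrix (Fin n) (Fin n) ℝ} {x : E × Coord n}
    (hF : MatSmoothAt F x) (w : E) :
    matDeriv (fun u => F (u, x.2)) x.1 w = matDeriv F x (w, 0) := by
  ext i j
  exact fderiv_slice_left (hF.diff i j) w

theorem matDeriv_const_mul {F : E → Matrix (Fin n) (Fin n) ℝ} {x : E} (hF : MatSmoothAt F x)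
    (A : Matrix (Fin n) (Fin n) ℝ) (w : E) :
    matDeriv (fun u => A * F u) x w = A * matDeriv F x w := by
  rw [matDeriv_mul (MatSmoothAt.const A) hF, matDeriv_const, zero_mul, zero_add]

theorem matDeriv_mul_const {F : E → Matrix (Fin n) (Fin n) ℝ} {x : E} (hF : MatSmoothAt F x)
    (A : Matrix (Fin n) (Fin n) ℝ) (w : E) :
    matDeriv (fun u => F u * A) x w = matDeriv F x w * A := by
  rw [matDeriv_mul hF (MatSmoothAt.const A), matDeriv_const, mul_zero, add_zero]

theorem matDeriv_const_smul {F : E → Matrix (Fin n) (Fin n) ℝ} {x : E} (hF : MatSmoothAt F x)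
    (c : ℝ) (w : E) : matDeriv (fun u => c • F u) x w = c • matDeriv F x w := by
  rw [matDeriv_smul contDiffAt_const hF]
  simp

/-- The family `G'` is the pullback of the family `G` by the change of coordinates `ψ`, which does
not depend on the parameter. -/
structure IsFamPullbackOn (G : E × Coord n → Matrix (Fin n) (Fin n) ℝ) (O : Set (E × Coord n))
    (ψ : Coord n → Coord n) (G' : E × Coord n → Matrix (Fin n) (Fin n) ℝ)
    (O' : Set (E × Coord n)) : Prop where
  family : IsFamilyOn G O
  family' : IsFamilyOn G' O'
  mapsTo : ∀ x ∈ O', (x.1, ψ x.2) ∈ O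
  smooth : ∀ x ∈ O', ContDiffAt ℝ ∞ ψ x.2
  eq : ∀ x ∈ O', G' x = (jac ψ x.2)ᵀ * G (x.1, ψ x.2) * jac ψ x.2

namespace IsFamPullbackOn

variable {G G' : E × Coord n → Matrix (Fin n) (Fin n) ℝ} {O O' : Set (E × Coord n)}
  {ψ : Coord n → Coord n} {x : E × Coord n}

theorem slice (hP : IsFamPullbackOn G O ψ G' O') (v : E) :
    IsPullbackOn (fun z => G (v, z)) {z | (v, z) ∈ O} ψ (fun z => G' (v, z))
      {z | (v, z) ∈ O'} where
  metric := hP.family.slice v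
  metric' := hP.family'.slice v
  mapsTo z hz := hP.mapsTo (v, z) hz
  smooth z hz := hP.smooth (v, z) hz
  eq z hz := hP.eq (v, z) hz

/-- The derivative of the connection is a tensor. -/
theorem jac_mul_dConn (hP : IsFamPullbackOn G O ψ G' O') (hx : x ∈ O') (w : E) (i : Fin n) :
    jac ψ x.2 * dConn G' w i x
      = (∑ a, jac ψ x.2 a i • dConn G w a (x.1, ψ x.2)) * jac ψ x.2 := by
  have hm := hP.mapsTo x hx
  have hA' := (hP.family'.famConn_smooth hx i)
  have hA := fun a => (hP.family.famConn_smooth hm a)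
  have hA1 : ∀ a, MatSmoothAt (fun u => famConn G a (u, ψ x.2)) x.1 := fun a => (hA a).slice_left
  have hA2 : ∀ a, MatSmoothAt (fun u => jac ψ x.2 a i • famConn G a (u, ψ x.2)) x.1 :=
    fun a => MatSmoothAt.smul contDiffAt_const (hA1 a)
  have h1 : (fun u => jac ψ x.2 * famConn G' i (u, x.2)) =ᶠ[𝓝 x.1] fun u =>
      (∑ a, jac ψ x.2 a i • famConn G a (u, ψ x.2)) * jac ψ x.2 + matPderiv i (jac ψ) x.2 := by
    have ho : ∀ᶠ u in 𝓝 x.1, (u, x.2) ∈ O' :=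
      (hP.family'.isOpen.preimage (by fun_prop : Continuous fun u : E => (u, x.2))).mem_nhds hx
    filter_upwards [ho] with u hu using (hP.slice u).jac_mul_conn (x := x.2) hu i
  have h2 := matDeriv_congr h1 w
  rw [matDeriv_const_mul hA'.slice_left, matDeriv_slice_left hA',
    matDeriv_add ((MatSmoothAt.sum fun a _ => hA2 a).mul (MatSmoothAt.const _))
      (MatSmoothAt.const _), matDeriv_const, add_zero,
    matDeriv_mul_const (MatSmoothAt.sum fun a _ => hA2 a), matDeriv_sum fun a _ => hA2 a] at h2
  simp only [fun a => matDeriv_const_smul (hA1 a)] at h2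
  have h3 : ∀ a, matDeriv (fun u => famConn G a (u, ψ x.2)) x.1 w
      = matDeriv (famConn G a) (x.1, ψ x.2) (w, 0) :=
    fun a => matDeriv_slice_left (x := (x.1, ψ x.2)) (hA a) w
  simp only [h3] at h2
  exact h2

/-- The vector field of the first variation transforms as a vector field. -/
theorem jac_mul_varField (hP : IsFamPullbackOn G O ψ G' O') (hx : x ∈ O') (w : E) (c : Fin n) :
    ∑ m, jac ψ x.2 c m * varField G' w m x = varField G w c (x.1, ψ x.2) := by
  have hS := hP.slice x.1
  have hx2 : x.2 ∈ {z | (x.1, z) ∈ O'} := hx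
  set J := jac ψ x.2 with hJ
  set W := (G (x.1, ψ x.2))⁻¹ with hW
  have hJJ : J * J⁻¹ = 1 := hS.jac_mul_inv hx2
  have hJi : J⁻¹ * J = 1 := hS.inv_jac_mul hx2
  have hJt : (J⁻¹)ᵀ * Jᵀ = 1 := by rw [← Matrix.transpose_mul, hJJ, Matrix.transpose_one]
  have hJt' : Jᵀ * (J⁻¹)ᵀ = 1 := by rw [← Matrix.transpose_mul, hJi, Matrix.transpose_one]
  have hW' : J * (G' x)⁻¹ * Jᵀ = W := hS.jac_mul_inv_mul hx2
  have hT : ∀ j, J * (dConn G' w j x * (G' x)⁻¹)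
      = ∑ a, J a j • (dConn G w a (x.1, ψ x.2) * W * (J⁻¹)ᵀ) := by
    intro j
    have : ∑ a, J a j • (dConn G w a (x.1, ψ x.2) * W * (J⁻¹)ᵀ)
        = (∑ a, J a j • dConn G w a (x.1, ψ x.2)) * (W * (J⁻¹)ᵀ) := by
      simp only [Finset.sum_mul, smul_mul_assoc, mul_assoc]
    rw [this, ← hW', mul_assoc _ Jᵀ, hJt', mul_one, ← mul_assoc, hP.jac_mul_dConn hx, mul_assoc]
  have hT2 : ∀ j, dConn G' w j x * (G' x)⁻¹ * Jᵀ
      = ∑ a, J a j • (J⁻¹ * (dConn G w a (x.1, ψ x.2) * W)) := by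
    intro j
    have h1 := congrArg (fun X => J⁻¹ * X * Jᵀ) (hT j)
    simp only [← mul_assoc, hJi, one_mul] at h1
    rw [h1]
    simp only [Finset.mul_sum, Finset.sum_mul, smul_mul_assoc, mul_smul_comm, mul_assoc, hJt,
      mul_one]
  have e1 : ∑ m, J c m * ∑ j, (dConn G' w j x * (G' x)⁻¹) m j
      = ∑ a, (dConn G w a (x.1, ψ x.2) * W) c a := by
    calc ∑ m, J c m * ∑ j, (dConn G' w j x * (G' x)⁻¹) m j
        = ∑ j, (J * (dConn G' w j x * (G' x)⁻¹)) c j := by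
          simp only [Finset.mul_sum, Matrix.mul_apply (M := J)]
          exact Finset.sum_comm
      _ = ∑ a, ∑ j, (dConn G w a (x.1, ψ x.2) * W * (J⁻¹)ᵀ) c j * Jᵀ j a := by
          simp only [hT, Matrix.sum_apply, Matrix.smul_apply, smul_eq_mul, Matrix.transpose_apply]
          rw [Finset.sum_comm]
          simp only [mul_comm]
      _ = _ := by
          simp only [← Matrix.mul_apply (N := Jᵀ), mul_assoc, hJt, mul_one]
  have e2 : ∑ m, J c m * ∑ j, (dConn G' w j x * (G' x)⁻¹) j m
      = ∑ a, (dConn G w a (x.1, ψ x.2) * W) a c := by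
    calc ∑ m, J c m * ∑ j, (dConn G' w j x * (G' x)⁻¹) j m
        = ∑ j, (dConn G' w j x * (G' x)⁻¹ * Jᵀ) j c := by
          simp only [Finset.mul_sum, Matrix.mul_apply (N := Jᵀ), Matrix.transpose_apply]
          rw [Finset.sum_comm]
          simp only [mul_comm]
      _ = ∑ a, ∑ j, J a j * (J⁻¹ * (dConn G w a (x.1, ψ x.2) * W)) j c := by
          simp only [hT2, Matrix.sum_apply, Matrix.smul_apply, smul_eq_mul]
          exact Finset.sum_comm
      _ = _ := by
          simp only [← Matrix.mul_apply (M := J), ← mul_assoc, hJJ, one_mul]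
  simp only [varField, Finset.sum_sub_distrib, mul_sub, e1, e2]
  rfl

end IsFamPullbackOn

end FamilyPullback

/-! ### Tensors in the charts of a manifold -/

section Charts

variable {n : ℕ} {M : Type*} [TopologicalSpace M] [ChartedSpace (Coord n) M]

theorem isOpen_target (p : M) : IsOpen (extChartAt (𝓡 n) p).target := isOpen_extChartAt_target p

/-- The change of coordinates from the chart at `p` to the chart at `q`. -/
def transition (p q : M) (y : Coord n) : Coord n :=
  extChartAt (𝓡 n) q ((extChartAt (𝓡 n) p).symm y)

/-- The domain of the change of coordinates from the chart at `p` to the chart at `q`. -/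
def overlap (p q : M) : Set (Coord n) :=
  (extChartAt (𝓡 n) p).target ∩ (extChartAt (𝓡 n) p).symm ⁻¹' (extChartAt (𝓡 n) q).source

theorem isOpen_overlap (p q : M) : IsOpen (overlap (n := n) p q) :=
  (continuousOn_extChartAt_symm p).isOpen_inter_preimage (isOpen_target p)
    (isOpen_extChartAt_source q)

theorem transition_mem {p q : M} {y : Coord n} (hy : y ∈ overlap p q) :
    transition p q y ∈ (extChartAt (𝓡 n) q).target :=
  (extChartAt (𝓡 n) q).map_source hy.2

theorem symm_transition {p q : M} {y : Coord n} (hy : y ∈ overlap p q) :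
    (extChartAt (𝓡 n) q).symm (transition p q y) = (extChartAt (𝓡 n) p).symm y :=
  (extChartAt (𝓡 n) q).left_inv hy.2

theorem transition_mem_overlap {p q : M} {y : Coord n} (hy : y ∈ overlap p q) :
    transition p q y ∈ overlap q p := by
  refine ⟨transition_mem hy, ?_⟩
  rw [Set.mem_preimage, symm_transition hy]
  exact (extChartAt (𝓡 n) p).map_target hy.1

theorem transition_transition {p q : M} {y : Coord n} (hy : y ∈ overlap p q) :
    transition q p (transition p q y) = y := by
  rw [transition, symm_transition hy]
  exact (extChartAt (𝓡 n) p).right_inv hy.1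

theorem center_mem_overlap {p m : M} (hm : m ∈ (extChartAt (𝓡 n) p).source) :
    extChartAt (𝓡 n) m m ∈ overlap m p := by
  refine ⟨mem_extChartAt_target m, ?_⟩
  rw [Set.mem_preimage, extChartAt_to_inv]
  exact hm

theorem transition_center (p m : M) :
    transition m p (extChartAt (𝓡 n) m m) = extChartAt (𝓡 n) p m := by
  rw [transition, extChartAt_to_inv]

theorem mem_overlap_symm {q : M} {y : Coord n} (hy : y ∈ (extChartAt (𝓡 n) q).target) :
    extChartAt (𝓡 n) ((extChartAt (𝓡 n) q).symm y) ((extChartAt (𝓡 n) q).symm y)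
      ∈ overlap ((extChartAt (𝓡 n) q).symm y) q :=
  center_mem_overlap ((extChartAt (𝓡 n) q).map_target hy)

theorem transition_symm {q : M} {y : Coord n} (hy : y ∈ (extChartAt (𝓡 n) q).target) :
    transition ((extChartAt (𝓡 n) q).symm y) q
      (extChartAt (𝓡 n) ((extChartAt (𝓡 n) q).symm y) ((extChartAt (𝓡 n) q).symm y)) = y := by
  rw [transition_center, (extChartAt (𝓡 n) q).right_inv hy]

theorem overlap_image (p q : M) (A : Set M) (hA : A ⊆ (extChartAt (𝓡 n) q).source) :
    (extChartAt (𝓡 n) p).target ∩ (extChartAt (𝓡 n) p).symm ⁻¹' A ⊆ overlap p q :=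
  fun _ hy => ⟨hy.1, hA hy.2⟩

variable [IsManifold (𝓡 n) ∞ M]

theorem comps_smoothAt (h : Tensor2 n M) (p : M) {y : Coord n}
    (hy : y ∈ (extChartAt (𝓡 n) p).target) : MatSmoothAt (comps h p) y := by
  intro i j
  have hopen : IsOpen (extChartAt (𝓡 n) p).target := isOpen_extChartAt_target p
  have hsm : ContMDiffOn 𝓘(ℝ, Coord n) (𝓡 n) ∞ (extChartAt (𝓡 n) p).symm
      (extChartAt (𝓡 n) p).target := contMDiffOn_extChartAt_symm p
  have hvec : ∀ i : Fin n, ContMDiffOn 𝓘(ℝ, Coord n) ((𝓡 n).prod 𝓘(ℝ, Coord n)) ∞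
      (fun y : Coord n => (⟨(extChartAt (𝓡 n) p).symm y,
        mfderiv 𝓘(ℝ, Coord n) (𝓡 n) (extChartAt (𝓡 n) p).symm y (EuclideanSpace.single i 1)⟩ :
          TangentBundle (𝓡 n) M)) (extChartAt (𝓡 n) p).target := by
    intro i
    have h1 := hsm.contMDiffOn_tangentMapWithin (m := ∞) (by simp) hopen.uniqueMDiffOn
    have h2 : ContMDiff 𝓘(ℝ, Coord n) (𝓘(ℝ, Coord n).prod 𝓘(ℝ, Coord n)) ∞
        (fun y : Coord n => (⟨y, EuclideanSpace.single i 1⟩ :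
          TangentBundle 𝓘(ℝ, Coord n) (Coord n))) := by
      exact contMDiff_vectorSpace_iff_contDiff.2 contDiff_const
    have h3 := h1.comp (h2.contMDiffOn (s := (extChartAt (𝓡 n) p).target)) (fun y hy => hy)
    refine h3.congr fun y hy => ?_
    simp only [Function.comp, tangentMapWithin]
    rw [mfderivWithin_of_isOpen hopen hy]
  have hh : ContMDiffOn 𝓘(ℝ, Coord n) ((𝓡 n).prod 𝓘(ℝ, Coord n →L[ℝ] Coord n →L[ℝ] ℝ)) ∞
      (fun y : Coord n => Bundle.TotalSpace.mk' (Coord n →L[ℝ] Coord n →L[ℝ] ℝ)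
        (E := fun x : M => TangentSpace (𝓡 n) x →L[ℝ] TangentSpace (𝓡 n) x →L[ℝ] ℝ)
        ((extChartAt (𝓡 n) p).symm y) (h ((extChartAt (𝓡 n) p).symm y)))
      (extChartAt (𝓡 n) p).target :=
    h.contMDiff.comp_contMDiffOn hsm
  have h4 : ContMDiffOn 𝓘(ℝ, Coord n) ((𝓡 n).prod 𝓘(ℝ)) ∞
      (fun y => Bundle.TotalSpace.mk' ℝ (E := Bundle.Trivial M ℝ)
        ((extChartAt (𝓡 n) p).symm y) (comps h p y i j)) (extChartAt (𝓡 n) p).target :=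
    ContMDiffOn.clm_bundle_apply₂ (F₁ := Coord n) (F₂ := Coord n) hh (hvec i) (hvec j)
  have h5 := h4.contMDiffAt (hopen.mem_nhds hy)
  rw [Bundle.contMDiffAt_totalSpace] at h5
  exact h5.2.contDiffAt

theorem transition_contDiffAt {p q : M} {y : Coord n} (hy : y ∈ overlap p q) :
    ContDiffAt ℝ ∞ (transition (n := n) p q) y := by
  refine (contDiffOn_ext_coord_change (I := 𝓡 n) (n := ∞) q p).contDiffAt
    ((isOpen_overlap p q).mem_nhds hy |> fun h => ?_)
  rw [PartialEquiv.trans_source, PartialEquiv.symm_source]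
  exact h

theorem comps_eq_bilin (h : Tensor2 n M) (p : M) (y : Coord n) (i j : Fin n) :
    comps h p y i j = (h ((extChartAt (𝓡 n) p).symm y) : Coord n →L[ℝ] Coord n →L[ℝ] ℝ)
      ((mfderiv 𝓘(ℝ, Coord n) (𝓡 n) (extChartAt (𝓡 n) p).symm y : Coord n →L[ℝ] Coord n)
        (EuclideanSpace.single i 1))
      ((mfderiv 𝓘(ℝ, Coord n) (𝓡 n) (extChartAt (𝓡 n) p).symm y : Coord n →L[ℝ] Coord n)
        (EuclideanSpace.single j 1)) := rfl

/-- The components of a tensor in two charts. -/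
theorem comps_transition (h : Tensor2 n M) {p q : M} {y : Coord n} (hy : y ∈ overlap p q) :
    comps h p y = (jac (transition p q) y)ᵀ * comps h q (transition p q y)
      * jac (transition p q) y := by
  have hψ := transition_contDiffAt hy
  let Dq : Coord n →L[ℝ] Coord n :=
    mfderiv 𝓘(ℝ, Coord n) (𝓡 n) (extChartAt (𝓡 n) q).symm (transition p q y)
  let Dp : Coord n →L[ℝ] Coord n := mfderiv 𝓘(ℝ, Coord n) (𝓡 n) (extChartAt (𝓡 n) p).symm y
  have hD : Dp = Dq.comp (fderiv ℝ (transition p q) y) := by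
    have hq : MDifferentiableAt 𝓘(ℝ, Coord n) (𝓡 n) (extChartAt (𝓡 n) q).symm
        (transition p q y) :=
      ((contMDiffOn_extChartAt_symm (n := ∞) q).contMDiffAt
        ((isOpen_target q).mem_nhds (transition_mem hy))).mdifferentiableAt (by simp)
    have hT : MDifferentiableAt 𝓘(ℝ, Coord n) 𝓘(ℝ, Coord n) (transition p q) y :=
      hψ.diffAt.mdifferentiableAt
    have h1 := mfderiv_comp y hq hT
    have h2 : (extChartAt (𝓡 n) q).symm ∘ transition p q =ᶠ[𝓝 y] (extChartAt (𝓡 n) p).symm := by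
      filter_upwards [(isOpen_overlap p q).mem_nhds hy] with z hz using symm_transition hz
    rw [h2.mfderiv_eq] at h1
    rw [mfderiv_eq_fderiv] at h1
    exact h1
  have hv : ∀ i, Dp (EuclideanSpace.single i 1)
      = ∑ a, jac (transition p q) y a i • Dq (EuclideanSpace.single a 1) := by
    intro i
    rw [hD, ContinuousLinearMap.comp_apply,
      coord_eq_sum (fderiv ℝ (transition p q) y (EuclideanSpace.single i 1)), map_sum]
    simp only [map_smul, jac_apply hψ]
  let B : Coord n →L[ℝ] Coord n →L[ℝ] ℝ := h ((extChartAt (𝓡 n) p).symm y)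
  ext i j
  have e1 : comps h p y i j = B (Dp (EuclideanSpace.single i 1)) (Dp (EuclideanSpace.single j 1)) :=
    rfl
  have e2 : ∀ a b, comps h q (transition p q y) a b
      = B (Dq (EuclideanSpace.single a 1)) (Dq (EuclideanSpace.single b 1)) := by
    intro a b
    rw [comps_eq_bilin, symm_transition hy]
    rfl
  rw [e1, hv, hv]
  simp only [map_sum, map_smul, _root_.sum_apply, _root_.smul_apply, smul_eq_mul, Matrix.mul_apply,
    Matrix.transpose_apply, e2, Finset.sum_mul, Finset.mul_sum]
  exact Finset.sum_congr rfl fun b _ => Finset.sum_congr rfl fun a _ => by ring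

/-- A symmetric `2`-tensor. -/
def IsSymmTensor (b : Tensor2 n M) : Prop :=
  ∀ (p : M) (v w : TangentSpace (𝓡 n) p), b p v w = b p w v

theorem comps_symm {h : Tensor2 n M} (hs : IsSymmTensor h) (p : M) (y : Coord n) :
    (comps h p y)ᵀ = comps h p y := by
  ext i j
  exact hs _ _ _

theorem jac_comp {φ ψ : Coord n → Coord n} {x : Coord n} (hψ : ContDiffAt ℝ ∞ ψ x)
    (hφ : ContDiffAt ℝ ∞ φ (ψ x)) : jac (fun z => φ (ψ z)) x = jac φ (ψ x) * jac ψ x := by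
  ext a i
  rw [Matrix.mul_apply]
  refine (pderiv_comp (f := fun z => φ z a) hψ (apply_contDiffAt hφ a).diffAt i).trans ?_
  exact Finset.sum_congr rfl fun b _ => mul_comm _ _

theorem jac_congr {φ ψ : Coord n → Coord n} {x : Coord n} (h : φ =ᶠ[𝓝 x] ψ) :
    jac φ x = jac ψ x := by
  ext a i
  have : (fun z => φ z a) =ᶠ[𝓝 x] fun z => ψ z a := h.mono fun z hz => by simp only [hz]
  simp only [jac, pderiv, Matrix.of_apply, this.fderiv_eq]

theorem jac_id (x : Coord n) : jac (fun z : Coord n => z) x = 1 := by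
  ext a i
  have h : HasFDerivAt (fun z : Coord n => z a) (EuclideanSpace.proj (𝕜 := ℝ) a) x :=
    (EuclideanSpace.proj (𝕜 := ℝ) a).hasFDerivAt
  simp only [jac, pderiv, Matrix.of_apply]
  rw [h.fderiv]
  simp [Matrix.one_apply]

theorem det_jac_transition_ne {p q : M} {y : Coord n} (hy : y ∈ overlap p q) :
    (jac (transition p q) y).det ≠ 0 := by
  have h1 := jac_comp (transition_contDiffAt hy)
    (transition_contDiffAt (transition_mem_overlap hy))
  have h2 : (fun z => transition q p (transition p q z)) =ᶠ[𝓝 y] fun z : Coord n => z := by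
    filter_upwards [(isOpen_overlap p q).mem_nhds hy] with z hz using transition_transition hz
  rw [jac_congr h2, jac_id] at h1
  have h3 := congrArg Matrix.det h1
  rw [Matrix.det_mul, Matrix.det_one] at h3
  exact right_ne_zero_of_mul (h3 ▸ one_ne_zero)

theorem det_comps_transition (h : Tensor2 n M) {p q : M} {y : Coord n} (hy : y ∈ overlap p q) :
    (comps h p y).det = (jac (transition p q) y).det ^ 2 * (comps h q (transition p q y)).det := by
  rw [comps_transition h hy, Matrix.det_mul, Matrix.det_mul, Matrix.det_transpose]
  ring

theorem det_tensorAt (h : Tensor2 n M) {p m : M} (hm : m ∈ (extChartAt (𝓡 n) p).source) :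
    (tensorAt h m).det = (jac (transition m p) (extChartAt (𝓡 n) m m)).det ^ 2
      * (comps h p (extChartAt (𝓡 n) p m)).det := by
  rw [tensorAt, det_comps_transition h (center_mem_overlap hm), transition_center]

/-- A tensor whose matrices of components have a positive determinant. Together with symmetry this
is what the volume and the curvature of a metric need. -/
def PosDet (b : Tensor2 n M) : Prop := ∀ m, 0 < (tensorAt b m).det

theorem det_comps_pos_iff (b : Tensor2 n M) {p m : M} (hm : m ∈ (extChartAt (𝓡 n) p).source) :
    0 < (tensorAt b m).det ↔ 0 < (comps b p (extChartAt (𝓡 n) p m)).det := by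
  rw [det_tensorAt b hm]
  have := det_jac_transition_ne (center_mem_overlap hm)
  exact mul_pos_iff_of_pos_left (by positivity)

theorem PosDet.comps_pos {b : Tensor2 n M} (hb : PosDet b) (p : M) {y : Coord n}
    (hy : y ∈ (extChartAt (𝓡 n) p).target) : 0 < (comps b p y).det := by
  have h := (det_comps_pos_iff b ((extChartAt (𝓡 n) p).map_target hy)).1 (hb _)
  rwa [(extChartAt (𝓡 n) p).right_inv hy] at h

theorem posDet_metric (g : RiemMetric n M) : PosDet (metricTensor g) := by
  intro p
  refine Matrix.PosDef.det_pos (Matrix.PosDef.of_dotProduct_mulVec_pos ?_ fun v hv => ?_)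
  · ext i j
    simp only [Matrix.conjTranspose_apply, star_trivial, tensorAt_apply]
    exact g.symm p _ _
  · set w : Coord n := ∑ i, v i • (EuclideanSpace.single i (1 : ℝ) : Coord n) with hw
    have hwv : ∀ i, w i = v i := by
      intro i
      simp [hw, Finset.sum_apply, Pi.single_apply]
    have hw0 : w ≠ 0 := fun h => hv (funext fun i => by rw [← hwv i, h]; rfl)
    have hpos := g.pos p w hw0
    let B : Coord n →L[ℝ] Coord n →L[ℝ] ℝ := g.inner p
    have hB : B w w = v ⬝ᵥ (tensorAt (metricTensor g) p).mulVec v := by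
      simp only [dotProduct, Matrix.mulVec, tensorAt_apply]
      rw [hw]
      simp only [map_sum, map_smul, _root_.sum_apply, _root_.smul_apply,
        smul_eq_mul, Finset.mul_sum]
      rw [Finset.sum_comm]
      refine Finset.sum_congr rfl fun i _ => Finset.sum_congr rfl fun j _ => ?_
      change v j * (v i * B _ _) = v i * (B _ _ * v j)
      ring
    rw [star_trivial, ← hB]
    exact hpos

theorem isSymmTensor_metric (g : RiemMetric n M) : IsSymmTensor (metricTensor g) :=
  fun p v w => g.symm p v w

theorem abs_det_fderiv_transition {p q : M} {y : Coord n} (hy : y ∈ overlap p q) :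
    |(fderiv ℝ (transition p q) y).det| = |(jac (transition p q) y).det| := by
  congr 1
  rw [ContinuousLinearMap.det, ← LinearMap.det_toMatrix (EuclideanSpace.basisFun (Fin n) ℝ).toBasis]
  congr 1
  ext a i
  rw [LinearMap.toMatrix_apply, jac_apply (transition_contDiffAt hy)]
  simp

theorem continuousOn_sqrt_det (b : Tensor2 n M) (p : M) :
    ContinuousOn (fun y => √(comps b p y).det) (extChartAt (𝓡 n) p).target :=
  fun _ hy => ((comps_smoothAt b p hy).det.continuousAt.sqrt).continuousWithinAt

end Charts

open MeasureTheory

/-! ### The Riemannian measure in charts -/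

section Measure

variable {n : ℕ} {M : Type*} [TopologicalSpace M] [MeasurableSpace M] [BorelSpace M]
  [ChartedSpace (Coord n) M]

theorem measurableSet_target_inter (p : M) {A : Set M} (hA : MeasurableSet A) :
    MeasurableSet ((extChartAt (𝓡 n) p).target ∩ (extChartAt (𝓡 n) p).symm ⁻¹' A) := by
  have h := (continuousOn_iff_continuous_domRestrict.1
    (continuousOn_extChartAt_symm (I := 𝓡 n) p)).measurable
  have h2 := (isOpen_target (n := n) p).measurableSet.subtype_image (h hA)
  rwa [Set.domRestrict_eq, Set.preimage_comp, Subtype.image_preimage_coe] at h2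

variable [IsManifold (𝓡 n) ∞ M]

theorem aemeasurable_chart_symm (b : Tensor2 n M) (p : M) :
    AEMeasurable (extChartAt (𝓡 n) p).symm ((volume.restrict (extChartAt (𝓡 n) p).target).withDensity
      fun y => ENNReal.ofReal √(comps b p y).det) :=
  ((continuousOn_extChartAt_symm p).aemeasurable (isOpen_target p).measurableSet).mono_ac
    (withDensity_absolutelyContinuous _ _)

theorem chartVol_apply (b : Tensor2 n M) (p : M) {A : Set M} (hA : MeasurableSet A) :
    chartVol b p A = ∫⁻ y in (extChartAt (𝓡 n) p).target ∩ (extChartAt (𝓡 n) p).symm ⁻¹' A,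
      ENNReal.ofReal √(comps b p y).det := by
  rw [chartVol, Measure.map_apply_of_aemeasurable (aemeasurable_chart_symm b p) hA,
    withDensity_apply', Measure.restrict_restrict' (isOpen_target p).measurableSet,
    Set.inter_comm]

/-- The change of variables formula: the measures of two charts agree on the overlap. -/
theorem chartVol_overlap (b : Tensor2 n M) {p q : M} {A : Set M} (hA : MeasurableSet A)
    (hp : A ⊆ (extChartAt (𝓡 n) p).source) (hq : A ⊆ (extChartAt (𝓡 n) q).source) :
    chartVol b p A = chartVol b q A := by
  set S := (extChartAt (𝓡 n) p).target ∩ (extChartAt (𝓡 n) p).symm ⁻¹' A with hS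
  have hSo : S ⊆ overlap p q := overlap_image p q A hq
  have himg : transition p q '' S
      = (extChartAt (𝓡 n) q).target ∩ (extChartAt (𝓡 n) q).symm ⁻¹' A := by
    ext z
    constructor
    · rintro ⟨y, hy, rfl⟩
      refine ⟨transition_mem (hSo hy), ?_⟩
      rw [Set.mem_preimage, symm_transition (hSo hy)]
      exact hy.2
    · intro hz
      have hz' : z ∈ overlap q p := overlap_image q p A hp hz
      refine ⟨transition q p z, ⟨transition_mem hz', ?_⟩, transition_transition hz'⟩
      rw [Set.mem_preimage, symm_transition hz']
      exact hz.2
  have hinj : Set.InjOn (transition (n := n) p q) S := fun y hy z hz h => by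
    rw [← transition_transition (hSo hy), h, transition_transition (hSo hz)]
  rw [chartVol_apply b p hA, chartVol_apply b q hA, ← himg,
    lintegral_image_eq_lintegral_abs_det_fderiv_mul volume (measurableSet_target_inter p hA)
      (fun y hy => (transition_contDiffAt (hSo hy)).diffAt.hasFDerivAt.hasFDerivWithinAt) hinj]
  refine setLIntegral_congr_fun (measurableSet_target_inter p hA) fun y hy => ?_
  have hy' := hSo hy
  rw [abs_det_fderiv_transition hy', ← ENNReal.ofReal_mul (abs_nonneg _),
    det_comps_transition b hy', Real.sqrt_mul (sq_nonneg _), Real.sqrt_sq_eq_abs]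

theorem chartVol_inter_source (b : Tensor2 n M) (p : M) {A : Set M} (hA : MeasurableSet A) :
    chartVol b p (A ∩ (extChartAt (𝓡 n) p).source) = chartVol b p A := by
  rw [chartVol_apply b p hA,
    chartVol_apply b p (hA.inter (isOpen_extChartAt_source p).measurableSet)]
  congr 2
  ext y
  simp only [Set.mem_inter_iff, Set.mem_preimage]
  exact ⟨fun h => ⟨h.1, h.2.1⟩, fun h => ⟨h.1, h.2, (extChartAt (𝓡 n) p).map_target h.1⟩⟩

variable [CompactSpace M]

/-- The Riemannian measure restricts to the measure of each chart. -/
theorem riemVol_apply (b : Tensor2 n M) (p : M) {A : Set M} (hA : MeasurableSet A)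
    (hp : A ⊆ (extChartAt (𝓡 n) p).source) : riemVol b A = chartVol b p A := by
  refine le_antisymm ?_ (Measure.le_iff'.1 (le_iSup (fun p => chartVol b p) p) A)
  obtain ⟨s, hs⟩ := isCompact_univ.elim_nhds_subcover
    (fun m : M => (extChartAt (𝓡 n) m).source) fun m _ => extChartAt_source_mem_nhds m
  obtain ⟨c, hc⟩ : ∃ c : ℕ → M, ∀ m, ∃ i, m ∈ (extChartAt (𝓡 n) (c i)).source := by
    have hne : (s : Set M).Nonempty := by
      have := hs.2 (Set.mem_univ p)
      simp only [Set.mem_iUnion] at this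
      exact ⟨this.choose, this.choose_spec.choose⟩
    obtain ⟨c, hc⟩ := s.countable_toSet.exists_eq_range hne
    refine ⟨c, fun m => ?_⟩
    have := hs.2 (Set.mem_univ m)
    simp only [Set.mem_iUnion] at this
    obtain ⟨q, hq, hm⟩ := this
    obtain ⟨i, hi⟩ := hc ▸ Finset.mem_coe.2 hq
    exact ⟨i, hi ▸ hm⟩
  set D : ℕ → Set M := disjointed fun i => (extChartAt (𝓡 n) (c i)).source with hD
  have hDm : ∀ i, MeasurableSet (D i) :=
    fun i => .disjointed (fun i => (isOpen_extChartAt_source (c i)).measurableSet) i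
  have hDs : ∀ i, D i ⊆ (extChartAt (𝓡 n) (c i)).source := disjointed_subset _
  have hDU : ⋃ i, D i = Set.univ := by
    rw [hD, iUnion_disjointed]
    exact Set.eq_univ_of_forall fun m => Set.mem_iUnion.2 (hc m)
  -- a measure that dominates all the measures of the charts
  set ν : Measure M := Measure.sum fun i => (chartVol b (c i)).restrict (D i) with hν
  have hνA : ∀ B, MeasurableSet B → ν B = ∑' i, chartVol b (c i) (B ∩ D i) := fun B hB => by
    rw [hν, Measure.sum_apply _ hB]
    simp only [Measure.restrict_apply hB]
  have hq : ∀ q B, MeasurableSet B → chartVol b q B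
      = ∑' i, chartVol b (c i) (B ∩ D i ∩ (extChartAt (𝓡 n) q).source) := by
    intro q B hB
    have h1 : B = ⋃ i, B ∩ D i := by rw [← Set.inter_iUnion, hDU, Set.inter_univ]
    have hdis : Pairwise (Function.onFun Disjoint fun i => B ∩ D i) := fun i j hij =>
      ((disjoint_disjointed fun i => (extChartAt (𝓡 n) (c i)).source) hij).mono
        Set.inter_subset_right Set.inter_subset_right
    conv_lhs => rw [h1, measure_iUnion hdis fun i => hB.inter (hDm i)]
    refine tsum_congr fun i => ?_
    rw [← chartVol_inter_source b q (hB.inter (hDm i))]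
    exact chartVol_overlap b ((hB.inter (hDm i)).inter (isOpen_extChartAt_source q).measurableSet)
      Set.inter_subset_right
      (Set.inter_subset_left.trans (Set.inter_subset_right.trans (hDs i)))
  have hle : riemVol b ≤ ν := iSup_le fun q => Measure.le_iff.2 fun B hB => by
    rw [hq q B hB, hνA B hB]
    exact ENNReal.tsum_le_tsum fun i => measure_mono Set.inter_subset_left
  refine (Measure.le_iff'.1 hle A).trans ?_
  rw [hνA A hA, hq p A hA]
  refine ENNReal.tsum_le_tsum fun i => measure_mono fun m hm => ⟨hm, hp hm.1⟩

theorem riemVol_restrict (b : Tensor2 n M) (p : M) :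
    (riemVol b).restrict (extChartAt (𝓡 n) p).source = chartVol b p := by
  ext A hA
  rw [Measure.restrict_apply hA, riemVol_apply b p
    (hA.inter (isOpen_extChartAt_source p).measurableSet) Set.inter_subset_right,
    chartVol_inter_source b p hA]

instance isFiniteMeasure_riemVol (b : Tensor2 n M) : IsFiniteMeasure (riemVol b) := by
  have hl : IsLocallyFiniteMeasure (riemVol b) := by
    refine ⟨fun m => ?_⟩
    have hmt := mem_extChartAt_target (I := 𝓡 n) m
    have hc : ContinuousAt (fun y => √(comps b m y).det) (extChartAt (𝓡 n) m m) :=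
      (continuousOn_sqrt_det b m).continuousAt ((isOpen_target m).mem_nhds hmt)
    have h1 : ∀ᶠ y in 𝓝 (extChartAt (𝓡 n) m m), √(comps b m y).det
        < √(comps b m (extChartAt (𝓡 n) m m)).det + 1 :=
      hc.eventually_lt continuousAt_const (lt_add_one _)
    obtain ⟨V, hV, hVo, hmV⟩ := eventually_nhds_iff.1
      (h1.and (Metric.ball_mem_nhds (extChartAt (𝓡 n) m m) one_pos))
    refine ⟨(extChartAt (𝓡 n) m).source ∩ extChartAt (𝓡 n) m ⁻¹' V,
      (isOpen_extChartAt_preimage' m hVo).mem_nhds ⟨mem_extChartAt_source m, hmV⟩, ?_⟩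
    have hA : MeasurableSet ((extChartAt (𝓡 n) m).source ∩ extChartAt (𝓡 n) m ⁻¹' V) :=
      (isOpen_extChartAt_preimage' m hVo).measurableSet
    rw [riemVol_apply b m hA Set.inter_subset_left, chartVol_apply b m hA]
    have hsub : (extChartAt (𝓡 n) m).target ∩ (extChartAt (𝓡 n) m).symm ⁻¹'
        ((extChartAt (𝓡 n) m).source ∩ extChartAt (𝓡 n) m ⁻¹' V) ⊆ V := by
      rintro y ⟨hy, -, hy2⟩
      rw [Set.mem_preimage, (extChartAt (𝓡 n) m).right_inv hy] at hy2
      exact hy2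
    calc _ ≤ ∫⁻ y in V, ENNReal.ofReal √(comps b m y).det := lintegral_mono_set hsub
      _ ≤ ∫⁻ _ in V, ENNReal.ofReal (√(comps b m (extChartAt (𝓡 n) m m)).det + 1) :=
          setLIntegral_mono' hVo.measurableSet fun y hy => ENNReal.ofReal_le_ofReal (hV y hy).1.le
      _ = _ := setLIntegral_const _ _
      _ < ⊤ := ENNReal.mul_lt_top ENNReal.ofReal_lt_top
          ((measure_mono fun y hy => (hV y hy).2).trans_lt measure_ball_lt_top)
  exact ⟨isCompact_univ.measure_lt_top⟩

/-- The integral of a function that vanishes outside the domain of a chart. -/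
theorem integral_riemVol_of_source (b : Tensor2 n M) (p : M) {f : M → ℝ} (hf : Continuous f)
    (h0 : ∀ m ∉ (extChartAt (𝓡 n) p).source, f m = 0) :
    ∫ m, f m ∂(riemVol b)
      = ∫ y in (extChartAt (𝓡 n) p).target,
        √(comps b p y).det * f ((extChartAt (𝓡 n) p).symm y) := by
  have : OpensMeasurableSpace M := inferInstance
  rw [← setIntegral_eq_integral_of_forall_compl_eq_zero h0, riemVol_restrict, chartVol,
    integral_map (aemeasurable_chart_symm b p) ?_, integral_withDensity_eq_integral_toReal_smul₀]
  · simp only [ENNReal.toReal_ofReal (Real.sqrt_nonneg _), smul_eq_mul]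
  · exact (((continuousOn_sqrt_det b p).aemeasurable (isOpen_target p).measurableSet)).ennreal_ofReal
  · exact Eventually.of_forall fun _ => ENNReal.ofReal_lt_top
  · exact hf.measurable.aestronglyMeasurable

end Measure

/-! ### Integrals depending on a parameter -/

section ParametricIntegral

variable {n : ℕ} {E : Type*} [NormedAddCommGroup E] [NormedSpace ℝ E]

theorem contDiffOn_integral_of_compact {H : E × Coord n → ℝ} {s : Set E} {k : Set (Coord n)}
    (hs : IsOpen s) (hk : IsCompact k) (h0 : ∀ v ∈ s, ∀ y ∉ k, H (v, y) = 0)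
    (hH : ContDiffOn ℝ ∞ H (s ×ˢ Set.univ)) :
    ContDiffOn ℝ ∞ (fun v => ∫ y, H (v, y)) s := by
  have h1 := contDiffOn_convolution_right_with_param_comp (n := (⊤ : ℕ∞)) (𝕜 := ℝ)
    (μ := (volume : Measure (Coord n)))
    (f := fun _ : Coord n => (1 : ℝ)) (g := fun v y => H (v, -y)) (v := fun _ => (0 : Coord n))
    (ContinuousLinearMap.mul ℝ ℝ) (s := s) (k := -k) contDiffOn_const hs hk.neg
    (fun v y hv hy => h0 v hv (-y) hy) (locallyIntegrable_const 1)
    (hH.comp (contDiff_fst.prodMk contDiff_snd.neg).contDiffOn fun x hx => ⟨hx.1, trivial⟩)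
  refine h1.congr fun v _ => ?_
  simp [convolution]

theorem fderiv_integral_of_compact {H : E × Coord n → ℝ} {s : Set E} {k : Set (Coord n)}
    (hs : IsOpen s) (hk : IsCompact k) (h0 : ∀ v ∈ s, ∀ y ∉ k, H (v, y) = 0)
    (hH : ContDiffOn ℝ ∞ H (s ×ˢ Set.univ)) {v : E} (hv : v ∈ s) (w : E) :
    fderiv ℝ (fun v => ∫ y, H (v, y)) v w = ∫ y, fderiv ℝ H (v, y) (w, 0) := by
  set g : E → Coord n → ℝ := fun v y => H (v, -y) with hg
  have hgc : ContDiffOn ℝ 1 (Function.uncurry g) (s ×ˢ Set.univ) :=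
    (hH.of_le (by simp)).comp (contDiff_fst.prodMk contDiff_snd.neg).contDiffOn
      fun x hx => ⟨hx.1, trivial⟩
  have hg0 : ∀ p, ∀ x, p ∈ s → x ∉ -k → g p x = 0 := fun v y hv hy => h0 v hv (-y) hy
  have h1 := hasFDerivAt_convolution_right_with_param (𝕜 := ℝ)
    (μ := (volume : Measure (Coord n))) (f := fun _ : Coord n => (1 : ℝ))
    (ContinuousLinearMap.mul ℝ ℝ) hs hk.neg hg0 (locallyIntegrable_const 1) hgc (v, 0) hv
  have h1' := HasFDerivAt.comp (f := fun v : E => (v, (0 : Coord n))) v h1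
    (hasFDerivAt_prodMk_left v 0)
  have h2 : HasFDerivAt (fun v => ∫ y, H (v, y)) _ v :=
    h1'.congr_of_eventuallyEq (Eventually.of_forall fun v => by simp [convolution, g])
  rw [h2.fderiv]
  have hopen : IsOpen (s ×ˢ (Set.univ : Set (Coord n))) := hs.prod isOpen_univ
  have hHd : ∀ y, HasFDerivAt H (fderiv ℝ H (v, y)) (v, y) := fun y =>
    ((hH.contDiffAt (hopen.mem_nhds ⟨hv, trivial⟩)).diffAt).hasFDerivAt
  have hgd : ∀ y, fderiv ℝ (Function.uncurry g) (v, -y) (w, 0) = fderiv ℝ H (v, y) (w, 0) := by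
    intro y
    have hi : HasFDerivAt (fun x : E × Coord n => (x.1, -x.2))
        ((ContinuousLinearMap.fst ℝ E (Coord n)).prod (-(ContinuousLinearMap.snd ℝ E (Coord n))))
        (v, -y) := hasFDerivAt_fst.prodMk hasFDerivAt_snd.neg
    have hy : HasFDerivAt H (fderiv ℝ H (v, y)) ((fun x : E × Coord n => (x.1, -x.2)) (v, -y)) := by
      simpa using hHd y
    have h3 := (hy.comp (v, -y) hi).fderiv
    have h4 : Function.uncurry g = H ∘ fun x : E × Coord n => (x.1, -x.2) := rfl
    rw [h4, h3]
    simp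
  have hcont : Continuous fun y => fderiv ℝ (Function.uncurry g) (v, y) := by
    have h5 := hgc.continuousOn_fderiv_of_isOpen hopen le_rfl
    exact h5.comp_continuous (by fun_prop) fun y => ⟨hv, trivial⟩
  have hsupp : HasCompactSupport fun y => fderiv ℝ (Function.uncurry g) (v, y) := by
    refine HasCompactSupport.intro hk.neg fun y hy => ?_
    have h6 : Function.uncurry g =ᶠ[𝓝 (v, y)] fun _ => 0 := by
      have : s ×ˢ (-k)ᶜ ∈ 𝓝 (v, y) :=
        (hs.prod hk.neg.isClosed.isOpen_compl).mem_nhds ⟨hv, hy⟩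
      filter_upwards [this] with x hx using hg0 x.1 x.2 hx.1 hx.2
    rw [h6.fderiv_eq]
    simp
  have hint : Integrable (fun y => fderiv ℝ (Function.uncurry g) (v, y)) :=
    hcont.integrable_of_hasCompactSupport hsupp
  have hint2 : Integrable fun y => fderiv ℝ (Function.uncurry g) (v, -y) := hint.comp_neg
  have h7 : (convolution (fun _ : Coord n => (1 : ℝ)) (fun x => fderiv ℝ (Function.uncurry g) (v, x))
      ((ContinuousLinearMap.mul ℝ ℝ).precompR (E × Coord n)) volume) 0
      = ∫ y, fderiv ℝ (Function.uncurry g) (v, -y) := by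
    simp only [convolution, zero_sub]
    congr 1
    funext y
    refine ContinuousLinearMap.ext fun x => ?_
    rw [ContinuousLinearMap.precompR_apply]
    simp
  change ((convolution (fun _ : Coord n => (1 : ℝ)) (fun x => fderiv ℝ (Function.uncurry g) (v, x))
      ((ContinuousLinearMap.mul ℝ ℝ).precompR (E × Coord n)) volume) 0) (w, 0) = _
  rw [h7, ContinuousLinearMap.integral_apply hint2]
  simp only [hgd]

/-- If `f` is smooth near `{v} × tsupport ρ`, the product of `f` with the cut-off function `ρ`, as a
function on the whole space, is smooth for all parameters near `v`. -/
theorem exists_cutoff_nhds {f : E × Coord n → ℝ} {O : Set (E × Coord n)} (hO : IsOpen O)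
    (hf : ∀ x ∈ O, ContDiffAt ℝ ∞ f x) {ρ : Coord n → ℝ} (hρ : ContDiff ℝ ∞ ρ)
    (hc : HasCompactSupport ρ) {v : E} (hv : ∀ y ∈ tsupport ρ, (v, y) ∈ O) :
    ∃ s : Set E, IsOpen s ∧ v ∈ s ∧ (∀ u ∈ s, ∀ y ∈ tsupport ρ, (u, y) ∈ O) ∧
      (∀ u ∈ s, ∀ y ∉ tsupport ρ, ρ y * f (u, y) = 0) ∧
      ContDiffOn ℝ ∞ (fun x : E × Coord n => ρ x.2 * f x) (s ×ˢ Set.univ) := by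
  obtain ⟨s, t, hs, ht, hvs, hKt, hst⟩ := generalized_tube_lemma (isCompact_singleton (x := v))
    hc hO (by rintro ⟨u, y⟩ ⟨rfl, hy⟩; exact hv y hy)
  refine ⟨s, hs, hvs rfl, fun u hu y hy => hst ⟨hu, hKt hy⟩, fun u _ y hy => ?_, ?_⟩
  · rw [image_eq_zero_of_notMem_tsupport hy, zero_mul]
  · rintro ⟨u, y⟩ ⟨hu, -⟩
    refine ContDiffAt.contDiffWithinAt ?_
    by_cases hy : y ∈ tsupport ρ
    · exact (hρ.contDiffAt.comp (u, y) contDiffAt_snd).mul (hf _ (hst ⟨hu, hKt hy⟩))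
    · have h0 : (fun x : E × Coord n => ρ x.2 * f x) =ᶠ[𝓝 (u, y)] fun _ => 0 := by
        have : Prod.snd ⁻¹' (tsupport ρ)ᶜ ∈ 𝓝 (u, y) :=
          ((isClosed_tsupport ρ).isOpen_compl.preimage continuous_snd).mem_nhds hy
        filter_upwards [this] with x hx
        rw [image_eq_zero_of_notMem_tsupport hx, zero_mul]
      exact contDiffAt_const.congr_of_eventuallyEq h0

theorem contDiffAt_integral_cutoff {f : E × Coord n → ℝ} {O : Set (E × Coord n)} (hO : IsOpen O)
    (hf : ∀ x ∈ O, ContDiffAt ℝ ∞ f x) {ρ : Coord n → ℝ} (hρ : ContDiff ℝ ∞ ρ)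
    (hc : HasCompactSupport ρ) {v : E} (hv : ∀ y ∈ tsupport ρ, (v, y) ∈ O) :
    ContDiffAt ℝ ∞ (fun v => ∫ y, ρ y * f (v, y)) v := by
  obtain ⟨s, hs, hvs, -, h0, hsm⟩ := exists_cutoff_nhds hO hf hρ hc hv
  exact (contDiffOn_integral_of_compact hs hc h0 hsm).contDiffAt (hs.mem_nhds hvs)

theorem fderiv_integral_cutoff {f : E × Coord n → ℝ} {O : Set (E × Coord n)} (hO : IsOpen O)
    (hf : ∀ x ∈ O, ContDiffAt ℝ ∞ f x) {ρ : Coord n → ℝ} (hρ : ContDiff ℝ ∞ ρ)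
    (hc : HasCompactSupport ρ) {v : E} (hv : ∀ y ∈ tsupport ρ, (v, y) ∈ O) (w : E) :
    fderiv ℝ (fun v => ∫ y, ρ y * f (v, y)) v w
      = ∫ y, ρ y * fderiv ℝ f (v, y) (w, 0) := by
  obtain ⟨s, hs, hvs, -, h0, hsm⟩ := exists_cutoff_nhds hO hf hρ hc hv
  rw [fderiv_integral_of_compact hs hc h0 hsm hvs]
  refine integral_congr_ae (Eventually.of_forall fun y => ?_)
  by_cases hy : y ∈ tsupport ρ
  · have hd : HasFDerivAt (fun x : E × Coord n => ρ x.2) ((fderiv ℝ ρ y).comp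
        (ContinuousLinearMap.snd ℝ E (Coord n))) (v, y) :=
      HasFDerivAt.comp (v, y) (g := ρ) (hρ.contDiffAt.diffAt.hasFDerivAt) hasFDerivAt_snd
    have h1 := (hd.mul (hf _ (hv y hy)).diffAt.hasFDerivAt).fderiv
    simp only
    erw [h1]
    simp
  · have h1 : (fun x : E × Coord n => ρ x.2 * f x) =ᶠ[𝓝 (v, y)] fun _ => 0 := by
      have : Prod.snd ⁻¹' (tsupport ρ)ᶜ ∈ 𝓝 (v, y) :=
        ((isClosed_tsupport ρ).isOpen_compl.preimage continuous_snd).mem_nhds hy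
      filter_upwards [this] with x hx
      rw [image_eq_zero_of_notMem_tsupport hx, zero_mul]
    simp only [h1.fderiv_eq, image_eq_zero_of_notMem_tsupport hy, zero_mul]
    simp

theorem integrable_cutoff {f : Coord n → ℝ} {U : Set (Coord n)} (hf : ContinuousOn f U)
    (hU : IsOpen U) {ρ : Coord n → ℝ} (hρ : Continuous ρ) (hc : HasCompactSupport ρ)
    (hs : tsupport ρ ⊆ U) : Integrable fun y => ρ y * f y := by
  refine Continuous.integrable_of_hasCompactSupport ?_ hc.mul_right
  refine continuous_iff_continuousAt.2 fun y => ?_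
  by_cases hy : y ∈ tsupport ρ
  · exact hρ.continuousAt.mul (hf.continuousAt (hU.mem_nhds (hs hy)))
  · have h1 : (fun x => ρ x * f x) =ᶠ[𝓝 y] fun _ => 0 := by
      filter_upwards [(isClosed_tsupport ρ).isOpen_compl.mem_nhds hy] with x hx
      rw [image_eq_zero_of_notMem_tsupport hx, zero_mul]
    exact continuousAt_const.congr h1.symm

/-- Integration by parts against a cut-off function. -/
theorem integral_cutoff_mul_pderiv {f : Coord n → ℝ} {U : Set (Coord n)} (hU : IsOpen U)
    (hf : ∀ y ∈ U, ContDiffAt ℝ ∞ f y) {ρ : Coord n → ℝ} (hρ : ContDiff ℝ ∞ ρ)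
    (hc : HasCompactSupport ρ) (hs : tsupport ρ ⊆ U) (k : Fin n) :
    ∫ y, ρ y * pderiv k f y = -∫ y, pderiv k ρ y * f y := by
  have hsp : tsupport (pderiv k ρ) ⊆ tsupport ρ :=
    (tsupport_fderiv_apply_subset ℝ (EuclideanSpace.single k 1))
  have hρ' : Continuous (pderiv k ρ) :=
    (hρ.continuous_fderiv (by simp)).clm_apply continuous_const
  have hf0 : ContinuousOn f U := fun y hy => (hf y hy).continuousAt.continuousWithinAt
  have hf1 : ContinuousOn (pderiv k f) U := fun y hy =>
    (pderiv_contDiffAt k f y (hf y hy)).continuousAt.continuousWithinAt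
  have hd : ∀ y, HasFDerivAt (fun y => ρ y * f y) (fderiv ℝ (fun y => ρ y * f y) y) y := by
    intro y
    refine DifferentiableAt.hasFDerivAt ?_
    by_cases hy : y ∈ tsupport ρ
    · exact hρ.contDiffAt.diffAt.mul (hf y (hs hy)).diffAt
    · have h1 : (fun x => ρ x * f x) =ᶠ[𝓝 y] fun _ => 0 := by
        filter_upwards [(isClosed_tsupport ρ).isOpen_compl.mem_nhds hy] with x hx
        rw [image_eq_zero_of_notMem_tsupport hx, zero_mul]
      exact (differentiableAt_const (0 : ℝ)).congr_of_eventuallyEq h1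
  have hprod : ∀ y, pderiv k (fun y => ρ y * f y) y = pderiv k ρ y * f y + ρ y * pderiv k f y := by
    intro y
    by_cases hy : y ∈ tsupport ρ
    · simp only [pderiv]
      rw [fderiv_fun_mul hρ.contDiffAt.diffAt (hf y (hs hy)).diffAt]
      simp only [_root_.add_apply, _root_.smul_apply, smul_eq_mul]
      ring
    · have h1 : (fun x => ρ x * f x) =ᶠ[𝓝 y] fun _ => 0 := by
        filter_upwards [(isClosed_tsupport ρ).isOpen_compl.mem_nhds hy] with x hx
        rw [image_eq_zero_of_notMem_tsupport hx, zero_mul]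
      rw [image_eq_zero_of_notMem_tsupport hy,
        image_eq_zero_of_notMem_tsupport fun h => hy (hsp h), pderiv, h1.fderiv_eq]
      simp
  have hi1 : Integrable fun y => pderiv k ρ y * f y :=
    integrable_cutoff hf0 hU hρ' (hc.of_isClosed_subset (isClosed_tsupport _) hsp) (hsp.trans hs)
  have hi2 : Integrable fun y => ρ y * pderiv k f y :=
    integrable_cutoff hf1 hU hρ.continuous hc hs
  have h0 : ∫ y, pderiv k (fun y => ρ y * f y) y = 0 := by
    have := integral_bilinear_hasFDerivAt_right_eq_neg_left_of_integrable
      (μ := (volume : Measure (Coord n)))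
      (f := fun _ : Coord n => (1 : ℝ)) (f' := fun _ => 0) (g := fun y => ρ y * f y)
      (g' := fderiv ℝ (fun y => ρ y * f y)) (v := EuclideanSpace.single k (1 : ℝ))
      (B := ContinuousLinearMap.mul ℝ ℝ) (by simp) ?_ ?_ (fun y _ => hasFDerivAt_const _ _)
      fun y _ => hd y
    · simpa [pderiv] using this
    · simp only [ContinuousLinearMap.mul_apply', one_mul]
      change Integrable fun y => pderiv k (fun y => ρ y * f y) y
      simp only [hprod]
      exact hi1.add hi2
    · simp only [ContinuousLinearMap.mul_apply', one_mul]
      exact integrable_cutoff hf0 hU hρ.continuous hc hs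
  simp only [hprod] at h0
  rw [integral_add hi1 hi2] at h0
  linarith

end ParametricIntegral

/-! ### Affine families of tensors on a manifold -/

section Variation

variable {n : ℕ} {E : Type*} [NormedAddCommGroup E] [NormedSpace ℝ E]

theorem IsFamilyOn.mono {G : E × Coord n → Matrix (Fin n) (Fin n) ℝ} {O O' : Set (E × Coord n)}
    (hG : IsFamilyOn G O) (hO : IsOpen O') (hs : O' ⊆ O) : IsFamilyOn G O' where
  isOpen := hO
  smooth x hx := hG.smooth x (hs hx)
  symm x hx := hG.symm x (hs hx)
  det_ne x hx := hG.det_ne x (hs hx)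

variable {M : Type*} [TopologicalSpace M] [ChartedSpace (Coord n) M] [IsManifold (𝓡 n) ∞ M]

/-- The components of the tensors `b + L v` in the chart at `p`, as functions of the parameter `v`
and the coordinates. -/
def famComps (b : Tensor2 n M) (L : E →ₗ[ℝ] Tensor2 n M) (p : M) (x : E × Coord n) :
    Matrix (Fin n) (Fin n) ℝ :=
  comps (b + L x.1) p x.2

/-- The parameters and coordinates for which `b + L v` is nondegenerate with positive
determinant. -/
def famDomain (b : Tensor2 n M) (L : E →ₗ[ℝ] Tensor2 n M) (p : M) : Set (E × Coord n) :=
  {x | x.2 ∈ (extChartAt (𝓡 n) p).target ∧ 0 < (famComps b L p x).det}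

theorem famComps_apply (b : Tensor2 n M) (L : E →ₗ[ℝ] Tensor2 n M) (p : M) (x : E × Coord n) :
    famComps b L p x = comps b p x.2 + comps (L x.1) p x.2 := rfl

theorem comps_map_add (L : E →ₗ[ℝ] Tensor2 n M) (p : M) (y : Coord n) (v w : E) :
    comps (L (v + w)) p y = comps (L v) p y + comps (L w) p y := by
  rw [map_add]
  rfl

theorem comps_map_smul (L : E →ₗ[ℝ] Tensor2 n M) (p : M) (y : Coord n) (c : ℝ) (v : E) :
    comps (L (c • v)) p y = c • comps (L v) p y := by
  rw [map_smul]
  rfl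

theorem comps_map_zero (L : E →ₗ[ℝ] Tensor2 n M) (p : M) (y : Coord n) :
    comps (L 0) p y = 0 := by
  rw [map_zero]
  rfl

/-- The components of `L v` at a fixed point, as a linear function of `v`. -/
def compsLin (L : E →ₗ[ℝ] Tensor2 n M) (p : M) (y : Coord n) (i j : Fin n) : E →ₗ[ℝ] ℝ where
  toFun v := comps (L v) p y i j
  map_add' v w := by rw [comps_map_add]; rfl
  map_smul' c v := by rw [comps_map_smul]; rfl

variable [FiniteDimensional ℝ E] {b : Tensor2 n M} {L : E →ₗ[ℝ] Tensor2 n M} {p q : M}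

theorem famComps_smoothAt {x : E × Coord n} (hx : x.2 ∈ (extChartAt (𝓡 n) p).target) :
    MatSmoothAt (famComps b L p) x := by
  have h1 : ∀ h : Tensor2 n M, MatSmoothAt (fun x : E × Coord n => comps h p x.2) x :=
    fun h => MatSmoothAt.comp (f := fun x : E × Coord n => x.2) (comps_smoothAt h p hx)
      contDiffAt_snd
  -- expand the parameter in a basis
  let B := Module.finBasis ℝ E
  have h2 : (fun x : E × Coord n => comps (L x.1) p x.2)
      = fun x => ∑ a, B.coord a x.1 • comps (L (B a)) p x.2 := by
    funext x
    ext i j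
    change compsLin L p x.2 i j x.1 = _
    conv_lhs => rw [← B.sum_repr x.1, map_sum]
    simp only [map_smul, Matrix.sum_apply, Matrix.smul_apply, Module.Basis.coord_apply]
    rfl
  have h3 : MatSmoothAt (fun x : E × Coord n => comps (L x.1) p x.2) x := by
    rw [h2]
    refine MatSmoothAt.sum fun a _ => MatSmoothAt.smul ?_ (h1 _)
    exact ((LinearMap.toContinuousLinearMap (B.coord a)).contDiff.comp contDiff_fst).contDiffAt
  exact (h1 b).add h3

theorem matDeriv_famComps {x : E × Coord n} (hx : x.2 ∈ (extChartAt (𝓡 n) p).target) (w : E) :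
    matDeriv (famComps b L p) x (w, 0) = comps (L w) p x.2 := by
  rw [← matDeriv_slice_left (famComps_smoothAt hx)]
  ext i j
  have h1 := ((LinearMap.toContinuousLinearMap (compsLin L p x.2 i j)).hasFDerivAt
    (x := x.1)).const_add (comps b p x.2 i j)
  exact congrArg (fun T : E →L[ℝ] ℝ => T w) h1.fderiv

theorem isOpen_famDomain : IsOpen (famDomain b L p) := by
  have h1 : ContinuousOn (fun x => (famComps b L p x).det)
      (Prod.snd ⁻¹' (extChartAt (𝓡 n) p).target) := fun x hx =>
    (famComps_smoothAt (b := b) (L := L) hx).det.continuousAt.continuousWithinAt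
  exact h1.isOpen_inter_preimage ((isOpen_target p).preimage continuous_snd) isOpen_Ioi

theorem isFamilyOn_famComps (hb : IsSymmTensor b) (hL : ∀ w, IsSymmTensor (L w)) :
    IsFamilyOn (famComps b L p) (famDomain b L p) where
  isOpen := isOpen_famDomain
  smooth x hx := famComps_smoothAt hx.1
  symm x _ := by
    rw [famComps_apply, Matrix.transpose_add, comps_symm hb, comps_symm (hL _)]
  det_ne x hx := hx.2.ne'

theorem isFamPullbackOn_famComps (hb : IsSymmTensor b) (hL : ∀ w, IsSymmTensor (L w)) (p q : M) :
    IsFamPullbackOn (famComps b L q) (famDomain b L q) (transition p q) (famComps b L p)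
      (famDomain b L p ∩ Prod.snd ⁻¹' overlap p q) where
  family := isFamilyOn_famComps hb hL
  family' := (isFamilyOn_famComps hb hL).mono
    (isOpen_famDomain.inter ((isOpen_overlap p q).preimage continuous_snd)) Set.inter_subset_left
  mapsTo x hx := by
    refine ⟨transition_mem hx.2, ?_⟩
    have h1 := hx.1.2
    rw [famComps, det_comps_transition _ hx.2] at h1
    exact pos_of_mul_pos_right h1 (sq_nonneg _)
  smooth x hx := transition_contDiffAt hx.2
  eq x hx := comps_transition _ hx.2

/-- On a compact manifold, the tensors near one with positive determinant have positive
determinant. -/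
theorem eventually_posDet [CompactSpace M] {v : E} (hv : PosDet (b + L v)) :
    ∀ᶠ u in 𝓝 v, PosDet (b + L u) := by
  have h1 := isCompact_univ (X := M) |>.eventually_forall_of_forall_eventually (x₀ := v)
    (P := fun u m => 0 < (tensorAt (b + L u) m).det) ?_
  · filter_upwards [h1] with u hu m using hu m trivial
  · intro m _
    have h2 : famDomain b L m ∈ 𝓝 (v, extChartAt (𝓡 n) m m) :=
      isOpen_famDomain.mem_nhds ⟨mem_extChartAt_target m, hv m⟩
    have h3 : ContinuousAt (fun x : E × M => (x.1, extChartAt (𝓡 n) m x.2)) (v, m) :=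
      continuousAt_fst.prodMk (ContinuousAt.comp (g := extChartAt (𝓡 n) m) (f := Prod.snd) (x := (v, m))
        (continuousAt_extChartAt m) continuousAt_snd)
    have h4 : Prod.snd ⁻¹' (extChartAt (𝓡 n) m).source ∈ 𝓝 (v, m) :=
      ((isOpen_extChartAt_source m).preimage continuous_snd).mem_nhds (mem_extChartAt_source m)
    filter_upwards [h3 h2, h4] with x hx hx2
    rw [det_comps_pos_iff _ hx2]
    exact hx.2

end Variation

/-! ### Integration of scalar fields with a partition of unity -/

section ScalarField

variable {n : ℕ} {M : Type*} [TopologicalSpace M] [ChartedSpace (Coord n) M]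

/-- A continuous function on `M`, given by its expressions `F p` in the charts. -/
structure IsScalarField (F : M → Coord n → ℝ) : Prop where
  continuousOn : ∀ p, ContinuousOn (F p) (extChartAt (𝓡 n) p).target
  eq : ∀ {p q : M} {y : Coord n}, y ∈ overlap p q → F p y = F q (transition p q y)

/-- The function on `M` with the expressions `F p` in the charts. -/
def ofCharts (F : M → Coord n → ℝ) (m : M) : ℝ := F m (extChartAt (𝓡 n) m m)

namespace IsScalarField

variable {F : M → Coord n → ℝ}

theorem ofCharts_eq (hF : IsScalarField F) {p m : M} (hm : m ∈ (extChartAt (𝓡 n) p).source) :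
    ofCharts F m = F p (extChartAt (𝓡 n) p m) := by
  rw [ofCharts, hF.eq (center_mem_overlap hm), transition_center]

theorem ofCharts_symm (hF : IsScalarField F) {p : M} {y : Coord n}
    (hy : y ∈ (extChartAt (𝓡 n) p).target) :
    ofCharts F ((extChartAt (𝓡 n) p).symm y) = F p y := by
  rw [hF.ofCharts_eq ((extChartAt (𝓡 n) p).map_target hy), (extChartAt (𝓡 n) p).right_inv hy]

theorem continuous (hF : IsScalarField F) : Continuous (ofCharts F) := by
  refine continuous_iff_continuousAt.2 fun m => ?_
  have h1 : ofCharts F =ᶠ[𝓝 m] fun x => F m (extChartAt (𝓡 n) m x) := by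
    filter_upwards [(isOpen_extChartAt_source (I := 𝓡 n) m).mem_nhds (mem_extChartAt_source m)]
      with x hx using hF.ofCharts_eq hx
  refine ContinuousAt.congr ?_ h1.symm
  exact ContinuousAt.comp (g := F m) (f := extChartAt (𝓡 n) m)
    ((hF.continuousOn m).continuousAt ((isOpen_target m).mem_nhds (mem_extChartAt_target m)))
    (continuousAt_extChartAt m)

end IsScalarField

variable (n M) in
/-- A finite smooth partition of unity, the functions of which are supported in the domains of
charts. -/
structure ChartPartition where
  index : Finset M
  fn : M → M → ℝ
  smooth : ∀ q, ContMDiff (𝓡 n) 𝓘(ℝ) ∞ (fn q)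
  tsupport_subset : ∀ q, tsupport (fn q) ⊆ (extChartAt (𝓡 n) q).source
  sum_eq_one : ∀ m, ∑ q ∈ index, fn q m = 1

theorem nonempty_chartPartition [IsManifold (𝓡 n) ∞ M] [T2Space M] [CompactSpace M] :
    Nonempty (ChartPartition n M) := by
  obtain ⟨f, hf⟩ := SmoothPartitionOfUnity.exists_isSubordinate_chartAt_source (𝓡 n) M
  have hfin : {q | (Function.support (f q)).Nonempty}.Finite :=
    f.locallyFinite.finite_nonempty_of_compact
  refine ⟨⟨hfin.toFinset, fun q => f q, fun q => (f q).contMDiff, fun q => ?_, fun m => ?_⟩⟩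
  · rw [extChartAt_source]
    exact hf q
  · rw [← f.sum_eq_one (Set.mem_univ m)]
    refine (finsum_eq_sum_of_support_subset _ fun q hq => ?_).symm
    rw [Set.Finite.coe_toFinset]
    exact ⟨m, hq⟩

namespace ChartPartition

variable (ρ : ChartPartition n M)

/-- The expression of a function of the partition of unity in its chart, extended by zero. -/
def weight (q : M) : Coord n → ℝ :=
  (extChartAt (𝓡 n) q).target.indicator fun y => ρ.fn q ((extChartAt (𝓡 n) q).symm y)

theorem weight_of_mem {q : M} {y : Coord n} (hy : y ∈ (extChartAt (𝓡 n) q).target) :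
    ρ.weight q y = ρ.fn q ((extChartAt (𝓡 n) q).symm y) := Set.indicator_of_mem hy _

theorem fn_symm_contDiffAt [IsManifold (𝓡 n) ∞ M] (q p : M) {y : Coord n}
    (hy : y ∈ (extChartAt (𝓡 n) p).target) :
    ContDiffAt ℝ ∞ (fun z => ρ.fn q ((extChartAt (𝓡 n) p).symm z)) y :=
  ((ρ.smooth q).contMDiffAt.comp y ((contMDiffOn_extChartAt_symm (n := ∞) p).contMDiffAt
    ((isOpen_target p).mem_nhds hy))).contDiffAt

theorem pderiv_weight [IsManifold (𝓡 n) ∞ M] (q : M) {y : Coord n}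
    (hy : y ∈ (extChartAt (𝓡 n) q).target) (k : Fin n) :
    pderiv k (ρ.weight q) y = pderiv k (fun z => ρ.fn q ((extChartAt (𝓡 n) q).symm z)) y := by
  have : ρ.weight q =ᶠ[𝓝 y] fun z => ρ.fn q ((extChartAt (𝓡 n) q).symm z) := by
    filter_upwards [(isOpen_target q).mem_nhds hy] with z hz using ρ.weight_of_mem hz
  rw [pderiv, pderiv, this.fderiv_eq]

variable [CompactSpace M]

theorem isCompact_image (q : M) : IsCompact (extChartAt (𝓡 n) q '' tsupport (ρ.fn q)) :=
  (isClosed_tsupport _).isCompact.image_of_continuousOn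
    ((continuousOn_extChartAt q).mono (ρ.tsupport_subset q))

theorem tsupport_weight_subset_image (q : M) :
    tsupport (ρ.weight q) ⊆ extChartAt (𝓡 n) q '' tsupport (ρ.fn q) := by
  refine closure_minimal (fun y hy => ?_) (ρ.isCompact_image q).isClosed
  have hyt : y ∈ (extChartAt (𝓡 n) q).target := Set.mem_of_indicator_ne_zero hy
  rw [Function.mem_support, ρ.weight_of_mem hyt] at hy
  exact ⟨_, subset_tsupport _ hy, (extChartAt (𝓡 n) q).right_inv hyt⟩

theorem hasCompactSupport_weight (q : M) : HasCompactSupport (ρ.weight q) :=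
  (ρ.isCompact_image q).of_isClosed_subset (isClosed_tsupport _) (ρ.tsupport_weight_subset_image q)

theorem tsupport_weight_subset (q : M) :
    tsupport (ρ.weight q) ⊆ (extChartAt (𝓡 n) q).target := by
  refine (ρ.tsupport_weight_subset_image q).trans ?_
  rintro _ ⟨m, hm, rfl⟩
  exact (extChartAt (𝓡 n) q).map_source (ρ.tsupport_subset q hm)

theorem weight_contDiff [IsManifold (𝓡 n) ∞ M] (q : M) : ContDiff ℝ ∞ (ρ.weight q) := by
  refine contDiff_iff_contDiffAt.2 fun y => ?_
  by_cases hy : y ∈ tsupport (ρ.weight q)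
  · have hyt := ρ.tsupport_weight_subset q hy
    refine (ρ.fn_symm_contDiffAt q q hyt).congr_of_eventuallyEq ?_
    filter_upwards [(isOpen_target q).mem_nhds hyt] with z hz using ρ.weight_of_mem hz
  · refine (contDiffAt_const (c := (0 : ℝ))).congr_of_eventuallyEq ?_
    filter_upwards [(isClosed_tsupport _).isOpen_compl.mem_nhds hy] with z hz
      using image_eq_zero_of_notMem_tsupport hz

variable [IsManifold (𝓡 n) ∞ M] [MeasurableSpace M] [BorelSpace M]

/-- The integral of a scalar field in terms of its expressions in the charts. -/
theorem integral_eq (b : Tensor2 n M) {F : M → Coord n → ℝ} (hF : IsScalarField F) :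
    ∫ m, ofCharts F m ∂(riemVol b)
      = ∑ q ∈ ρ.index, ∫ y, ρ.weight q y * (F q y * √(comps b q y).det) := by
  have hc : ∀ q, Continuous fun m => ρ.fn q m * ofCharts F m := fun q =>
    (ρ.smooth q).continuous.mul hF.continuous
  have h1 : ∀ m, ofCharts F m = ∑ q ∈ ρ.index, ρ.fn q m * ofCharts F m := fun m => by
    rw [← Finset.sum_mul, ρ.sum_eq_one, one_mul]
  calc ∫ m, ofCharts F m ∂(riemVol b)
      = ∑ q ∈ ρ.index, ∫ m, ρ.fn q m * ofCharts F m ∂(riemVol b) := by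
        rw [← integral_finsetSum _ fun q _ => (hc q).integrable_of_hasCompactSupport
          (HasCompactSupport.of_compactSpace _)]
        exact integral_congr_ae (Eventually.of_forall h1)
    _ = _ := by
        refine Finset.sum_congr rfl fun q _ => ?_
        rw [integral_riemVol_of_source b q (hc q) fun m hm => ?_,
          ← integral_indicator (isOpen_target q).measurableSet]
        · refine integral_congr_ae (Eventually.of_forall fun y => ?_)
          by_cases hy : y ∈ (extChartAt (𝓡 n) q).target
          · simp only [Set.indicator_of_mem hy, ρ.weight_of_mem hy, hF.ofCharts_symm hy]
            ring
          · simp only [Set.indicator_of_notMem hy, weight, zero_mul]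
        · rw [image_eq_zero_of_notMem_tsupport fun h => hm (ρ.tsupport_subset q h), zero_mul]

end ChartPartition

end ScalarField

/-! ### The divergence theorem -/

section Divergence

variable {n : ℕ} {M : Type*} [TopologicalSpace M] [ChartedSpace (Coord n) M]

/-- A smooth vector field on `M`, given by its components `X p c` in the charts. -/
structure IsVectorField (X : M → Fin n → Coord n → ℝ) : Prop where
  smooth : ∀ {p : M} {y : Coord n}, y ∈ (extChartAt (𝓡 n) p).target →
    ∀ c, ContDiffAt ℝ ∞ (X p c) y
  eq : ∀ {p q : M} {y : Coord n}, y ∈ overlap p q →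
    ∀ c, ∑ m, jac (transition p q) y c m * X p m y = X q c (transition p q y)

variable [IsManifold (𝓡 n) ∞ M]

/-- The derivative of a function of the partition of unity along a vector field. -/
theorem IsVectorField.isScalarField {X : M → Fin n → Coord n → ℝ} (hX : IsVectorField X)
    (ρ : ChartPartition n M) (q : M) :
    IsScalarField fun p y => ∑ m, pderiv m (fun z => ρ.fn q ((extChartAt (𝓡 n) p).symm z)) y
      * X p m y where
  continuousOn p y hy := by
    refine ContinuousAt.continuousWithinAt (tendsto_finsetSum _ fun m _ => ?_)
    exact ((pderiv_contDiffAt m _ y (ρ.fn_symm_contDiffAt q p hy)).continuousAt).mul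
      (hX.smooth hy m).continuousAt
  eq {p p' y} hy := by
    have h1 : (fun z => ρ.fn q ((extChartAt (𝓡 n) p).symm z)) =ᶠ[𝓝 y]
        fun z => ρ.fn q ((extChartAt (𝓡 n) p').symm (transition p p' z)) := by
      filter_upwards [(isOpen_overlap p p').mem_nhds hy] with z hz
      rw [symm_transition hz]
    have h2 : ∀ m, pderiv m (fun z => ρ.fn q ((extChartAt (𝓡 n) p).symm z)) y
        = ∑ a, jac (transition p p') y a m
          * pderiv a (fun z => ρ.fn q ((extChartAt (𝓡 n) p').symm z)) (transition p p' y) := by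
      intro m
      rw [pderiv, h1.fderiv_eq]
      exact pderiv_comp (transition_contDiffAt hy)
        (ρ.fn_symm_contDiffAt q p' (transition_mem hy)).diffAt m
    simp only [h2, ← hX.eq hy, Finset.sum_mul, Finset.mul_sum]
    rw [Finset.sum_comm]
    exact Finset.sum_congr rfl fun a _ => Finset.sum_congr rfl fun m _ => by ring

variable [CompactSpace M] [MeasurableSpace M] [BorelSpace M]

/-- The integral of a divergence vanishes. Integrating by parts moves the derivatives to the
functions of the partition of unity, the sum of which is constant. -/
theorem IsVectorField.sum_integral_divergence_eq_zero {X : M → Fin n → Coord n → ℝ}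
    (hX : IsVectorField X) (ρ : ChartPartition n M) {b : Tensor2 n M} (hb : PosDet b) :
    ∑ q ∈ ρ.index, ∫ y, ρ.weight q y
      * ∑ m, pderiv m (fun z => √(comps b q z).det * X q m z) y = 0 := by
  have hsm : ∀ q m, ∀ y ∈ (extChartAt (𝓡 n) q).target,
      ContDiffAt ℝ ∞ (fun z => √(comps b q z).det * X q m z) y := fun q m y hy =>
    ((comps_smoothAt b q hy).det.sqrt (hb.comps_pos q hy).ne').mul (hX.smooth hy m)
  have hF := hX.isScalarField ρ
  set F : M → M → Coord n → ℝ := fun q p y =>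
    ∑ m, pderiv m (fun z => ρ.fn q ((extChartAt (𝓡 n) p).symm z)) y * X p m y with hFdef
  have h1 : ∀ q, ∫ y, ρ.weight q y * ∑ m, pderiv m (fun z => √(comps b q z).det * X q m z) y
      = -∫ m, ofCharts (F q) m ∂(riemVol b) := by
    intro q
    have hi1 : ∀ m ∈ Finset.univ, Integrable fun y =>
        ρ.weight q y * pderiv m (fun z => √(comps b q z).det * X q m z) y := fun m _ =>
      integrable_cutoff (fun y hy => (pderiv_contDiffAt m _ y
        (hsm q m y hy)).continuousAt.continuousWithinAt) (isOpen_target q)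
        (ρ.weight_contDiff q).continuous (ρ.hasCompactSupport_weight q) (ρ.tsupport_weight_subset q)
    have hsp : ∀ m, tsupport (pderiv m (ρ.weight q)) ⊆ tsupport (ρ.weight q) := fun m =>
      tsupport_fderiv_apply_subset ℝ (EuclideanSpace.single m 1)
    have hi2 : ∀ m ∈ Finset.univ, Integrable fun y =>
        pderiv m (ρ.weight q) y * (√(comps b q y).det * X q m y) := fun m _ =>
      integrable_cutoff (fun y hy => (hsm q m y hy).continuousAt.continuousWithinAt)
        (isOpen_target q)
        (((ρ.weight_contDiff q).continuous_fderiv (by simp)).clm_apply continuous_const)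
        ((ρ.hasCompactSupport_weight q).of_isClosed_subset (isClosed_tsupport _) (hsp m))
        ((hsp m).trans (ρ.tsupport_weight_subset q))
    simp only [Finset.mul_sum]
    rw [integral_finsetSum _ hi1, Finset.sum_congr rfl fun m _ =>
      integral_cutoff_mul_pderiv (isOpen_target q) (hsm q m) (ρ.weight_contDiff q)
        (ρ.hasCompactSupport_weight q) (ρ.tsupport_weight_subset q) m,
      Finset.sum_neg_distrib, ← integral_finsetSum _ hi2,
      integral_riemVol_of_source b q (hF q).continuous fun m hm => ?_,
      ← integral_indicator (isOpen_target q).measurableSet]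
    · congr 1
      refine integral_congr_ae (Eventually.of_forall fun y => ?_)
      by_cases hy : y ∈ (extChartAt (𝓡 n) q).target
      · simp only [Set.indicator_of_mem hy, (hF q).ofCharts_symm hy, ρ.pderiv_weight q hy,
          Finset.mul_sum]
        exact Finset.sum_congr rfl fun m _ => by ring
      · simp only [Set.indicator_of_notMem hy]
        refine Finset.sum_eq_zero fun m _ => ?_
        rw [image_eq_zero_of_notMem_tsupport fun h => hy (ρ.tsupport_weight_subset q (hsp m h)),
          zero_mul]
    · have hev : (fun z => ρ.fn q ((extChartAt (𝓡 n) m).symm z))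
          =ᶠ[𝓝 (extChartAt (𝓡 n) m m)] fun _ => 0 := by
        have hm' : m ∉ tsupport (ρ.fn q) := fun h => hm (ρ.tsupport_subset q h)
        have hc : ContinuousAt (extChartAt (𝓡 n) m).symm (extChartAt (𝓡 n) m m) :=
          continuousAt_extChartAt_symm m
        have := hc ((isClosed_tsupport (ρ.fn q)).isOpen_compl.mem_nhds
          (by rw [extChartAt_to_inv]; exact hm'))
        filter_upwards [this] with z hz using image_eq_zero_of_notMem_tsupport hz
      simp only [ofCharts, pderiv, hev.fderiv_eq]
      simp
  have hcont : ∀ q ∈ ρ.index, Integrable (ofCharts (F q)) (riemVol b) := fun q _ =>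
    (hF q).continuous.integrable_of_hasCompactSupport (HasCompactSupport.of_compactSpace _)
  simp only [h1]
  rw [Finset.sum_neg_distrib, ← integral_finsetSum _ hcont, neg_eq_zero]
  refine integral_eq_zero_of_ae (Eventually.of_forall fun m => ?_)
  have hmt := mem_extChartAt_target (I := 𝓡 n) m
  have h2 : ∀ k, ∑ q ∈ ρ.index, pderiv k (fun z => ρ.fn q ((extChartAt (𝓡 n) m).symm z))
      (extChartAt (𝓡 n) m m) = 0 := by
    intro k
    have h3 : (fun z => ∑ q ∈ ρ.index, ρ.fn q ((extChartAt (𝓡 n) m).symm z)) = fun _ => 1 :=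
      funext fun z => ρ.sum_eq_one _
    have h4 := fderiv_fun_sum (𝕜 := ℝ) (u := ρ.index)
      (A := fun q z => ρ.fn q ((extChartAt (𝓡 n) m).symm z)) (x := extChartAt (𝓡 n) m m)
      fun q _ => (ρ.fn_symm_contDiffAt q m hmt).diffAt
    rw [h3, fderiv_const_apply] at h4
    have h5 := congrArg (fun T : Coord n →L[ℝ] ℝ => T (EuclideanSpace.single k 1)) h4
    simp only [_root_.sum_apply, _root_.zero_apply] at h5
    exact h5.symm
  simp only [ofCharts, hFdef, Pi.zero_apply]
  rw [Finset.sum_comm]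
  simp only [← Finset.sum_mul, h2, zero_mul, Finset.sum_const_zero]

end Divergence

/-! ### The first variation of the Einstein--Hilbert functional -/

section FirstVariation

variable {n : ℕ} {M : Type*} [TopologicalSpace M] [ChartedSpace (Coord n) M]
  [IsManifold (𝓡 n) ∞ M]

theorem isMetricOn_comps {b : Tensor2 n M} (hs : IsSymmTensor b) (hb : PosDet b) (p : M) :
    IsMetricOn (comps b p) (extChartAt (𝓡 n) p).target where
  isOpen := isOpen_target p
  smooth _ hy := comps_smoothAt b p hy
  symm _ _ := comps_symm hs p _
  det_ne _ hy := (hb.comps_pos p hy).ne'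

theorem isPullbackOn_comps {b : Tensor2 n M} (hs : IsSymmTensor b) (hb : PosDet b) (p q : M) :
    IsPullbackOn (comps b q) (extChartAt (𝓡 n) q).target (transition p q) (comps b p)
      (overlap p q) where
  metric := isMetricOn_comps hs hb q
  metric' :=
    { isOpen := isOpen_overlap p q
      smooth := fun _ hy => comps_smoothAt b p hy.1
      symm := fun _ _ => comps_symm hs p _
      det_ne := fun _ hy => (hb.comps_pos p hy.1).ne' }
  mapsTo _ hy := transition_mem hy
  smooth _ hy := transition_contDiffAt hy
  eq _ hy := comps_transition b hy

theorem IsMetricOn.ricciLocal_smooth {G : Coord n → Matrix (Fin n) (Fin n) ℝ} {U : Set (Coord n)}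
    (hG : IsMetricOn G U) {y : Coord n} (hy : y ∈ U) : MatSmoothAt (ricciLocal G) y := by
  have hC := christoffel_contDiffAt G y (hG.smooth y hy) (hG.det_ne y hy)
  intro j k
  change ContDiffAt ℝ ∞ (fun z => ∑ i, riemann G i i j k z) y
  refine ContDiffAt.sum fun i _ => ?_
  exact ((pderiv_contDiffAt _ _ _ (hC _ _ _)).sub (pderiv_contDiffAt _ _ _ (hC _ _ _))).add
    (ContDiffAt.sum fun m _ => ((hC _ _ _).mul (hC _ _ _)).sub ((hC _ _ _).mul (hC _ _ _)))

theorem isScalarField_scal {b : Tensor2 n M} (hs : IsSymmTensor b) (hb : PosDet b) (c : ℝ) :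
    IsScalarField fun p y => scalLocal (comps b p) y + c where
  continuousOn p := by
    have hG := isMetricOn_comps hs hb p
    have h1 : ContinuousOn (fun y => ((comps b p y)⁻¹ * ricciLocal (comps b p) y).trace + c)
        (extChartAt (𝓡 n) p).target := fun y hy =>
      (((((hG.smooth y hy).inv (hG.det_ne y hy)).mul
        (hG.ricciLocal_smooth hy)).trace.continuousAt).add continuousAt_const).continuousWithinAt
    exact h1.congr fun y hy => by rw [IsPullbackOn.scal_eq_trace hG hy]
  eq {p q y} hy := by rw [(isPullbackOn_comps hs hb p q).scal_eq hy]

variable {E : Type*} [NormedAddCommGroup E] [NormedSpace ℝ E]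

/-- The Euler--Lagrange tensor `Ric - ½ (scal + (2 - n) λ) g` of the functional `S_λ`, for a family
of metrics. -/
def eulerTensor (lam : ℝ) (G : E × Coord n → Matrix (Fin n) (Fin n) ℝ) (x : E × Coord n) :
    Matrix (Fin n) (Fin n) ℝ :=
  famRicci G x - ((1 / 2) * (famScal G x + (2 - (n : ℝ)) * lam)) • G x

/-- The tensor `h` with both indices raised by the family of metrics `G`, multiplied with the volume
density. -/
def raised (G : E × Coord n → Matrix (Fin n) (Fin n) ℝ) (h : Coord n → Matrix (Fin n) (Fin n) ℝ)
    (x : E × Coord n) : Matrix (Fin n) (Fin n) ℝ :=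
  √(G x).det • ((G x)⁻¹ * h x.2 * (G x)⁻¹)

namespace IsFamilyOn

variable {G : E × Coord n → Matrix (Fin n) (Fin n) ℝ} {O : Set (E × Coord n)} {x : E × Coord n}

theorem eulerTensor_smooth (hG : IsFamilyOn G O) (hx : x ∈ O) (lam : ℝ) :
    MatSmoothAt (eulerTensor lam G) x :=
  (hG.famRicci_smooth hx).sub
    (MatSmoothAt.smul (contDiffAt_const.mul ((hG.famScal_smooth hx).add contDiffAt_const))
      (hG.smooth x hx))

theorem raised_smooth (hG : IsFamilyOn G O) (hx : x ∈ O)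
    {h : Coord n → Matrix (Fin n) (Fin n) ℝ} (hh : MatSmoothAt h x.2) :
    MatSmoothAt (raised G h) x :=
  MatSmoothAt.smul (hG.sqrt_det_smooth hx)
    (((hG.inv_smooth hx).mul (MatSmoothAt.comp (f := fun x : E × Coord n => x.2) hh
      contDiffAt_snd)).mul (hG.inv_smooth hx))

/-- The variation of the density of `S_λ` consists of the Euler--Lagrange term and a divergence. -/
theorem fderiv_scal_density_eq (hG : IsFamilyOn G O) (hx : x ∈ O) (hpos : 0 < (G x).det) (lam : ℝ)
    (w : E) {h : Coord n → Matrix (Fin n) (Fin n) ℝ} (hh : matDeriv G x (w, 0) = h x.2) :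
    fderiv ℝ (fun x => (famScal G x + (2 - (n : ℝ)) * lam) * √(G x).det) x (w, 0)
      = ∑ m, pderiv m (fun z => √(G (x.1, z)).det * varField G w m (x.1, z)) x.2
        - (eulerTensor lam G x * raised G h x).trace := by
  have hGW : G x * (G x)⁻¹ = 1 := Matrix.mul_nonsing_inv _ (hG.det_ne x hx).isUnit
  have e1 : (famRicci G x * raised G h x).trace
      = √(G x).det * ((G x)⁻¹ * famRicci G x * (G x)⁻¹ * h x.2).trace := by
    rw [raised, mul_smul_comm, Matrix.trace_smul, smul_eq_mul, ← mul_assoc, Matrix.trace_mul_comm]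
    simp only [mul_assoc]
  have e2 : (G x * raised G h x).trace = √(G x).det * ((G x)⁻¹ * h x.2).trace := by
    rw [raised, mul_smul_comm, Matrix.trace_smul, smul_eq_mul, ← mul_assoc, ← mul_assoc, hGW,
      one_mul, Matrix.trace_mul_comm]
  rw [hG.fderiv_scal_density hx hpos, hG.varField_divergence hx hpos, hh, eulerTensor,
    Matrix.sub_mul, Matrix.trace_sub, smul_mul_assoc, Matrix.trace_smul, e1, e2, smul_eq_mul]
  ring

end IsFamilyOn

variable {b : Tensor2 n M} {L : E →ₗ[ℝ] Tensor2 n M} {v : E}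

theorem IsSymmTensor.add_map (hb : IsSymmTensor b) (hL : ∀ w, IsSymmTensor (L w)) (v : E) :
    IsSymmTensor (b + L v) := fun p x y => by
  change b p x y + L v p x y = b p y x + L v p y x
  rw [hb, hL]

theorem mem_famDomain (hv : PosDet (b + L v)) (p : M) {y : Coord n}
    (hy : y ∈ (extChartAt (𝓡 n) p).target) : (v, y) ∈ famDomain b L p :=
  ⟨hy, hv.comps_pos p hy⟩

variable [FiniteDimensional ℝ E]

theorem scal_density_smooth (lam : ℝ) (hb : IsSymmTensor b) (hL : ∀ w, IsSymmTensor (L w)) (q : M)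
    {x : E × Coord n} (hx : x ∈ famDomain b L q) :
    ContDiffAt ℝ ∞ (fun x => (famScal (famComps b L q) x + (2 - (n : ℝ)) * lam)
      * √(famComps b L q x).det) x :=
  (((isFamilyOn_famComps hb hL).famScal_smooth hx).add contDiffAt_const).mul
    ((isFamilyOn_famComps hb hL).sqrt_det_smooth hx)

theorem isVectorField_varField (hb : IsSymmTensor b) (hL : ∀ w, IsSymmTensor (L w))
    (hv : PosDet (b + L v)) (w : E) :
    IsVectorField fun p c y => varField (famComps b L p) w c (v, y) where
  smooth {p y} hy c :=
    ((isFamilyOn_famComps hb hL).varField_smooth (mem_famDomain hv p hy) w c).comp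
      (f := fun z : Coord n => (v, z)) y (contDiffAt_slice (v, y))
  eq {p q y} hy c :=
    (isFamPullbackOn_famComps hb hL p q).jac_mul_varField (x := (v, y))
      ⟨mem_famDomain hv p hy.1, hy⟩ w c

variable [CompactSpace M]

/-- The sums of localized integrals by which integrals over `M` are computed depend smoothly on the
parameter. -/
theorem contDiffAt_sum_integral (ρ : ChartPartition n M) {f : M → E × Coord n → ℝ}
    (hf : ∀ q, ∀ x ∈ famDomain b L q, ContDiffAt ℝ ∞ (f q) x) (hv : PosDet (b + L v)) :
    ContDiffAt ℝ ∞ (fun v => ∑ q ∈ ρ.index, ∫ y, ρ.weight q y * f q (v, y)) v :=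
  ContDiffAt.sum fun q _ => contDiffAt_integral_cutoff isOpen_famDomain (hf q)
    (ρ.weight_contDiff q) (ρ.hasCompactSupport_weight q)
    fun _ hy => mem_famDomain hv q (ρ.tsupport_weight_subset q hy)

theorem fderiv_sum_integral (ρ : ChartPartition n M) {f : M → E × Coord n → ℝ}
    (hf : ∀ q, ∀ x ∈ famDomain b L q, ContDiffAt ℝ ∞ (f q) x) (hv : PosDet (b + L v)) (w : E) :
    fderiv ℝ (fun v => ∑ q ∈ ρ.index, ∫ y, ρ.weight q y * f q (v, y)) v w
      = ∑ q ∈ ρ.index, ∫ y, ρ.weight q y * fderiv ℝ (f q) (v, y) (w, 0) := by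
  have hmem : ∀ q, ∀ y ∈ tsupport (ρ.weight q), (v, y) ∈ famDomain b L q := fun q y hy =>
    mem_famDomain hv q (ρ.tsupport_weight_subset q hy)
  rw [fderiv_fun_sum fun q _ => (contDiffAt_integral_cutoff isOpen_famDomain (hf q)
    (ρ.weight_contDiff q) (ρ.hasCompactSupport_weight q) (hmem q)).diffAt]
  simp only [_root_.sum_apply]
  exact Finset.sum_congr rfl fun q _ => fderiv_integral_cutoff isOpen_famDomain (hf q)
    (ρ.weight_contDiff q) (ρ.hasCompactSupport_weight q) (hmem q) w

variable [MeasurableSpace M] [BorelSpace M]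

theorem einsteinHilbert_eq (ρ : ChartPartition n M) (lam : ℝ) {b : Tensor2 n M}
    (hs : IsSymmTensor b) (hb : PosDet b) :
    einsteinHilbert lam b = ∑ q ∈ ρ.index, ∫ y, ρ.weight q y
      * ((scalLocal (comps b q) y + (2 - (n : ℝ)) * lam) * √(comps b q y).det) :=
  ρ.integral_eq b (isScalarField_scal hs hb _)

theorem eventually_einsteinHilbert_eq (ρ : ChartPartition n M) (lam : ℝ) (hb : IsSymmTensor b)
    (hL : ∀ w, IsSymmTensor (L w)) (hv : PosDet (b + L v)) :
    (fun v => einsteinHilbert lam (b + L v)) =ᶠ[𝓝 v] fun v => ∑ q ∈ ρ.index, ∫ y, ρ.weight q y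
      * ((famScal (famComps b L q) (v, y) + (2 - (n : ℝ)) * lam)
        * √(famComps b L q (v, y)).det) := by
  filter_upwards [eventually_posDet hv] with u hu
  exact einsteinHilbert_eq ρ lam (hb.add_map hL u) hu

theorem einsteinHilbert_smooth [T2Space M] (lam : ℝ) (hb : IsSymmTensor b)
    (hL : ∀ w, IsSymmTensor (L w)) (hv : PosDet (b + L v)) :
    ContDiffAt ℝ ∞ (fun v => einsteinHilbert lam (b + L v)) v := by
  obtain ⟨ρ⟩ := nonempty_chartPartition (n := n) (M := M)
  refine ContDiffAt.congr_of_eventuallyEq ?_ (eventually_einsteinHilbert_eq ρ lam hb hL hv)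
  exact contDiffAt_sum_integral ρ (fun q _ => scal_density_smooth lam hb hL q) hv

/-- The first variation of `S_λ` is given by the Euler--Lagrange tensor. -/
theorem fderiv_einsteinHilbert (ρ : ChartPartition n M) (lam : ℝ) (hb : IsSymmTensor b)
    (hL : ∀ w, IsSymmTensor (L w)) (hv : PosDet (b + L v)) (w : E) :
    fderiv ℝ (fun v => einsteinHilbert lam (b + L v)) v w
      = ∑ q ∈ ρ.index, ∫ y, ρ.weight q y * -(eulerTensor lam (famComps b L q) (v, y)
        * raised (famComps b L q) (comps (L w) q) (v, y)).trace := by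
  have hmem : ∀ q, ∀ y ∈ tsupport (ρ.weight q), (v, y) ∈ famDomain b L q := fun q y hy =>
    mem_famDomain hv q (ρ.tsupport_weight_subset q hy)
  have hfam := fun q => isFamilyOn_famComps (p := q) hb hL
  rw [(eventually_einsteinHilbert_eq ρ lam hb hL hv).fderiv_eq,
    fderiv_sum_integral ρ (fun q _ => scal_density_smooth lam hb hL q) hv]
  have hX := (isVectorField_varField hb hL hv w)
  have hdiv := hX.sum_integral_divergence_eq_zero ρ hv
  have hi1 : ∀ q, Integrable fun y => ρ.weight q y * ∑ m, pderiv m (fun z =>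
      √(comps (b + L v) q z).det * varField (famComps b L q) w m (v, z)) y := fun q => by
    refine integrable_cutoff (U := (extChartAt (𝓡 n) q).target) (fun y hy =>
      ContinuousAt.continuousWithinAt (tendsto_finsetSum _ fun m _ => ?_)) (isOpen_target q)
      (ρ.weight_contDiff q).continuous (ρ.hasCompactSupport_weight q) (ρ.tsupport_weight_subset q)
    exact (pderiv_contDiffAt m _ y (((comps_smoothAt _ q hy).det.sqrt
      (hv.comps_pos q hy).ne').mul (hX.smooth hy m))).continuousAt
  have hi2 : ∀ q, Integrable fun y => ρ.weight q y * -(eulerTensor lam (famComps b L q) (v, y)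
      * raised (famComps b L q) (comps (L w) q) (v, y)).trace := fun q => by
    refine integrable_cutoff (U := (extChartAt (𝓡 n) q).target) (fun y hy =>
      ContinuousAt.continuousWithinAt ?_) (isOpen_target q)
      (ρ.weight_contDiff q).continuous (ρ.hasCompactSupport_weight q) (ρ.tsupport_weight_subset q)
    have hx := mem_famDomain hv q hy
    exact ((((hfam q).eulerTensor_smooth hx lam).mul
      ((hfam q).raised_smooth hx (comps_smoothAt (L w) q hy))).slice.trace.neg).continuousAt
  conv_rhs => rw [← zero_add (Finset.sum _ _), ← hdiv, ← Finset.sum_add_distrib]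
  refine Finset.sum_congr rfl fun q _ => ?_
  rw [← integral_add (hi1 q) (hi2 q)]
  refine integral_congr_ae (Eventually.of_forall fun y => ?_)
  by_cases hy : y ∈ tsupport (ρ.weight q)
  · have hyt := ρ.tsupport_weight_subset q hy
    simp only
    rw [(hfam q).fderiv_scal_density_eq (hmem q y hy) (hmem q y hy).2 lam w
      (matDeriv_famComps (x := (v, y)) hyt w), ← mul_add, sub_eq_add_neg]
    rfl
  · simp only [image_eq_zero_of_notMem_tsupport hy, zero_mul, add_zero]

end FirstVariation

/-! ### Iterated derivatives along lines -/

section Lines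

variable {E : Type*} [NormedAddCommGroup E] [NormedSpace ℝ E]

theorem deriv_line {f : E → ℝ} {u w : E} (hf : DifferentiableAt ℝ f u) :
    deriv (fun r : ℝ => f (u + r • w)) 0 = fderiv ℝ f u w := by
  have h1 : HasDerivAt (fun r : ℝ => u + r • w) w 0 := by
    simpa using ((hasDerivAt_id (0 : ℝ)).smul_const w).const_add u
  have h2 : HasFDerivAt f (fderiv ℝ f u) (u + (0 : ℝ) • w) := by simpa using hf.hasFDerivAt
  exact (h2.comp_hasDerivAt (0 : ℝ) h1).deriv

theorem deriv_deriv_line {f : E → ℝ} (hf : ∀ᶠ v in 𝓝 (0 : E), ContDiffAt ℝ ∞ f v) (w₁ w₂ : E) :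
    deriv (fun t : ℝ => deriv (fun s : ℝ => f (t • w₁ + s • w₂)) 0) 0
      = fderiv ℝ (fun v => fderiv ℝ f v w₂) 0 w₁ := by
  have hc : Tendsto (fun t : ℝ => t • w₁) (𝓝 0) (𝓝 (0 : E)) := by
    have : Continuous fun t : ℝ => t • w₁ := by fun_prop
    simpa using this.tendsto 0
  have h1 : (fun t : ℝ => deriv (fun s : ℝ => f (t • w₁ + s • w₂)) 0)
      =ᶠ[𝓝 0] fun t => fderiv ℝ f (0 + t • w₁) w₂ := by
    filter_upwards [hc.eventually hf] with t ht
    rw [deriv_line ht.diffAt, zero_add]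
  rw [h1.deriv_eq, deriv_line (f := fun v => fderiv ℝ f v w₂)]
  exact ((hf.self_of_nhds.fderiv_right (m := ∞) (by simp)).clm_apply contDiffAt_const).diffAt

theorem deriv_deriv_deriv_line {f : E → ℝ} (hf : ∀ᶠ v in 𝓝 (0 : E), ContDiffAt ℝ ∞ f v)
    (w₁ w₂ w₃ : E) :
    deriv (fun t : ℝ => deriv (fun s : ℝ => deriv (fun r : ℝ =>
        f (t • w₁ + s • w₂ + r • w₃)) 0) 0) 0
      = fderiv ℝ (fun v => fderiv ℝ (fun v => fderiv ℝ f v w₃) v w₂) 0 w₁ := by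
  have hc : Tendsto (fun x : ℝ × ℝ => x.1 • w₁ + x.2 • w₂) (𝓝 (0, 0)) (𝓝 (0 : E)) := by
    have : Continuous fun x : ℝ × ℝ => x.1 • w₁ + x.2 • w₂ := by fun_prop
    simpa using this.tendsto (0, 0)
  rw [← deriv_deriv_line (f := fun v => fderiv ℝ f v w₃) (hf.mono fun v hv =>
    (hv.fderiv_right (m := ∞) (by simp)).clm_apply contDiffAt_const)]
  refine EventuallyEq.deriv_eq ?_
  have h1 := (hc.eventually hf).curry_nhds
  filter_upwards [h1] with t ht
  refine EventuallyEq.deriv_eq ?_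
  filter_upwards [ht] with s hs
  rw [deriv_line hs.diffAt]

end Lines

/-! ### Infinitesimal Einstein deformations in charts -/

section Einstein

variable {n : ℕ} {E : Type*} [NormedAddCommGroup E] [NormedSpace ℝ E]

/-- Differentiation of a transformation law with respect to a parameter on which the change of
coordinates does not depend. -/
theorem matDeriv_conj {F F' : E × Coord n → Matrix (Fin n) (Fin n) ℝ} {v : E} {y y' : Coord n}
    {J : Matrix (Fin n) (Fin n) ℝ} (hF : MatSmoothAt F (v, y)) (hF' : MatSmoothAt F' (v, y'))
    (h : ∀ᶠ u in 𝓝 v, F' (u, y') = Jᵀ * F (u, y) * J) (w : E) :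
    matDeriv F' (v, y') (w, 0) = Jᵀ * matDeriv F (v, y) (w, 0) * J := by
  have h1 := matDeriv_congr h w
  rw [matDeriv_mul_const (F := fun u => Jᵀ * F (u, y))
    ((MatSmoothAt.const _).mul (MatSmoothAt.slice_left hF)),
    matDeriv_const_mul (F := fun u => F (u, y)) (MatSmoothAt.slice_left hF)] at h1
  have h2 := matDeriv_slice_left hF w
  have h3 := matDeriv_slice_left hF' w
  simp only at h2 h3
  rw [← h3, h1, h2]

variable {M : Type*} [TopologicalSpace M] [ChartedSpace (Coord n) M] [IsManifold (𝓡 n) ∞ M]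

theorem eq_zero_of_conj_eq_zero {J A : Matrix (Fin n) (Fin n) ℝ} (hJ : J.det ≠ 0)
    (h : Jᵀ * A * J = 0) : A = 0 := by
  have h1 : J * J⁻¹ = 1 := Matrix.mul_nonsing_inv _ hJ.isUnit
  have h2 : (J⁻¹)ᵀ * Jᵀ = 1 := by rw [← Matrix.transpose_mul, h1, Matrix.transpose_one]
  calc A = ((J⁻¹)ᵀ * Jᵀ) * A * (J * J⁻¹) := by rw [h1, h2, one_mul, mul_one]
    _ = (J⁻¹)ᵀ * (Jᵀ * A * J) * J⁻¹ := by noncomm_ring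
    _ = 0 := by rw [h, mul_zero, zero_mul]

variable {g : RiemMetric n M} {lam : ℝ} {h : Tensor2 n M}

/-- The Einstein equation, which is given at the centre of each chart, holds in the whole chart. -/
theorem _root_.IsEinstein.ricciLocal_eq (hE : IsEinstein g lam) {q : M} {y : Coord n}
    (hy : y ∈ (extChartAt (𝓡 n) q).target) :
    ricciLocal (comps (metricTensor g) q) y = lam • comps (metricTensor g) q y := by
  set m := (extChartAt (𝓡 n) q).symm y with hm
  have hov := mem_overlap_symm hy
  have h1 := hE m
  have hP := isPullbackOn_comps (isSymmTensor_metric g) (posDet_metric g) m q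
  rw [ricci, hP.ricci_eq hov, tensorAt, comps_transition _ hov, transition_symm hy] at h1
  refine sub_eq_zero.1 (eq_zero_of_conj_eq_zero (det_jac_transition_ne hov) ?_)
  rw [Matrix.mul_sub, Matrix.sub_mul, h1]
  simp only [mul_smul_comm, smul_mul_assoc, sub_self]

theorem traceT_eq_trace {b : Tensor2 n M} (hs : IsSymmTensor h) (p : M) :
    traceT b h p = ((tensorAt b p)⁻¹ * tensorAt h p).trace := by
  have h1 : ∀ i j, tensorAt h p i j = tensorAt h p j i := fun i j =>
    congrFun (congrFun (comps_symm hs p _) j) i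
  simp only [traceT, Matrix.trace, Matrix.diag, Matrix.mul_apply]
  exact Finset.sum_congr rfl fun i _ => Finset.sum_congr rfl fun j _ => by rw [h1 i j]

theorem _root_.IsInfinitesimalDeformation.trace_comps
    (hh : IsInfinitesimalDeformation g h) {q : M} {y : Coord n}
    (hy : y ∈ (extChartAt (𝓡 n) q).target) :
    ((comps (metricTensor g) q y)⁻¹ * comps h q y).trace = 0 := by
  set m := (extChartAt (𝓡 n) q).symm y with hm
  have hov := mem_overlap_symm hy
  have h1 := hh.trace_eq_zero m
  have hP := isPullbackOn_comps (isSymmTensor_metric g) (posDet_metric g) m q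
  rw [traceT_eq_trace hh.symm, tensorAt, tensorAt, comps_transition h hov,
    hP.trace_inv_mul hov, transition_symm hy] at h1
  exact h1

theorem _root_.IsInfinitesimalDeformation.divLocal_comps
    (hh : IsInfinitesimalDeformation g h) {q : M} {y : Coord n}
    (hy : y ∈ (extChartAt (𝓡 n) q).target) :
    divLocal (comps (metricTensor g) q) (comps h q) y = 0 := by
  set m := (extChartAt (𝓡 n) q).symm y with hm
  have hov := mem_overlap_symm hy
  have h1 := hh.div_eq_zero m
  have hP := isPullbackOn_comps (isSymmTensor_metric g) (posDet_metric g) m q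
  have h2 : (jac (transition m q) (extChartAt (𝓡 n) m m))ᵀ *ᵥ
      divLocal (comps (metricTensor g) q) (comps h q) y = 0 := by
    funext j
    have h3 := congrFun h1 j
    rw [divT, hP.div_eq hov (comps_smoothAt h q (transition_mem hov))
      (fun x hx => comps_transition h hx) j, transition_symm hy] at h3
    exact h3
  refine Matrix.eq_zero_of_mulVec_eq_zero ?_ h2
  rw [Matrix.det_transpose]
  exact det_jac_transition_ne hov

variable [FiniteDimensional ℝ E] {b : Tensor2 n M} {L : E →ₗ[ℝ] Tensor2 n M} {v : E}

theorem eventually_famRicci_transition (hb : IsSymmTensor b) (hL : ∀ w, IsSymmTensor (L w))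
    {p q : M} {y : Coord n} (hv : (v, y) ∈ famDomain b L p) (hy : y ∈ overlap p q) :
    ∀ᶠ u in 𝓝 v, famRicci (famComps b L p) (u, y) = (jac (transition p q) y)ᵀ
      * famRicci (famComps b L q) (u, transition p q y) * jac (transition p q) y := by
  have h1 : ∀ᶠ u in 𝓝 v, (u, y) ∈ famDomain b L p :=
    (isOpen_famDomain.preimage (by fun_prop : Continuous fun u : E => (u, y))).mem_nhds hv
  filter_upwards [h1] with u hu
  exact ((isFamPullbackOn_famComps hb hL p q).slice u).ricci_eq (x := y) ⟨hu, hy⟩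

/-- The derivative of the Ricci tensor is a tensor. -/
theorem matDeriv_famRicci_transition (hb : IsSymmTensor b) (hL : ∀ w, IsSymmTensor (L w))
    {p q : M} {y : Coord n} (hv : (v, y) ∈ famDomain b L p) (hy : y ∈ overlap p q) (w : E) :
    matDeriv (famRicci (famComps b L p)) (v, y) (w, 0) = (jac (transition p q) y)ᵀ
      * matDeriv (famRicci (famComps b L q)) (v, transition p q y) (w, 0)
      * jac (transition p q) y :=
  matDeriv_conj ((isFamilyOn_famComps hb hL).famRicci_smooth
      ((isFamPullbackOn_famComps hb hL p q).mapsTo (v, y) ⟨hv, hy⟩))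
    ((isFamilyOn_famComps hb hL).famRicci_smooth hv)
    (eventually_famRicci_transition hb hL hv hy) w

/-- The second derivative of the Ricci tensor of `b + L v` at `v = 0`, in the chart at `q`. -/
def ricciSndVar (b : Tensor2 n M) (L : E →ₗ[ℝ] Tensor2 n M) (w₁ w₂ : E) (q : M) (y : Coord n) :
    Matrix (Fin n) (Fin n) ℝ :=
  matDeriv (fun x => matDeriv (famRicci (famComps b L q)) x (w₂, 0)) (0, y) (w₁, 0)

theorem ricciSndVar_transition (hb : IsSymmTensor b) (hL : ∀ w, IsSymmTensor (L w))
    {p q : M} {y : Coord n} (hv : (0, y) ∈ famDomain b L p) (hy : y ∈ overlap p q) (w₁ w₂ : E) :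
    ricciSndVar b L w₁ w₂ p y = (jac (transition p q) y)ᵀ
      * ricciSndVar b L w₁ w₂ q (transition p q y) * jac (transition p q) y := by
  refine matDeriv_conj (((isFamilyOn_famComps hb hL).famRicci_smooth
      ((isFamPullbackOn_famComps hb hL p q).mapsTo (0, y) ⟨hv, hy⟩)).matDeriv _)
    (((isFamilyOn_famComps hb hL).famRicci_smooth hv).matDeriv _) ?_ w₁
  have h1 : ∀ᶠ u in 𝓝 (0 : E), (u, y) ∈ famDomain b L p :=
    (isOpen_famDomain.preimage (by fun_prop : Continuous fun u : E => (u, y))).mem_nhds hv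
  filter_upwards [h1] with u hu using matDeriv_famRicci_transition hb hL hu hy w₂

end Einstein

/-! ### Variations of an Einstein metric by infinitesimal deformations -/

section LocalCongruence

variable {n : ℕ} {G h h' : Coord n → Matrix (Fin n) (Fin n) ℝ} {y : Coord n}

theorem covLocal_congr (H : h =ᶠ[𝓝 y] h') (k i j : Fin n) :
    covLocal G h k i j =ᶠ[𝓝 y] covLocal G h' k i j := by
  filter_upwards [H.eventuallyEq_nhds] with z hz
  have h1 : (fun z => h z i j) =ᶠ[𝓝 z] fun z => h' z i j := hz.mono fun u hu => by simp only [hu]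
  simp only [covLocal, pderiv, h1.fderiv_eq, hz.eq_of_nhds]

theorem divLocal_congr (H : h =ᶠ[𝓝 y] h') : divLocal G h y = divLocal G h' y := by
  funext j
  simp only [divLocal, (covLocal_congr H _ _ _).eq_of_nhds]

theorem einsteinOpLocal_congr (H : h =ᶠ[𝓝 y] h') :
    einsteinOpLocal G h y = einsteinOpLocal G h' y := by
  have h1 : ∀ m k i j, covLocal₂ G h m k i j y = covLocal₂ G h' m k i j y := by
    intro m k i j
    simp only [covLocal₂, pderiv, (covLocal_congr H _ _ _).fderiv_eq,
      (covLocal_congr H _ _ _).eq_of_nhds]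
  simp only [einsteinOpLocal, roughLaplacianLocal, curvActionLocal, h1, H.eq_of_nhds]

end LocalCongruence

section EinsteinVariation

variable {n : ℕ} {E : Type*} [NormedAddCommGroup E] [NormedSpace ℝ E]
  {M : Type*} [TopologicalSpace M] [ChartedSpace (Coord n) M] [IsManifold (𝓡 n) ∞ M]
  {g : RiemMetric n M} {lam : ℝ} {L : E →ₗ[ℝ] Tensor2 n M} {q : M} {y : Coord n}

theorem famComps_zero (b : Tensor2 n M) (L : E →ₗ[ℝ] Tensor2 n M) (q : M) (y : Coord n) :
    famComps b L q (0, y) = comps b q y := by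
  rw [famComps_apply, comps_map_zero, add_zero]

theorem posDet_zero (g : RiemMetric n M) (L : E →ₗ[ℝ] Tensor2 n M) :
    PosDet (metricTensor g + L 0) := by
  rw [map_zero, add_zero]
  exact posDet_metric g

theorem famRicci_zero (hE : IsEinstein g lam) (hy : y ∈ (extChartAt (𝓡 n) q).target) :
    famRicci (famComps (metricTensor g) L q) (0, y)
      = lam • famComps (metricTensor g) L q (0, y) := by
  have h1 : (fun z => famComps (metricTensor g) L q (0, z)) = comps (metricTensor g) q :=
    funext fun z => famComps_zero _ _ _ _
  rw [famRicci, famComps_zero]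
  simp only
  rw [h1, hE.ricciLocal_eq hy]

/-- The trace of an infinitesimal deformation vanishes. -/
theorem trace_mul_raised_zero (hL : ∀ w, IsInfinitesimalDeformation g (L w))
    (hy : y ∈ (extChartAt (𝓡 n) q).target) (w : E) :
    (famComps (metricTensor g) L q (0, y)
      * raised (famComps (metricTensor g) L q) (comps (L w) q) (0, y)).trace = 0 := by
  have hG : comps (metricTensor g) q y * (comps (metricTensor g) q y)⁻¹ = 1 :=
    Matrix.mul_nonsing_inv _ ((posDet_metric g).comps_pos q hy).ne'.isUnit
  rw [raised, famComps_zero, mul_smul_comm, Matrix.trace_smul, ← mul_assoc, ← mul_assoc, hG,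
    one_mul, Matrix.trace_mul_comm, (hL w).trace_comps hy, smul_zero]

/-- The second derivative of a product, the first factor of which vanishes to first order. -/
theorem fderiv_fderiv_trace_mul {F H : E → Matrix (Fin n) (Fin n) ℝ} {x v w : E}
    (hF : ∀ᶠ z in 𝓝 x, MatSmoothAt F z) (hH : ∀ᶠ z in 𝓝 x, MatSmoothAt H z) (h0 : F x = 0)
    (hv : matDeriv F x v = 0) (hw : matDeriv F x w = 0) :
    fderiv ℝ (fun z => fderiv ℝ (fun z => (F z * H z).trace) z w) x v
      = (matDeriv (fun z => matDeriv F z w) x v * H x).trace := by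
  have h1 : (fun z => fderiv ℝ (fun z => (F z * H z).trace) z w) =ᶠ[𝓝 x] fun z =>
      (matDeriv F z w * H z + F z * matDeriv H z w).trace := by
    filter_upwards [hF, hH] with z hz hz'
    rw [fderiv_trace (hz.mul hz'), matDeriv_mul hz hz']
  have hF' := hF.self_of_nhds
  have hH' := hH.self_of_nhds
  rw [h1.fderiv_eq, fderiv_trace (((hF'.matDeriv w).mul hH').add (hF'.mul (hH'.matDeriv w))),
    matDeriv_add ((hF'.matDeriv w).mul hH') (hF'.mul (hH'.matDeriv w)),
    matDeriv_mul (hF'.matDeriv w) hH', matDeriv_mul hF' (hH'.matDeriv w), h0, hv, hw]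
  simp only [zero_mul, add_zero]

variable [FiniteDimensional ℝ E]

/-- Infinitesimal Einstein deformations satisfy the linearized Einstein equation
`D Ric (h) = λ h`. -/
theorem matDeriv_famRicci_zero (hE : IsEinstein g lam)
    (hL : ∀ w, IsInfinitesimalDeformation g (L w)) (hy : y ∈ (extChartAt (𝓡 n) q).target) (w : E) :
    matDeriv (famRicci (famComps (metricTensor g) L q)) (0, y) (w, 0)
      = lam • comps (L w) q y := by
  have hs := isSymmTensor_metric g
  have hLs : ∀ w, IsSymmTensor (L w) := fun w => (hL w).symm
  set m := (extChartAt (𝓡 n) q).symm y with hm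
  have hov := mem_overlap_symm hy
  have h0 : ∀ p, (fun z => famComps (metricTensor g) L p (0, z)) = comps (metricTensor g) p :=
    fun p => funext fun z => famComps_zero _ _ _ _
  have hd : ∀ z ∈ (extChartAt (𝓡 n) m).target,
      (fun z => matDeriv (famComps (metricTensor g) L m) (0, z) (w, 0)) =ᶠ[𝓝 z]
        comps (L w) m := fun z hz => by
    filter_upwards [(isOpen_target m).mem_nhds hz] with u hu
    exact matDeriv_famComps (x := (0, u)) hu w
  -- the equation in the chart at the point, where the Einstein operator is given
  have h1 := (isFamilyOn_famComps (p := m) hs hLs).matDeriv_famRicci_eq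
    (x := ((0 : E), extChartAt (𝓡 n) m m)) (w := w) (lam := lam)
    (mem_famDomain (posDet_zero g L) m (mem_extChartAt_target m))
    (fun z hz => by
      rw [matDeriv_famComps hz.1]
      simp only
      rw [famComps_zero]
      exact (hL w).trace_comps hz.1)
    (fun z hz => by
      simp only
      rw [h0, divLocal_congr (hd z hz.1)]
      exact (hL w).divLocal_comps hz.1)
    (by
      simp only
      rw [h0, einsteinOpLocal_congr (hd _ (mem_extChartAt_target m))]
      exact (hL w).einsteinOp_eq_zero m)
    (famRicci_zero hE (mem_extChartAt_target m))
  rw [matDeriv_famComps (x := ((0 : E), extChartAt (𝓡 n) m m)) (mem_extChartAt_target m),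
    matDeriv_famRicci_transition hs hLs
      (mem_famDomain (posDet_zero g L) m (mem_extChartAt_target m)) hov] at h1
  simp only at h1
  rw [comps_transition _ hov, transition_symm hy] at h1
  refine sub_eq_zero.1 (eq_zero_of_conj_eq_zero (det_jac_transition_ne hov) ?_)
  rw [Matrix.mul_sub, Matrix.sub_mul, h1]
  simp only [mul_smul_comm, smul_mul_assoc, sub_self]

theorem famScal_zero (hE : IsEinstein g lam) (hL : ∀ w, IsSymmTensor (L w))
    (hy : y ∈ (extChartAt (𝓡 n) q).target) :
    famScal (famComps (metricTensor g) L q) (0, y) = n * lam := by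
  have hx := mem_famDomain (posDet_zero g L) q hy
  have hfam := isFamilyOn_famComps (p := q) (isSymmTensor_metric g) hL
  rw [hfam.famScal_eq hx, famRicci_zero hE hy, mul_smul_comm,
    Matrix.nonsing_inv_mul _ (hfam.det_ne _ hx).isUnit, Matrix.trace_smul, Matrix.trace_one,
    Fintype.card_fin, smul_eq_mul, mul_comm]

/-- The scalar curvature is constant to first order. -/
theorem fderiv_famScal_zero (hE : IsEinstein g lam)
    (hL : ∀ w, IsInfinitesimalDeformation g (L w)) (hy : y ∈ (extChartAt (𝓡 n) q).target) (w : E) :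
    fderiv ℝ (famScal (famComps (metricTensor g) L q)) (0, y) (w, 0) = 0 := by
  have hx := mem_famDomain (posDet_zero g L) q hy
  have hfam := isFamilyOn_famComps (p := q) (isSymmTensor_metric g) fun w => (hL w).symm
  have hW := Matrix.nonsing_inv_mul _ (hfam.det_ne _ hx).isUnit
  rw [hfam.fderiv_famScal hx, matDeriv_famRicci_zero hE hL hy, famRicci_zero hE hy,
    mul_smul_comm, mul_smul_comm, hW, matDeriv_famComps (x := ((0 : E), y)) hy]
  simp only [smul_mul_assoc, one_mul]
  ring

theorem eulerTensor_zero (hE : IsEinstein g lam) (hL : ∀ w, IsSymmTensor (L w))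
    (hy : y ∈ (extChartAt (𝓡 n) q).target) (μ : ℝ) :
    eulerTensor μ (famComps (metricTensor g) L q) (0, y)
      = ((1 / 2) * (2 - (n : ℝ)) * (lam - μ)) • famComps (metricTensor g) L q (0, y) := by
  rw [eulerTensor, famRicci_zero hE hy, famScal_zero hE hL hy, ← sub_smul]
  congr 1
  ring

theorem matDeriv_eulerTensor (hL : ∀ w, IsSymmTensor (L w)) {x : E × Coord n}
    (hx : x ∈ famDomain (metricTensor g) L q) (w : E) :
    matDeriv (eulerTensor lam (famComps (metricTensor g) L q)) x (w, 0)
      = matDeriv (famRicci (famComps (metricTensor g) L q)) x (w, 0)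
        - (((1 / 2) * fderiv ℝ (famScal (famComps (metricTensor g) L q)) x (w, 0))
            • famComps (metricTensor g) L q x
          + ((1 / 2) * (famScal (famComps (metricTensor g) L q) x + (2 - (n : ℝ)) * lam))
            • comps (L w) q x.2) := by
  have hfam := isFamilyOn_famComps (p := q) (isSymmTensor_metric g) hL
  have hs := (hfam.famScal_smooth hx)
  have hs2 : ContDiffAt ℝ ∞ (fun x => (1 / 2) * (famScal (famComps (metricTensor g) L q) x
      + (2 - (n : ℝ)) * lam)) x := contDiffAt_const.mul (hs.add contDiffAt_const)
  have e1 := matDeriv_sub (hfam.famRicci_smooth hx) (MatSmoothAt.smul hs2 (hfam.smooth x hx)) (w, 0)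
  rw [matDeriv_smul hs2 (hfam.smooth x hx), matDeriv_famComps hx.1,
    fderiv_const_mul (hs.add contDiffAt_const).diffAt, fderiv_add_const] at e1
  exact e1

/-- The Euler--Lagrange tensor vanishes to first order. -/
theorem matDeriv_eulerTensor_zero (hE : IsEinstein g lam)
    (hL : ∀ w, IsInfinitesimalDeformation g (L w)) (hy : y ∈ (extChartAt (𝓡 n) q).target) (w : E) :
    matDeriv (eulerTensor lam (famComps (metricTensor g) L q)) (0, y) (w, 0) = 0 := by
  rw [matDeriv_eulerTensor (fun w => (hL w).symm) (mem_famDomain (posDet_zero g L) q hy),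
    matDeriv_famRicci_zero hE hL hy, fderiv_famScal_zero hE hL hy,
    famScal_zero hE (fun w => (hL w).symm) hy, mul_zero, zero_smul, zero_add, ← sub_smul]
  rw [show lam - 1 / 2 * (n * lam + (2 - (n : ℝ)) * lam) = 0 by ring, zero_smul]

/-- The second derivative of the Euler--Lagrange tensor is, up to a multiple of the metric, the
second derivative of the Ricci tensor. -/
theorem matDeriv_matDeriv_eulerTensor_zero (hE : IsEinstein g lam)
    (hL : ∀ w, IsInfinitesimalDeformation g (L w)) (hy : y ∈ (extChartAt (𝓡 n) q).target)
    (w₁ w₂ : E) : ∃ c : ℝ,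
    matDeriv (fun x => matDeriv (eulerTensor lam (famComps (metricTensor g) L q)) x (w₂, 0))
        (0, y) (w₁, 0)
      = ricciSndVar (metricTensor g) L w₁ w₂ q y
        - c • famComps (metricTensor g) L q (0, y) := by
  set G := famComps (metricTensor g) L q with hG
  have hLs : ∀ w, IsSymmTensor (L w) := fun w => (hL w).symm
  have hfam := isFamilyOn_famComps (p := q) (isSymmTensor_metric g) hLs
  have hx := mem_famDomain (posDet_zero g L) q hy
  have hs := hfam.famScal_smooth hx
  have h1 : (fun x => matDeriv (eulerTensor lam G) x (w₂, 0)) =ᶠ[𝓝 (0, y)] fun x =>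
      matDeriv (famRicci G) x (w₂, 0) - (((1 / 2) * fderiv ℝ (famScal G) x (w₂, 0)) • G x
        + ((1 / 2) * (famScal G x + (2 - (n : ℝ)) * lam)) • comps (L w₂) q x.2) := by
    filter_upwards [hfam.mem_nhds hx] with x hx using matDeriv_eulerTensor hLs hx w₂
  have hd : ContDiffAt ℝ ∞ (fun x => (1 / 2) * fderiv ℝ (famScal G) x (w₂, 0)) (0, y) :=
    contDiffAt_const.mul ((hs.fderiv_right (m := ∞) (by simp)).clm_apply contDiffAt_const)
  have hc : ContDiffAt ℝ ∞ (fun x => (1 / 2) * (famScal G x + (2 - (n : ℝ)) * lam)) (0, y) :=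
    contDiffAt_const.mul (hs.add contDiffAt_const)
  have hh : MatSmoothAt (fun x : E × Coord n => comps (L w₂) q x.2) (0, y) :=
    MatSmoothAt.comp (f := fun x : E × Coord n => x.2) (comps_smoothAt (L w₂) q hy)
      contDiffAt_snd
  have hh0 : matDeriv (fun x : E × Coord n => comps (L w₂) q x.2) (0, y) (w₁, 0) = 0 := by
    rw [← matDeriv_slice_left hh]
    exact matDeriv_const (E := E) (comps (L w₂) q y) w₁
  refine ⟨fderiv ℝ (fun x => (1 / 2) * fderiv ℝ (famScal G) x (w₂, 0)) (0, y) (w₁, 0), ?_⟩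
  rw [matDeriv_congr h1, matDeriv_sub ((hfam.famRicci_smooth hx).matDeriv _)
    ((MatSmoothAt.smul hd (hfam.smooth _ hx)).add (MatSmoothAt.smul hc hh)),
    matDeriv_add (MatSmoothAt.smul hd (hfam.smooth _ hx)) (MatSmoothAt.smul hc hh),
    matDeriv_smul hd (hfam.smooth _ hx), matDeriv_smul hc hh, hh0,
    fderiv_famScal_zero hE hL hy, fderiv_const_mul (hs.add contDiffAt_const).diffAt,
    fderiv_add_const, _root_.smul_apply, fderiv_famScal_zero hE hL hy]
  simp only [mul_zero, smul_zero, zero_smul, add_zero]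
  rfl

end EinsteinVariation

/-! ### The third variation of the Einstein--Hilbert functional -/

section ThirdVariation

variable {n : ℕ} {E : Type*} [NormedAddCommGroup E] [NormedSpace ℝ E]
  {M : Type*} [TopologicalSpace M] [ChartedSpace (Coord n) M] [IsManifold (𝓡 n) ∞ M]
  {g : RiemMetric n M} {lam : ℝ} {L : E →ₗ[ℝ] Tensor2 n M}

/-- The scalar product `⟨∂²Ric(w₁, w₂), L w₃⟩` of the second derivative of the Ricci tensor with a
tensor of the family, in the charts. -/
def ricciPairing (b : Tensor2 n M) (L : E →ₗ[ℝ] Tensor2 n M) (w₁ w₂ w₃ : E) (p : M)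
    (y : Coord n) : ℝ :=
  (ricciSndVar b L w₁ w₂ p y * ((comps b p y)⁻¹ * comps (L w₃) p y * (comps b p y)⁻¹)).trace

theorem innerT_eq_trace {b h : Tensor2 n M} (hb : IsSymmTensor b) (hh : IsSymmTensor h)
    (A : M → Matrix (Fin n) (Fin n) ℝ) (p : M) :
    innerT b A (tensorAt h) p
      = (A p * ((tensorAt b p)⁻¹ * tensorAt h p * (tensorAt b p)⁻¹)).trace := by
  have h1 : ∀ i j, tensorAt h p i j = tensorAt h p j i := fun i j =>
    congrFun (congrFun (comps_symm hh p _) j) i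
  have h2 : ∀ i j, (tensorAt b p)⁻¹ i j = (tensorAt b p)⁻¹ j i := fun i j => by
    have : ((tensorAt b p)⁻¹)ᵀ = (tensorAt b p)⁻¹ := by
      rw [Matrix.transpose_nonsing_inv, tensorAt, comps_symm hb]
    exact congrFun (congrFun this j) i
  simp only [innerT, Matrix.trace, Matrix.diag, Matrix.mul_apply, Finset.mul_sum, Finset.sum_mul]
  refine Finset.sum_congr rfl fun i _ => Finset.sum_congr rfl fun j _ =>
    Finset.sum_congr rfl fun k _ => Finset.sum_congr rfl fun l _ => ?_
  rw [h1 k l, h2 i k]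
  ring

/-- The integral of the scalar curvature is the functional `S_λ` for `λ = 0`. -/
theorem einsteinTensor_add_map [MeasurableSpace M] (b : Tensor2 n M) (L : E →ₗ[ℝ] Tensor2 n M)
    (p : M) (v : E) :
    einsteinTensor (b + L v) p = famRicci (famComps b L p) (v, extChartAt (𝓡 n) p p)
      - ((1 / (n : ℝ)) * einsteinHilbert 0 (b + L v))
        • famComps b L p (v, extChartAt (𝓡 n) p p) := by
  simp only [einsteinTensor, einsteinHilbert, mul_zero, add_zero]
  rfl

variable [FiniteDimensional ℝ E]

theorem isScalarField_ricciPairing (hL : ∀ w, IsSymmTensor (L w)) (w₁ w₂ w₃ : E) :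
    IsScalarField (ricciPairing (metricTensor g) L w₁ w₂ w₃) where
  continuousOn p y hy := by
    have hG := isMetricOn_comps (isSymmTensor_metric g) (posDet_metric g) p
    have hx := mem_famDomain (posDet_zero g L) p hy
    have hR : MatSmoothAt (ricciSndVar (metricTensor g) L w₁ w₂ p) y :=
      ((((isFamilyOn_famComps (isSymmTensor_metric g) hL).famRicci_smooth hx).matDeriv
        (w₂, 0)).matDeriv (w₁, 0)).slice
    have hW := (hG.smooth y hy).inv (hG.det_ne y hy)
    exact ((hR.mul ((hW.mul (comps_smoothAt (L w₃) p hy)).mul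
      hW)).trace).continuousAt.continuousWithinAt
  eq {p q y} hy := by
    have hP := isPullbackOn_comps (isSymmTensor_metric g) (posDet_metric g) p q
    have hx := mem_famDomain (posDet_zero g L) p hy.1
    have h1 := hP.jac_mul_inv_mul hy
    rw [ricciPairing, ricciPairing, ricciSndVar_transition (isSymmTensor_metric g) hL hx hy,
      comps_transition (L w₃) hy, ← h1]
    set J := jac (transition p q) y
    set W := (comps (metricTensor g) p y)⁻¹
    rw [mul_assoc Jᵀ, mul_assoc Jᵀ, Matrix.trace_mul_comm Jᵀ]
    congr 1
    noncomm_ring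

variable [CompactSpace M]

theorem eventually_posDet_zero (g : RiemMetric n M) (L : E →ₗ[ℝ] Tensor2 n M) :
    ∀ᶠ v in 𝓝 (0 : E), PosDet (metricTensor g + L v) := eventually_posDet (posDet_zero g L)

variable [T2Space M] [MeasurableSpace M] [BorelSpace M]

/-- The third derivative of `S_λ` in directions of infinitesimal Einstein deformations. The first
variation is differentiated twice under the integral sign; since the Euler--Lagrange tensor vanishes
to first order, only its second derivative remains. -/
theorem fderiv_fderiv_fderiv_einsteinHilbert (hE : IsEinstein g lam)
    (hL : ∀ w, IsInfinitesimalDeformation g (L w)) (w₁ w₂ w₃ : E) :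
    fderiv ℝ (fun v => fderiv ℝ (fun v => fderiv ℝ
        (fun v => einsteinHilbert lam (metricTensor g + L v)) v w₃) v w₂) 0 w₁
      = -∫ m, ofCharts (ricciPairing (metricTensor g) L w₁ w₂ w₃) m
        ∂(riemVol (metricTensor g)) := by
  obtain ⟨ρ⟩ := nonempty_chartPartition (n := n) (M := M)
  have hs := isSymmTensor_metric g
  have hLs : ∀ w, IsSymmTensor (L w) := fun w => (hL w).symm
  have hfam := fun q => isFamilyOn_famComps (p := q) hs hLs
  set G := fun q => famComps (metricTensor g) L q with hG
  set f : M → E × Coord n → ℝ := fun q x =>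
    -(eulerTensor lam (G q) x * raised (G q) (comps (L w₃) q) x).trace with hf
  have hfs : ∀ q, ∀ x ∈ famDomain (metricTensor g) L q, ContDiffAt ℝ ∞ (f q) x := fun q x hx =>
    (((hfam q).eulerTensor_smooth hx lam).mul
      ((hfam q).raised_smooth hx (comps_smoothAt (L w₃) q hx.1))).trace.neg
  have e1 : ∀ v, PosDet (metricTensor g + L v) →
      fderiv ℝ (fun v => fderiv ℝ
          (fun v => einsteinHilbert lam (metricTensor g + L v)) v w₃) v w₂
        = ∑ q ∈ ρ.index, ∫ y, ρ.weight q y * fderiv ℝ (f q) (v, y) (w₂, 0) := fun v hv => by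
    have : (fun v => fderiv ℝ (fun v => einsteinHilbert lam (metricTensor g + L v)) v w₃) =ᶠ[𝓝 v]
        fun v => ∑ q ∈ ρ.index, ∫ y, ρ.weight q y * f q (v, y) := by
      filter_upwards [eventually_posDet hv] with u hu
      exact fderiv_einsteinHilbert ρ lam hs hLs hu w₃
    rw [this.fderiv_eq, fderiv_sum_integral ρ hfs hv]
  have e2 : (fun v => fderiv ℝ (fun v => fderiv ℝ
          (fun v => einsteinHilbert lam (metricTensor g + L v)) v w₃) v w₂) =ᶠ[𝓝 0]
      fun v => ∑ q ∈ ρ.index, ∫ y, ρ.weight q y * fderiv ℝ (f q) (v, y) (w₂, 0) := by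
    filter_upwards [eventually_posDet_zero g L] with v hv using e1 v hv
  rw [e2.fderiv_eq, fderiv_sum_integral ρ (fun q x hx => ((hfs q x hx).fderiv_right (m := ∞)
    (by simp)).clm_apply contDiffAt_const) (posDet_zero g L),
    ρ.integral_eq _ (isScalarField_ricciPairing hLs w₁ w₂ w₃), ← Finset.sum_neg_distrib]
  refine Finset.sum_congr rfl fun q _ => ?_
  rw [← integral_neg]
  refine integral_congr_ae (Eventually.of_forall fun y => ?_)
  by_cases hyt : y ∈ tsupport (ρ.weight q)
  · have hy := ρ.tsupport_weight_subset q hyt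
    have hx := mem_famDomain (posDet_zero g L) q hy
    have hn : ∀ᶠ x in 𝓝 ((0 : E), y), x ∈ famDomain (metricTensor g) L q :=
      (hfam q).mem_nhds hx
    obtain ⟨c, hc⟩ := matDeriv_matDeriv_eulerTensor_zero hE hL hy w₁ w₂
    have h0 : eulerTensor lam (G q) (0, y) = 0 := by
      rw [eulerTensor_zero hE hLs hy, sub_self, mul_zero, zero_smul]
    have h2 := fderiv_fderiv_trace_mul (hn.mono fun x hx => (hfam q).eulerTensor_smooth hx lam)
      (hn.mono fun x hx => (hfam q).raised_smooth hx (comps_smoothAt (L w₃) q hx.1)) h0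
      (matDeriv_eulerTensor_zero hE hL hy w₁) (matDeriv_eulerTensor_zero hE hL hy w₂)
    have h3 : (fun x => fderiv ℝ (f q) x (w₂, 0)) = fun x => -(fderiv ℝ (fun x =>
        (eulerTensor lam (G q) x * raised (G q) (comps (L w₃) q) x).trace) x (w₂, 0)) := by
      funext x
      simp only [hf]
      rw [fderiv_fun_neg, _root_.neg_apply]
    simp only
    rw [h3, fderiv_fun_neg, _root_.neg_apply, h2, hc, Matrix.sub_mul, Matrix.trace_sub,
      smul_mul_assoc, Matrix.trace_smul, trace_mul_raised_zero hL hy, smul_zero, sub_zero, raised,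
      famComps_zero, mul_smul_comm, Matrix.trace_smul, smul_eq_mul, ricciPairing]
    ring
  · simp only [image_eq_zero_of_notMem_tsupport hyt, zero_mul, neg_zero]

/-- The total scalar curvature is constant to first order. -/
theorem fderiv_einsteinHilbert_zero (hE : IsEinstein g lam)
    (hL : ∀ w, IsInfinitesimalDeformation g (L w)) (μ : ℝ) (w : E) :
    fderiv ℝ (fun v => einsteinHilbert μ (metricTensor g + L v)) 0 w = 0 := by
  obtain ⟨ρ⟩ := nonempty_chartPartition (n := n) (M := M)
  have hLs : ∀ w, IsSymmTensor (L w) := fun w => (hL w).symm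
  rw [fderiv_einsteinHilbert ρ μ (isSymmTensor_metric g) hLs (posDet_zero g L)]
  refine Finset.sum_eq_zero fun q _ => integral_eq_zero_of_ae (Eventually.of_forall fun y => ?_)
  by_cases hyt : y ∈ tsupport (ρ.weight q)
  · have hy := ρ.tsupport_weight_subset q hyt
    simp only [Pi.zero_apply]
    rw [eulerTensor_zero hE hLs hy, smul_mul_assoc, Matrix.trace_smul,
      trace_mul_raised_zero hL hy, smul_zero, neg_zero, mul_zero]
  · simp only [image_eq_zero_of_notMem_tsupport hyt, zero_mul, Pi.zero_apply]

/-! ### The second derivative of the Einstein tensor -/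

theorem einsteinTensor_smooth (hL : ∀ w, IsSymmTensor (L w)) {v : E}
    (hv : PosDet (metricTensor g + L v)) (p : M) :
    MatSmoothAt (fun v => einsteinTensor (metricTensor g + L v) p) v := by
  have hs := isSymmTensor_metric g
  have hx := mem_famDomain hv p (mem_extChartAt_target (I := 𝓡 n) p)
  have hfam := isFamilyOn_famComps (p := p) hs hL
  simp only [einsteinTensor_add_map]
  exact (hfam.famRicci_smooth hx).slice_left.sub (MatSmoothAt.smul
    (contDiffAt_const.mul (einsteinHilbert_smooth 0 hs hL hv)) (hfam.smooth _ hx).slice_left)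

/-- In the directions of infinitesimal Einstein deformations, `D²E` differs from the second
derivative of the Ricci tensor by a constant multiple of the metric, because the total scalar
curvature is constant to first order. -/
theorem D2E_eq (hE : IsEinstein g lam) (hL : ∀ w, IsInfinitesimalDeformation g (L w))
    (w₁ w₂ : E) : ∃ c : ℝ, ∀ p, D2E (metricTensor g) (L w₁) (L w₂) p
      = ricciSndVar (metricTensor g) L w₁ w₂ p (extChartAt (𝓡 n) p p)
        - c • tensorAt (metricTensor g) p := by
  have hs := isSymmTensor_metric g
  have hLs : ∀ w, IsSymmTensor (L w) := fun w => (hL w).symm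
  set a : E → ℝ := fun v => (1 / (n : ℝ)) * einsteinHilbert 0 (metricTensor g + L v) with ha
  have hsm : ∀ {v}, PosDet (metricTensor g + L v) → ContDiffAt ℝ ∞ a v := fun hv =>
    contDiffAt_const.mul (einsteinHilbert_smooth 0 hs hLs hv)
  have ha0 : ∀ w, fderiv ℝ a 0 w = 0 := fun w => by
    rw [ha, fderiv_const_mul (einsteinHilbert_smooth 0 hs hLs (posDet_zero g L)).diffAt,
      _root_.smul_apply, fderiv_einsteinHilbert_zero hE hL, smul_zero]
  refine ⟨fderiv ℝ (fun v => fderiv ℝ a v w₂) 0 w₁, fun p => ?_⟩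
  set y := extChartAt (𝓡 n) p p with hy
  have hyt : y ∈ (extChartAt (𝓡 n) p).target := mem_extChartAt_target p
  set G := famComps (metricTensor g) L p with hG
  have hfam : IsFamilyOn G _ := isFamilyOn_famComps (p := p) hs hLs
  set F : E → Matrix (Fin n) (Fin n) ℝ := fun v => einsteinTensor (metricTensor g + L v) p with hF
  have h1 : D2E (metricTensor g) (L w₁) (L w₂) p
      = matDeriv (fun v => matDeriv F v w₂) 0 w₁ := by
    ext i j
    have h2 := deriv_deriv_line (f := fun v => F v i j) ((eventually_posDet_zero g L).mono
      fun v hv => einsteinTensor_smooth hLs hv p i j) w₁ w₂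
    simp only [hF, map_add, map_smul, ← add_assoc] at h2
    exact h2
  have h3 : (fun v => matDeriv F v w₂) =ᶠ[𝓝 0] fun v => matDeriv (famRicci G) (v, y) (w₂, 0)
      - (fderiv ℝ a v w₂ • G (v, y) + a v • comps (L w₂) p y) := by
    filter_upwards [eventually_posDet_zero g L] with v hv
    have hx := mem_famDomain hv p hyt
    have e1 := matDeriv_sub (hfam.famRicci_smooth hx).slice_left
      (MatSmoothAt.smul (hsm hv) (hfam.smooth _ hx).slice_left) w₂
    rw [matDeriv_smul (hsm hv) (hfam.smooth _ hx).slice_left,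
      matDeriv_slice_left (hfam.famRicci_smooth hx), matDeriv_slice_left (hfam.smooth _ hx),
      matDeriv_famComps (x := (v, y)) hyt] at e1
    rw [← e1]
    congr 1
    funext v
    exact einsteinTensor_add_map _ _ _ _
  have hx := mem_famDomain (posDet_zero g L) p hyt
  have h0 := hsm (posDet_zero g L)
  have hR := ((hfam.famRicci_smooth hx).matDeriv (w₂, 0))
  have hG0 := (hfam.smooth _ hx).slice_left
  have hda : ContDiffAt ℝ ∞ (fun v => fderiv ℝ a v w₂) 0 :=
    (h0.fderiv_right (m := ∞) (by simp)).clm_apply contDiffAt_const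
  have hc : MatSmoothAt (fun _ : E => comps (L w₂) p y) 0 := MatSmoothAt.const _
  have h4 := matDeriv_congr h3 w₁
  rw [matDeriv_sub hR.slice_left ((MatSmoothAt.smul hda hG0).add (MatSmoothAt.smul h0 hc)),
    matDeriv_add (MatSmoothAt.smul hda hG0) (MatSmoothAt.smul h0 hc), matDeriv_smul hda hG0,
    matDeriv_smul h0 hc, matDeriv_const, ha0, ha0, matDeriv_slice_left hR] at h4
  rw [h1, h4]
  simp only [zero_smul, smul_zero, add_zero, hG, famComps_zero]
  rfl

/-- The pairing of `D²E` with an infinitesimal deformation. The multiples of the metric in `D²E` do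
not contribute. -/
theorem innerT_D2E (hE : IsEinstein g lam) (hL : ∀ w, IsInfinitesimalDeformation g (L w))
    (w₁ w₂ w₃ : E) :
    innerT (metricTensor g) (D2E (metricTensor g) (L w₁) (L w₂)) (tensorAt (L w₃))
      = ofCharts (ricciPairing (metricTensor g) L w₁ w₂ w₃) := by
  funext p
  obtain ⟨c, hc⟩ := D2E_eq hE hL w₁ w₂
  have hG : tensorAt (metricTensor g) p * (tensorAt (metricTensor g) p)⁻¹ = 1 :=
    Matrix.mul_nonsing_inv _ (posDet_metric g p).ne'.isUnit
  have h1 : ((tensorAt (metricTensor g) p)⁻¹ * tensorAt (L w₃) p).trace = 0 :=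
    (hL w₃).trace_comps (mem_extChartAt_target p)
  rw [innerT_eq_trace (isSymmTensor_metric g) (hL w₃).symm, hc, Matrix.sub_mul, Matrix.trace_sub,
    smul_mul_assoc, Matrix.trace_smul, ← mul_assoc (tensorAt _ _), ← mul_assoc (tensorAt _ _), hG,
    one_mul, Matrix.trace_mul_comm (tensorAt (L w₃) p), h1, smul_zero, sub_zero]
  rfl

/-- The iterated one-variable derivatives of `thirdVariation` as Fréchet derivatives. -/
theorem thirdVariation_eq (hL : ∀ w, IsSymmTensor (L w)) (w₁ w₂ w₃ : E) :
    thirdVariation lam (metricTensor g) (L w₁) (L w₂) (L w₃)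
      = fderiv ℝ (fun v => fderiv ℝ (fun v => fderiv ℝ
        (fun v => einsteinHilbert lam (metricTensor g + L v)) v w₃) v w₂) 0 w₁ := by
  rw [← deriv_deriv_deriv_line ((eventually_posDet_zero g L).mono fun v hv =>
    einsteinHilbert_smooth lam (isSymmTensor_metric g) hL hv)]
  simp only [map_add, map_smul, ← add_assoc]
  rfl

theorem innerL2_D2E (hE : IsEinstein g lam) (hL : ∀ w, IsInfinitesimalDeformation g (L w))
    (w₁ w₂ w₃ : E) :
    innerL2 (metricTensor g) (D2E (metricTensor g) (L w₁) (L w₂)) (tensorAt (L w₃))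
      = -thirdVariation lam (metricTensor g) (L w₁) (L w₂) (L w₃) := by
  rw [innerL2, innerT_D2E hE hL, thirdVariation_eq fun w => (hL w).symm,
    fderiv_fderiv_fderiv_einsteinHilbert hE hL, neg_neg]

end ThirdVariation

/-! ### The symmetric trilinear form on the infinitesimal Einstein deformations -/

section TrilinearForm

variable {n : ℕ} {M : Type*} [TopologicalSpace M] [ChartedSpace (Coord n) M]
  [IsManifold (𝓡 n) ∞ M] {g : RiemMetric n M} {lam : ℝ}

/-- The family `(t, s, r) ↦ t h + s k + r l`. -/
def threeParam (h k l : Tensor2 n M) : ℝ × ℝ × ℝ →ₗ[ℝ] Tensor2 n M where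
  toFun v := v.1 • h + v.2.1 • k + v.2.2 • l
  map_add' v w := by
    simp only [Prod.fst_add, Prod.snd_add, add_smul]
    abel
  map_smul' c v := by
    simp only [Prod.smul_fst, Prod.smul_snd, smul_eq_mul, mul_smul, smul_add, RingHom.id_apply]

theorem threeParam_apply (h k l : Tensor2 n M) (v : ℝ × ℝ × ℝ) :
    threeParam h k l v = v.1 • h + v.2.1 • k + v.2.2 • l := rfl

theorem threeParam_fst (h k l : Tensor2 n M) : threeParam h k l (1, 0, 0) = h := by
  simp [threeParam_apply]

theorem threeParam_snd (h k l : Tensor2 n M) : threeParam h k l (0, 1, 0) = k := by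
  simp [threeParam_apply]

theorem threeParam_trd (h k l : Tensor2 n M) : threeParam h k l (0, 0, 1) = l := by
  simp [threeParam_apply]

theorem isInfinitesimalDeformation_threeParam {h k l : Tensor2 n M} (hh : h ∈ infDef g)
    (hk : k ∈ infDef g) (hl : l ∈ infDef g) (v : ℝ × ℝ × ℝ) :
    IsInfinitesimalDeformation g (threeParam h k l v) :=
  (infDef g).add_mem ((infDef g).add_mem ((infDef g).smul_mem _ hh) ((infDef g).smul_mem _ hk))
    ((infDef g).smul_mem _ hl)

variable [T2Space M] [CompactSpace M] [MeasurableSpace M] [BorelSpace M] {h k l : Tensor2 n M}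

theorem integrable_innerT_D2E (hE : IsEinstein g lam) (hh : h ∈ infDef g) (hk : k ∈ infDef g)
    (hl : l ∈ infDef g) :
    Integrable (innerT (metricTensor g) (D2E (metricTensor g) h k) (tensorAt l))
      (riemVol (metricTensor g)) := by
  have hL := isInfinitesimalDeformation_threeParam hh hk hl
  have h1 := innerT_D2E hE hL (1, 0, 0) (0, 1, 0) (0, 0, 1)
  rw [threeParam_fst, threeParam_snd, threeParam_trd] at h1
  rw [h1]
  exact Continuous.integrable_of_hasCompactSupport
    (isScalarField_ricciPairing (fun w => (hL w).symm) _ _ _).continuous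
    (HasCompactSupport.of_compactSpace _)

theorem innerL2_D2E_eq (hE : IsEinstein g lam) (hh : h ∈ infDef g) (hk : k ∈ infDef g)
    (hl : l ∈ infDef g) :
    innerL2 (metricTensor g) (D2E (metricTensor g) h k) (tensorAt l)
      = -thirdVariation lam (metricTensor g) h k l := by
  have h1 := innerL2_D2E hE (isInfinitesimalDeformation_threeParam hh hk hl)
    (1, 0, 0) (0, 1, 0) (0, 0, 1)
  rwa [threeParam_fst, threeParam_snd, threeParam_trd] at h1

/-- The third variation is symmetric because iterated derivatives commute. -/
theorem thirdVariation_symm (hh : h ∈ infDef g) (hk : k ∈ infDef g) (hl : l ∈ infDef g) :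
    thirdVariation lam (metricTensor g) h k l = thirdVariation lam (metricTensor g) k h l ∧
      thirdVariation lam (metricTensor g) h k l = thirdVariation lam (metricTensor g) h l k := by
  have hL : ∀ v, IsSymmTensor (threeParam h k l v) := fun v =>
    (isInfinitesimalDeformation_threeParam hh hk hl v).symm
  have h1 := thirdVariation_eq (g := g) (lam := lam) hL
  have hS : ∀ {v}, PosDet (metricTensor g + threeParam h k l v) → ContDiffAt ℝ ∞
      (fun v => einsteinHilbert lam (metricTensor g + threeParam h k l v)) v :=
    fun hv => einsteinHilbert_smooth lam (isSymmTensor_metric g) hL hv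
  have e1 := h1 (1, 0, 0) (0, 1, 0) (0, 0, 1)
  have e2 := h1 (0, 1, 0) (1, 0, 0) (0, 0, 1)
  have e3 := h1 (1, 0, 0) (0, 0, 1) (0, 1, 0)
  rw [threeParam_fst, threeParam_snd, threeParam_trd] at e1 e2 e3
  rw [e1, e2, e3]
  refine ⟨fderiv_fderiv_comm (((hS (posDet_zero g _)).fderiv_right (m := ∞)
    (by simp)).clm_apply contDiffAt_const) _ _, ?_⟩
  have h2 : (fun v => fderiv ℝ (fun v => fderiv ℝ (fun v => einsteinHilbert lam (metricTensor g
        + threeParam h k l v)) v (0, 0, 1)) v (0, 1, 0))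
      =ᶠ[𝓝 0] fun v => fderiv ℝ (fun v => fderiv ℝ (fun v => einsteinHilbert lam (metricTensor g
        + threeParam h k l v)) v (0, 1, 0)) v (0, 0, 1) := by
    filter_upwards [eventually_posDet_zero g (threeParam h k l)] with v hv
    exact fderiv_fderiv_comm (hS hv) _ _
  rw [h2.fderiv_eq]

/-- The form `(h, k, l) ↦ (D²E(h, k), l)` on the infinitesimal Einstein deformations. -/
def koisoForm (g : RiemMetric n M) (h k l : infDef g) : ℝ :=
  innerL2 (metricTensor g) (D2E (metricTensor g) h k) (tensorAt (l : Tensor2 n M))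

theorem koisoForm_symm (hE : IsEinstein g lam) (h k l : infDef g) :
    koisoForm g h k l = koisoForm g k h l ∧ koisoForm g h k l = koisoForm g h l k := by
  have h1 := thirdVariation_symm (lam := lam) h.2 k.2 l.2
  simp only [koisoForm]
  rw [innerL2_D2E_eq hE h.2 k.2 l.2, innerL2_D2E_eq hE k.2 h.2 l.2, innerL2_D2E_eq hE h.2 l.2 k.2]
  exact ⟨congrArg Neg.neg h1.1, congrArg Neg.neg h1.2⟩

theorem koisoForm_linear (hE : IsEinstein g lam) (h k l l' : infDef g) (a : ℝ) :
    koisoForm g h k (a • l + l') = a * koisoForm g h k l + koisoForm g h k l' := by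
  have h1 : innerT (metricTensor g) (D2E (metricTensor g) h k)
        (tensorAt ((a • l + l' : infDef g) : Tensor2 n M))
      = fun p => a * innerT (metricTensor g) (D2E (metricTensor g) h k) (tensorAt l) p
        + innerT (metricTensor g) (D2E (metricTensor g) h k) (tensorAt l') p := by
    funext p
    have h2 : tensorAt ((a • l + l' : infDef g) : Tensor2 n M) p
        = a • tensorAt (l : Tensor2 n M) p + tensorAt (l' : Tensor2 n M) p := rfl
    simp only [innerT, h2, Matrix.add_apply, Matrix.smul_apply, smul_eq_mul, Finset.mul_sum,
      ← Finset.sum_add_distrib]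
    refine Finset.sum_congr rfl fun i _ => Finset.sum_congr rfl fun j _ =>
      Finset.sum_congr rfl fun k _ => Finset.sum_congr rfl fun l _ => ?_
    ring
  simp only [koisoForm, innerL2]
  rw [h1, integral_add ((integrable_innerT_D2E hE h.2 k.2 l.2).const_mul a)
    (integrable_innerT_D2E hE h.2 k.2 l'.2), integral_const_mul]

/-- The symmetric form `koisoForm` as a trilinear map. By symmetry it suffices that it is linear in
its last argument. -/
def koisoTrilinear (hE : IsEinstein g lam) :
    infDef g →ₗ[ℝ] infDef g →ₗ[ℝ] infDef g →ₗ[ℝ] ℝ :=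
  have hs := koisoForm_symm hE
  have hadd : ∀ h k l l', koisoForm g h k (l + l') = koisoForm g h k l + koisoForm g h k l' :=
    fun h k l l' => by simpa using koisoForm_linear hE h k l l' 1
  have h0 : ∀ h k, koisoForm g h k 0 = 0 := fun h k => by simpa using hadd h k 0 0
  have hsmul : ∀ a h k l, koisoForm g h k (a • l) = a * koisoForm g h k l :=
    fun a h k l => by simpa [h0] using koisoForm_linear hE h k l 0 a
  LinearMap.mk₂ ℝ
    (fun h k =>
      { toFun := koisoForm g h k
        map_add' := hadd h k
        map_smul' := fun a l => hsmul a h k l })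
    (fun h h' k => LinearMap.ext fun l => by
      change koisoForm g (h + h') k l = koisoForm g h k l + koisoForm g h' k l
      rw [(hs (h + h') k l).1, (hs k (h + h') l).2, hadd, (hs k l h).2, (hs k h l).1, (hs k l h').2,
        (hs k h' l).1])
    (fun a h k => LinearMap.ext fun l => by
      change koisoForm g (a • h) k l = a * koisoForm g h k l
      rw [(hs (a • h) k l).1, (hs k (a • h) l).2, hsmul, (hs k l h).2, (hs k h l).1])
    (fun h k k' => LinearMap.ext fun l => by
      change koisoForm g h (k + k') l = koisoForm g h k l + koisoForm g h k' l
      rw [(hs h (k + k') l).2, hadd, (hs h l k).2, (hs h l k').2])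
    (fun a h k => LinearMap.ext fun l => by
      change koisoForm g h (a • k) l = a * koisoForm g h k l
      rw [(hs h (a • k) l).2, hsmul, (hs h l k).2])

/-- Polarization: a symmetric trilinear form that vanishes on the diagonal is zero on all triples
of the form `(h, h, k)`. -/
theorem exists_diag_ne_zero {V : Type*} [AddCommGroup V] [Module ℝ V]
    (Φ : V →ₗ[ℝ] V →ₗ[ℝ] V →ₗ[ℝ] ℝ)
    (hΦ : ∀ h k l, Φ h k l = Φ k h l ∧ Φ h k l = Φ h l k) {h k : V} (hne : Φ h h k ≠ 0) :
    ∃ l, Φ l l l ≠ 0 := by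
  by_contra! H
  refine hne ?_
  have h1 := H (h + k)
  have h2 := H (h - k)
  have e1 : Φ h k h = Φ h h k := (hΦ h k h).2
  have e2 : Φ k h h = Φ h h k := by rw [(hΦ k h h).1, e1]
  have e3 : Φ k h k = Φ h k k := (hΦ k h k).1
  have e4 : Φ k k h = Φ h k k := by rw [(hΦ k k h).2, e3]
  simp only [map_add, map_sub, LinearMap.add_apply, LinearMap.sub_apply, H, e1, e2, e3, e4] at h1 h2
  linarith

end TrilinearForm

end EinsteinDeformation

end

open EinsteinDeformation

theorem mainTheorem4 {n : ℕ} {M : Type*} [TopologicalSpace M] [T2Space M] [CompactSpace M]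
    [MeasurableSpace M] [BorelSpace M]
    [ChartedSpace (Coord n) M] [IsManifold (𝓡 n) ∞ M]
    (g : RiemMetric n M) (lam : ℝ) (hE : IsEinstein g lam)
    (hvol : riemVol (metricTensor g) Set.univ = 1) :
    -- the second derivative of `E` exists, and the integrals that define the form converge
    (∀ h ∈ infDef g, ∀ k ∈ infDef g, ∀ (p : M) (i j : Fin n),
      ContDiffAt ℝ 2 (fun v : ℝ × ℝ =>
        einsteinTensor (metricTensor g + v.1 • h + v.2 • k) p i j) 0) ∧
    (∀ h ∈ infDef g, ∀ k ∈ infDef g, ∀ l ∈ infDef g,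
      MeasureTheory.Integrable
        (innerT (metricTensor g) (D2E (metricTensor g) h k) (tensorAt l))
        (riemVol (metricTensor g))) ∧
    -- `S_λ` is three times differentiable in the directions of `ε(g)`
    (∀ h ∈ infDef g, ∀ k ∈ infDef g, ∀ l ∈ infDef g,
      ContDiffAt ℝ 3 (fun v : ℝ × ℝ × ℝ =>
        einsteinHilbert lam (metricTensor g + v.1 • h + v.2.1 • k + v.2.2 • l)) 0) ∧
    -- `Φ(h, k, l) = (D²E(h, k), l)` is a trilinear form on `ε(g)`, it is minus the third variation
    -- of `S_λ` and totally symmetric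
    (∃ Φ : infDef g →ₗ[ℝ] infDef g →ₗ[ℝ] infDef g →ₗ[ℝ] ℝ,
      (∀ h k l : infDef g, Φ h k l =
        innerL2 (metricTensor g) (D2E (metricTensor g) h k) (tensorAt l)) ∧
      (∀ h k l : infDef g, Φ h k l = -thirdVariation lam (metricTensor g) h k l) ∧
      (∀ h k l : infDef g, Φ h k l = Φ k h l ∧ Φ h k l = Φ h l k)) ∧
    -- the consequence for the Koiso obstruction
    ((∃ h ∈ infDef g, ∃ k ∈ infDef g,
        innerL2 (metricTensor g) (D2E (metricTensor g) h h) (tensorAt k) ≠ 0) →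
      ∃ l ∈ infDef g,
        innerL2 (metricTensor g) (D2E (metricTensor g) l l) (tensorAt l) ≠ 0) := by
  have hsymm : ∀ {h k l : Tensor2 n M}, h ∈ infDef g → k ∈ infDef g → l ∈ infDef g → ∀ v,
      IsSymmTensor (threeParam h k l v) := fun hh hk hl v =>
    (isInfinitesimalDeformation_threeParam hh hk hl v).symm
  have hΦ : ∀ h k l : infDef g, koisoTrilinear hE h k l = koisoTrilinear hE k h l ∧
      koisoTrilinear hE h k l = koisoTrilinear hE h l k := koisoForm_symm hE
  refine ⟨fun h hh k hk p i j => ?_, fun h hh k hk l hl => integrable_innerT_D2E hE hh hk hl,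
    fun h hh k hk l hl => ?_, ⟨koisoTrilinear hE, fun _ _ _ => rfl,
      fun h k l => innerL2_D2E_eq hE h.2 k.2 l.2, hΦ⟩, ?_⟩
  -- the two-parameter family is the restriction of a three-parameter family with `l = 0`
  · have h0 := (infDef g).zero_mem
    have h1 := einsteinTensor_smooth (hsymm hh hk h0) (v := ((0 : ℝ × ℝ).1, (0 : ℝ × ℝ).2, 0))
      (posDet_zero g _) p i j
    have h2 : ContDiffAt ℝ ∞ (fun v : ℝ × ℝ => (v.1, v.2, (0 : ℝ))) 0 :=
      contDiffAt_fst.prodMk (contDiffAt_snd.prodMk contDiffAt_const)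
    refine ((ContDiffAt.comp (f := fun v : ℝ × ℝ => (v.1, v.2, (0 : ℝ))) 0 h1 h2).of_le
      (WithTop.coe_le_coe.2 le_top : ((2 : ℕ∞) : WithTop ℕ∞) ≤ ∞)).congr_of_eventuallyEq
        (Filter.Eventually.of_forall fun v => ?_)
    simp only [Function.comp, threeParam_apply, smul_zero, add_zero, ← add_assoc]
  · refine ((einsteinHilbert_smooth lam (isSymmTensor_metric g) (hsymm hh hk hl)
      (posDet_zero g _)).of_le
        (WithTop.coe_le_coe.2 le_top : ((3 : ℕ∞) : WithTop ℕ∞) ≤ ∞)).congr_of_eventuallyEq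
        (Filter.Eventually.of_forall fun v => ?_)
    simp only [threeParam_apply, ← add_assoc]
  · rintro ⟨h, hh, k, hk, hne⟩
    obtain ⟨l, hl⟩ := exists_diag_ne_zero (koisoTrilinear hE) hΦ (h := ⟨h, hh⟩) (k := ⟨k, hk⟩) hne
    exact ⟨l, l.2, hl⟩
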